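/- All languages are sets of binary strings; $|x|$ is the length of $x$. A polynomial-time probabilistic Turing machine is a polynomial-time Turing machine that receives, next to its input, polynomially many (in the input size) independent fair random bits. Let $\mathcal C$ be the class of languages $L$ for which there exist a polynomial-time probabilistic Turing machine $M$, a polynomial $N$, and distributions $\mathcal D_n$ on $\{0,1\}^n$ ($n\ge 0$) that can be sampled by one polynomial-time probabilistic Turing machine on input $1^n$, such that the following holds. For an input $x$ with $|x|=n$, the machine $M$ receives $x$ and a training set $\mathcal T=\{(x_i,y_i)\}_{i=1}^{N(n)}$, where the $x_i$ are independent samples from $\mathcal D_n$, and $y_i=1$ if $x_i\in L$ and $y_i=0$ otherwise. Over the training set and the random bits of $M$, the probability that $M$ outputs $1$ is at least $2/3$ for every $x\in L$ and at most $1/3$ for every $x\notin L$. Then: 1. $\mathrm{BPP}\subseteq\mathcal C$. 2. $\mathcal C\subseteq\mathrm{P/poly}$, where $\mathrm{P/poly}$ is the class of languages decided by a polynomial-time deterministic Turing machine with a polynomial-size advice string that depends only on the input size. 3. Let $A\subseteq\mathbb N$ be such that the unary language $L_{\mathrm{hard}}=\{1^n : n\in A\}$ is undecidable, and let $L_{\mathrm{easy}}\in\mathrm{BPP}$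 be such that for every $n\ge 1$ there are strings $a_n\in L_{\mathrm{easy}}$ and $b_n\notin L_{\mathrm{easy}}$ of length $n$. Put $$L=\bigcup_{n\ge 1}\{x : |x|=n,\ (x\in L_{\mathrm{easy}}\text{ and }1^n\in L_{\mathrm{hard}})\text{ or }(x\notin L_{\mathrm{easy}}\text{ and }1^n\notin L_{\mathrm{hard}})\}.$$ Then $L\in\mathcal C$, $L\notin\mathrm{BPP}$ and $L\notin\mathrm{BQP}$, where $\mathrm{BQP}$ is the class of languages decided with error at most $1/3$ by polynomial-time uniform families of quantum circuits over the gates $H$, $T$ and $\mathrm{CNOT}$. 4. In particular, some language lies in $\mathcal C$ but neither in $\mathrm{BPP}$ nor in $\mathrm{BQP}$. -/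

import Mathlib

open scoped ENNReal

noncomputable section

namespace DataLearning

/-! ### Encodings and polynomial-time functions -/

/-- A finite list of binary strings, written with an end marker `none` after each string. -/
def encStrings (ws : List (List Bool)) : List (Option Bool) :=
  ws.flatMap fun w => w.map some ++ [none]

/-- The unary word `1ⁿ`. -/
def ones (n : ℕ) : List Bool := List.replicate n true

/-- A pair of binary strings as an input tape. -/
def encPair (p : List Bool × List Bool) : List (Option Bool) := encStrings [p.1, p.2]

/-- The pair `(1ⁿ, r)` as an input tape. -/
def encUnaryPair (p : ℕ × List Bool) : List (Option Bool) := encStrings [ones p.1, p.2]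

/-- A training set `(x₁, y₁), …, (x_N, y_N)`: examples with their labels. -/
abbrev TrainingSet := List (List Bool × Bool)

/-- An input `x`, a training set and a string of random bits as an input tape. -/
def encLearner (p : List Bool × TrainingSet × List Bool) : List (Option Bool) :=
  encStrings (p.1 :: p.2.2 :: p.2.1.flatMap fun s => [s.1, [s.2]])

/-- `f` is computed by a Turing machine in time polynomial in the length of the encoded input. -/
def PolyTime {α β αΓ βΓ : Type} (ea : α → List αΓ) (eb : β → List βΓ) (f : α → β) : Prop :=
  Nonempty (Turing.TM2ComputableInPolyTime ea eb f)

/-! ### Random strings and samples -/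

/-- The law of a list of `N` independent samples from `μ`. -/
def iid {α : Type} (μ : PMF α) : ℕ → PMF (List α)
  | 0 => PMF.pure []
  | N + 1 => μ.bind fun a => (iid μ N).map fun l => a :: l

/-- The law of `m` independent fair random bits. -/
def randomBits (m : ℕ) : PMF (List Bool) := iid (PMF.uniformOfFintype Bool) m

/-! ### Classical complexity classes

A polynomial-time probabilistic Turing machine is a polynomial-time Turing machine that is given,
next to its input, a string of independent fair random bits whose number is a polynomial of the
input size. -/

/-- Bounded-error probabilistic polynomial time. -/
def BPP : Set (Language Bool) :=
  {L | ∃ (M : List Bool × List Bool → Bool) (p : Polynomial ℕ),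
    PolyTime encPair Computability.encodeBool M ∧
    ∀ x : List Bool,
      (x ∈ L → 2 / 3 ≤ ((randomBits (p.eval x.length)).map fun r => M (x, r)) true) ∧
      (x ∉ L → ((randomBits (p.eval x.length)).map fun r => M (x, r)) true ≤ 1 / 3)}

/-- Polynomial time with polynomial-size advice that depends only on the input length. -/
def PPoly : Set (Language Bool) :=
  {L | ∃ (M : List Bool × List Bool → Bool) (a : ℕ → List Bool) (q : Polynomial ℕ),
    PolyTime encPair Computability.encodeBool M ∧
    (∀ n, (a n).length ≤ q.eval n) ∧
    ∀ x : List Bool, x ∈ L ↔ M (x, a x.length) = true}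

/-- `D n` is a distribution on the strings of length `n`, and a polynomial-time probabilistic
Turing machine that is given `1ⁿ` outputs a sample of `D n`. -/
def PolyTimeSamplable (D : ℕ → PMF (List Bool)) : Prop :=
  (∀ n, ∀ z ∈ (D n).support, z.length = n) ∧
  ∃ (S : ℕ × List Bool → List Bool) (s : Polynomial ℕ),
    PolyTime encUnaryPair (id : List Bool → List Bool) S ∧
    ∀ n, D n = (randomBits (s.eval n)).map fun r => S (n, r)

open Classical in
/-- The examples in the list, each labelled by its membership in `L`. -/
def labelled (L : Language Bool) (zs : List (List Bool)) : TrainingSet :=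
  zs.map fun z => (z, decide (z ∈ L))

/-- The probability that `M` outputs `1` on the input `x`, when it receives a training set of `N`
examples that are sampled independently from `μ` and labelled by `L`, and `m` random bits. -/
def acceptProb (L : Language Bool) (M : List Bool × TrainingSet × List Bool → Bool)
    (μ : PMF (List Bool)) (N m : ℕ) (x : List Bool) : ℝ≥0∞ :=
  ((iid μ N).bind fun zs => (randomBits m).map fun r => M (x, labelled L zs, r)) true

/-- The languages decided with bounded error by polynomial-time probabilistic Turing machines that
learn from data: on inputs of size `n` the machine also receives polynomially many labelled
examples, drawn independently from a distribution `D n` that can be sampled in polynomial time. -/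
def BPPData : Set (Language Bool) :=
  {L | ∃ (M : List Bool × TrainingSet × List Bool → Bool) (D : ℕ → PMF (List Bool))
      (N p : Polynomial ℕ),
    PolyTime encLearner Computability.encodeBool M ∧
    PolyTimeSamplable D ∧
    ∀ x : List Bool,
      (x ∈ L →
        2 / 3 ≤ acceptProb L M (D x.length) (N.eval x.length) (p.eval x.length) x) ∧
      (x ∉ L →
        acceptProb L M (D x.length) (N.eval x.length) (p.eval x.length) x ≤ 1 / 3)}

/-! ### Quantum circuits and BQP -/

/-- Gates on `w` qubits: Hadamard, `T = diag(1, exp(iπ/4))`, and controlled-not. -/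
inductive QGate (w : ℕ) : Type
  | hadamard (i : Fin w)
  | phaseT (i : Fin w)
  | cnot (c t : Fin w) (h : c ≠ t)

/-- Amplitudes of a state of `w` qubits in the computational basis. -/
abbrev QState (w : ℕ) := (Fin w → Bool) → ℂ

/-- The action of a gate on a state. -/
def QGate.apply {w : ℕ} : QGate w → QState w → QState w
  | .hadamard i, ψ => fun b =>
      (ψ (Function.update b i false) + (if b i then -1 else 1) * ψ (Function.update b i true))
        / (Real.sqrt 2 : ℂ)
  | .phaseT i, ψ => fun b =>
      (if b i then Complex.exp (Complex.I * (Real.pi / 4)) else 1) * ψ b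
  | .cnot c t _, ψ => fun b => ψ (Function.update b t (xor (b t) (b c)))

/-- A quantum circuit on `n` input qubits and `anc + 1` ancilla qubits. -/
structure QCircuit (n : ℕ) where
  anc : ℕ
  gates : List (QGate (n + anc + 1))

/-- A description of a gate by natural numbers. -/
def QGate.code {w : ℕ} : QGate w → List ℕ
  | .hadamard i => [0, i]
  | .phaseT i => [1, i]
  | .cnot c t _ => [2, c, t]

/-- The description of a circuit as a binary string; each number `k` is written as `1ᵏ0`. -/
def QCircuit.encode {n : ℕ} (C : QCircuit n) : List Bool :=
  (C.anc :: C.gates.flatMap QGate.code).flatMap fun k => ones k ++ [false]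

/-- The basis state with `x` on the first qubits and `0` on all others. -/
def initState (w : ℕ) (x : List Bool) : QState w :=
  fun b => if ∀ i : Fin w, b i = x.getD i false then 1 else 0

/-- The state after all gates have been applied in order to the initial state. -/
def QCircuit.run {n : ℕ} (C : QCircuit n) (x : List Bool) : QState (n + C.anc + 1) :=
  C.gates.foldl (fun ψ g => g.apply ψ) (initState _ x)

/-- The probability that measuring the first qubit of the final state gives `1`. -/
def QCircuit.acceptProb {n : ℕ} (C : QCircuit n) (x : List Bool) : ℝ :=
  ∑ b : Fin (n + C.anc + 1) → Bool, if b 0 then ‖C.run x b‖ ^ 2 else 0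

/-- Bounded-error quantum polynomial time: polynomial-time uniform families of quantum circuits. -/
def BQP : Set (Language Bool) :=
  {L | ∃ C : ∀ n, QCircuit n,
    PolyTime ones (id : List Bool → List Bool) (fun n => (C n).encode) ∧
    ∀ x : List Bool,
      (x ∈ L → 2 / 3 ≤ (C x.length).acceptProb x) ∧
      (x ∉ L → (C x.length).acceptProb x ≤ 1 / 3)}

/-! ### The separating language -/

/-- The unary language `{1ⁿ | n ∈ A}`. -/
def unaryLanguage (A : Set ℕ) : Language Bool := {w | ∃ n ∈ A, w = ones n}

/-- No algorithm decides membership in `L`. -/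
def Undecidable (L : Language Bool) : Prop := ¬ ComputablePred fun w : List Bool => w ∈ L

/-- In each size `n ≥ 1`: the members of `Leasy` if `1ⁿ ∈ Lhard`, the non-members otherwise. -/
def combined (Lhard Leasy : Language Bool) : Language Bool :=
  {x | ∃ n, 1 ≤ n ∧ x.length = n ∧
    ((x ∈ Leasy ∧ ones n ∈ Lhard) ∨ (x ∉ Leasy ∧ ones n ∉ Lhard))}

end DataLearning

end

noncomputable section

namespace DataLearning

section

open Turing Turing.TM2

/-! ### Program fragments of stack machines -/

/-! A BPP machine is a learner that draws no examples (`BPP_subset_BPPData`). The other inclusion is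
Adleman's argument with a pair (training set, random bits) as the random outcome, whose law depends
only on the input size `n`. With error at most `1/3`, the expectation of `2 ^ errors` over `12(n+1)`
independent outcomes is at most `(4/3)^(12(n+1))`. Summed over all `2^n` inputs this is still below
`2^(6(n+1))`, so one list of outcomes has the right majority on every input
(`exists_good_outcomes`). That list is the advice, and a stack machine replays the learner on its
blocks (`PolyTime.majorityRun`).

For the separating language `L`, the undecidable bit is common to all words of one size. It
therefore cancels in the identity: `x ∈ L` is the exclusive or of `x ∈ Leasy`, `1ⁿ ∈ Leasy` and `1ⁿ
∈ L`. The last bit is the label of the single example `1ⁿ`, drawn from a point mass. The other two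
come from a BPP machine for `Leasy`, run on independent bits with error at most `1/5` each, so that
the exclusive or errs with probability at most `8/25 < 1/3` (`combined_mem_BPPData`).

Conversely, the bits `1ⁿ ∈ L` and `1ⁿ ∈ Leasy` together reveal the undecidable one for `n ≥ 1`
(`not_primrec_combined`). It remains to see that BPP and BQP languages are decidable on the words
`1ⁿ`. Polynomial-time functions are primitive recursive (`PolyTime.primrec`), because a stack
machine only ever uses finitely many symbols and a polynomial bounds its time. Random bits are
removed by counting all strings. A quantum circuit over `H`, `T`, `CNOT` is expanded into a sum over
paths with phases in the eighth roots of unity. The comparison of its acceptance probability with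
`1/2` becomes one between numbers `a + b√2` with natural `a`, `b`, which squaring decides exactly
(`exists_primrec_of_mem_BQP`).

Explicit machines are assembled from program fragments closed under sequence, loop, branching and
subroutine call. The three closure properties of `PolyTime` used are precomposition with a finite
transducer, Boolean combination, and the majority run. -/

/-- `StepsIn M a n b`: the stack machine `M` goes from `a` to `b` in exactly `n` steps. -/
inductive StepsIn {K : Type} [DecidableEq K] {Γ : K → Type} {Λ σ : Type} (M : Λ → Stmt Γ Λ σ) :
    Cfg Γ Λ σ → ℕ → Cfg Γ Λ σ → Prop
  | refl (c : Cfg Γ Λ σ) : StepsIn M c 0 c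
  | head {a b c : Cfg Γ Λ σ} {n : ℕ} :
      step M a = some b → StepsIn M b n c → StepsIn M a (n + 1) c

/-- A program fragment: its halting statement is the exit to whatever follows. -/
structure Frag {K : Type} (Γ : K → Type) (σ : Type) where
  Λ : Type
  [fin : Fintype Λ]
  main : Λ
  m : Λ → Stmt Γ Λ σ

attribute [instance] Frag.fin

section Relabel

variable {K : Type} {Γ : K → Type} {Λ Λ' σ : Type}

/-- Rename the labels of a statement and replace halting by a jump to an exit. -/
def relabel (g : Λ → Λ') (e : Option Λ') : Stmt Γ Λ σ → Stmt Γ Λ' σ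
  | .push k f q => .push k f (relabel g e q)
  | .peek k f q => .peek k f (relabel g e q)
  | .pop k f q => .pop k f (relabel g e q)
  | .load f q => .load f (relabel g e q)
  | .branch f q q' => .branch f (relabel g e q) (relabel g e q')
  | .goto f => .goto fun s => g (f s)
  | .halt => match e with
    | none => .halt
    | some l => .goto fun _ => l

/-- The label that corresponds to `l` after renaming. -/
def relabelOpt (g : Λ → Λ') (e : Option Λ') : Option Λ → Option Λ'
  | none => e
  | some l => some (g l)

variable [DecidableEq K]

/-- Renaming leaves every operation on stacks and state alone, so only the label that is reached
gets translated. -/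
theorem stepAux_relabel (g : Λ → Λ') (e : Option Λ') (q : Stmt Γ Λ σ) (v : σ)
    (S : ∀ k, List (Γ k)) :
    stepAux (relabel g e q) v S =
      ⟨relabelOpt g e (stepAux q v S).l, (stepAux q v S).var, (stepAux q v S).stk⟩ := by
  induction q generalizing v S with
  | push k f q ih => simpa [relabel] using ih _ _
  | peek k f q ih => simpa [relabel] using ih _ _
  | pop k f q ih => simpa [relabel] using ih _ _
  | load f q ih => simpa [relabel] using ih _ _
  | branch f q q' ih ih' =>
    simp only [relabel, stepAux]
    cases f v
    · simpa using ih' _ _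
    · simpa using ih _ _
  | goto f => rfl
  | halt => cases e <;> rfl

theorem StepsIn.trans {M : Λ → Stmt Γ Λ σ} {a b c : Cfg Γ Λ σ} {n n' : ℕ}
    (h : StepsIn M a n b) (h' : StepsIn M b n' c) : StepsIn M a (n + n') c := by
  induction h with
  | refl => simpa using h'
  | head hs _ ih => rw [Nat.add_right_comm]; exact .head hs (ih h')

/-- The jump to the exit replaces the halt inside the same step, so leaving a fragment costs nothing
and step counts are preserved exactly. -/
theorem StepsIn.relabel {M : Λ → Stmt Γ Λ σ} {M' : Λ' → Stmt Γ Λ' σ} {g : Λ → Λ'}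
    {e : Option Λ'} (hM : ∀ l, M' (g l) = relabel g e (M l)) {a b : Cfg Γ Λ σ} {n : ℕ}
    (h : StepsIn M a n b) :
    StepsIn M' ⟨relabelOpt g e a.l, a.var, a.stk⟩ n ⟨relabelOpt g e b.l, b.var, b.stk⟩ := by
  induction h with
  | refl => exact .refl _
  | @head a b c n hs _ ih =>
    rcases a with ⟨_ | l, v, S⟩
    · simp at hs
    · simp only [step, Option.some.injEq] at hs
      subst hs
      refine .head ?_ ih
      simp [relabelOpt, hM, stepAux_relabel]

end Relabel

/-! ### Sequences, loops and branches of fragments, with running times -/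

namespace Frag

variable {K : Type} [DecidableEq K] {Γ : K → Type} {σ : Type}

/-- From the state and stacks `a`, the fragment reaches its exit with `b` in at most `t` steps. -/
def Runs (F : Frag Γ σ) (a b : σ × ∀ k, List (Γ k)) (t : ℕ) : Prop :=
  ∃ s ≤ t, StepsIn F.m ⟨some F.main, a.1, a.2⟩ s ⟨none, b.1, b.2⟩

theorem Runs.mono {F : Frag Γ σ} {a b : σ × ∀ k, List (Γ k)} {t t' : ℕ} (h : F.Runs a b t)
    (ht : t ≤ t') : F.Runs a b t' :=
  let ⟨s, hs, h⟩ := h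
  ⟨s, hs.trans ht, h⟩

/-- A single statement. -/
def stm (q : Stmt Γ Unit σ) : Frag Γ σ := ⟨Unit, (), fun _ => q⟩

theorem runs_stm {q : Stmt Γ Unit σ} {a b : σ × ∀ k, List (Γ k)}
    (h : stepAux q a.1 a.2 = ⟨none, b.1, b.2⟩) : (stm q).Runs a b 1 :=
  ⟨1, le_rfl, .head (by simp [stm, h]) (.refl _)⟩

/-- Sequential composition. -/
def seq (F G : Frag Γ σ) : Frag Γ σ where
  Λ := F.Λ ⊕ G.Λ
  main := .inl F.main
  m
    | .inl l => relabel Sum.inl (some (.inr G.main)) (F.m l)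
    | .inr l => relabel Sum.inr none (G.m l)

theorem Runs.seq {F G : Frag Γ σ} {a b c : σ × ∀ k, List (Γ k)} {t t' : ℕ}
    (h : F.Runs a b t) (h' : G.Runs b c t') : (F.seq G).Runs a c (t + t') := by
  obtain ⟨s, hs, h⟩ := h
  obtain ⟨s', hs', h'⟩ := h'
  refine ⟨s + s', by omega, ?_⟩
  have h1 := h.relabel (M' := (F.seq G).m) (g := Sum.inl) (e := some (.inr G.main)) fun _ => rfl
  have h2 := h'.relabel (M' := (F.seq G).m) (g := Sum.inr) (e := none) fun _ => rfl
  exact h1.trans h2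

/-- Repeat `F` while the state satisfies `c`. -/
def loop (c : σ → Bool) (F : Frag Γ σ) : Frag Γ σ where
  Λ := Option F.Λ
  main := none
  m
    | none => .branch c (.goto fun _ => some F.main) .halt
    | some l => relabel some (some none) (F.m l)

theorem runs_loop_exit {c : σ → Bool} {F : Frag Γ σ} {a : σ × ∀ k, List (Γ k)}
    (h : c a.1 = false) : (loop c F).Runs a a 1 :=
  ⟨1, le_rfl, .head (by simp [loop, h]) (.refl _)⟩

theorem Runs.loop {c : σ → Bool} {F : Frag Γ σ} {a b d : σ × ∀ k, List (Γ k)} {t t' : ℕ}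
    (hc : c a.1 = true) (h : F.Runs a b t) (h' : (loop c F).Runs b d t') :
    (loop c F).Runs a d (1 + t + t') := by
  obtain ⟨s, hs, h⟩ := h
  obtain ⟨s', hs', h'⟩ := h'
  refine ⟨(s + s') + 1, by omega, ?_⟩
  have h1 := h.relabel (M' := (Frag.loop c F).m) (g := some) (e := some none) fun _ => rfl
  refine .head (b := ⟨some (some F.main), a.1, a.2⟩) (by simp [Frag.loop, hc]) (h1.trans h')

/-- Run `F` or `G` according to the state. -/
def ite (c : σ → Bool) (F G : Frag Γ σ) : Frag Γ σ where
  Λ := Option (F.Λ ⊕ G.Λ)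
  main := none
  m
    | none => .branch c (.goto fun _ => some (.inl F.main)) (.goto fun _ => some (.inr G.main))
    | some (.inl l) => relabel (fun l => some (.inl l)) none (F.m l)
    | some (.inr l) => relabel (fun l => some (.inr l)) none (G.m l)

theorem Runs.ite_true {c : σ → Bool} {F G : Frag Γ σ} {a b : σ × ∀ k, List (Γ k)} {t : ℕ}
    (hc : c a.1 = true) (h : F.Runs a b t) : (ite c F G).Runs a b (t + 1) := by
  obtain ⟨s, hs, h⟩ := h
  have h1 := h.relabel (M' := (Frag.ite c F G).m) (g := fun l => some (.inl l)) (e := none)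
    fun _ => rfl
  exact ⟨s + 1, by omega, .head (by simp [Frag.ite, hc, relabelOpt]) h1⟩

theorem Runs.ite_false {c : σ → Bool} {F G : Frag Γ σ} {a b : σ × ∀ k, List (Γ k)} {t : ℕ}
    (hc : c a.1 = false) (h : G.Runs a b t) : (ite c F G).Runs a b (t + 1) := by
  obtain ⟨s, hs, h⟩ := h
  have h1 := h.relabel (M' := (Frag.ite c F G).m) (g := fun l => some (.inr l)) (e := none)
    fun _ => rfl
  exact ⟨s + 1, by omega, .head (by simp [Frag.ite, hc, relabelOpt]) h1⟩

/-- A loop whose `i`-th round consumes the `i`-th element of a list. -/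
theorem runs_loop_foldl {X Y : Type} {c : σ → Bool} {F : Frag Γ σ}
    (cfg : List X → Y → σ × ∀ k, List (Γ k)) (up : Y → X → Y) (t : ℕ)
    (hnil : ∀ y, c (cfg [] y).1 = false) (hcons : ∀ x l y, c (cfg (x :: l) y).1 = true)
    (hstep : ∀ x l y, F.Runs (cfg (x :: l) y) (cfg l (up y x)) t) (l : List X) (y : Y) :
    (loop c F).Runs (cfg l y) (cfg [] (l.foldl up y)) ((t + 1) * l.length + 1) := by
  induction l generalizing y with
  | nil => simpa using runs_loop_exit (hnil y)
  | cons x l ih =>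
    -- Each round pays `t` steps and one for the test; the final `1` is the test that fails.
    refine (Runs.loop (hcons x l y) (hstep x l y) (ih (up y x))).mono ?_
    simp only [List.length_cons]
    ring_nf
    omega

/-! ### Calling a fragment inside a larger machine -/

section Embed

variable {K' : Type} [DecidableEq K'] {Γ' : K' → Type} {σ' : Type}

/-- Let a statement act on some of the stacks and a part of the state of a larger machine. -/
def embedStmt (ι : K → K') (get : σ' → σ) (set : σ → σ' → σ') {Λ : Type} :
    Stmt (fun k => Γ' (ι k)) Λ σ → Stmt Γ' Λ σ'
  | .push k f q => .push (ι k) (fun s => f (get s)) (embedStmt ι get set q)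
  | .peek k f q => .peek (ι k) (fun s o => set (f (get s) o) s) (embedStmt ι get set q)
  | .pop k f q => .pop (ι k) (fun s o => set (f (get s) o) s) (embedStmt ι get set q)
  | .load f q => .load (fun s => set (f (get s)) s) (embedStmt ι get set q)
  | .branch f q q' => .branch (fun s => f (get s)) (embedStmt ι get set q) (embedStmt ι get set q')
  | .goto f => .goto fun s => f (get s)
  | .halt => .halt

/-- Let a fragment act on some of the stacks and a part of the state of a larger machine. -/
def embed (ι : K → K') (get : σ' → σ) (set : σ → σ' → σ') (F : Frag (fun k => Γ' (ι k)) σ) :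
    Frag Γ' σ' :=
  ⟨F.Λ, F.main, fun l => embedStmt ι get set (F.m l)⟩

variable {ι : K → K'} {get : σ' → σ} {set : σ → σ' → σ'}

/-- The pair `get`, `set` is a lens on the state: reading after writing lets the small statement see
its own component, and overwriting lets successive writes collapse. Injectivity of `ι` keeps
distinct small stacks apart. -/
theorem stepAux_embedStmt (hι : Function.Injective ι) (hgs : ∀ x s, get (set x s) = x)
    (hss : ∀ x y s, set x (set y s) = set x s) {Λ : Type} (q : Stmt (fun k => Γ' (ι k)) Λ σ)
    (v : σ) (S : ∀ k, List (Γ' k)) (x : σ') :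
    (stepAux (embedStmt ι get set q) (set v x) S).l = (stepAux q v fun k => S (ι k)).l ∧
    (stepAux (embedStmt ι get set q) (set v x) S).var =
      set (stepAux q v fun k => S (ι k)).var x ∧
    (∀ k, (stepAux (embedStmt ι get set q) (set v x) S).stk (ι k) =
      (stepAux q v fun k => S (ι k)).stk k) ∧
    (∀ k', (∀ k, ι k ≠ k') → (stepAux (embedStmt ι get set q) (set v x) S).stk k' = S k') := by
  have key : ∀ (S : ∀ k, List (Γ' k)) (k : K) (l : List (Γ' (ι k))),
      (fun j => Function.update S (ι k) l (ι j)) =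
        Function.update (fun j => S (ι j)) k l := fun S k l =>
    Function.update_comp_eq_of_injective' S hι k l
  have key' : ∀ (S : ∀ k, List (Γ' k)) (k : K) (l : List (Γ' (ι k))) (k' : K'),
      (∀ k, ι k ≠ k') → Function.update S (ι k) l k' = S k' := fun S k l k' h =>
    Function.update_of_ne (h k).symm _ _
  induction q generalizing v S with
  | push k f q ih =>
    obtain ⟨h1, h2, h3, h4⟩ := ih v (Function.update S (ι k) (f v :: S (ι k)))
    rw [key] at h1 h2 h3
    simp only [embedStmt, stepAux, hgs]
    exact ⟨h1, h2, h3, fun k' hk => (h4 k' hk).trans (key' _ _ _ _ hk)⟩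
  | peek k f q ih =>
    simp only [embedStmt, stepAux, hgs, hss]
    exact ih _ _
  | pop k f q ih =>
    obtain ⟨h1, h2, h3, h4⟩ := ih (f v (S (ι k)).head?) (Function.update S (ι k) (S (ι k)).tail)
    rw [key] at h1 h2 h3
    simp only [embedStmt, stepAux, hgs, hss]
    exact ⟨h1, h2, h3, fun k' hk => (h4 k' hk).trans (key' _ _ _ _ hk)⟩
  | load f q ih =>
    simp only [embedStmt, stepAux, hgs, hss]
    exact ih _ _
  | branch f q q' ih ih' =>
    simp only [embedStmt, stepAux, hgs]
    cases f v
    · exact ih' _ _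
    · exact ih _ _
  | goto f => simp [embedStmt, hgs]
  | halt => simp [embedStmt]

theorem Runs.embed {F : Frag (fun k => Γ' (ι k)) σ} (hι : Function.Injective ι)
    (hgs : ∀ x s, get (set x s) = x) (hss : ∀ x y s, set x (set y s) = set x s)
    {a b : σ × ∀ k, List (Γ' (ι k))} {t : ℕ} (h : F.Runs a b t) {S S' : ∀ k, List (Γ' k)} (x : σ')
    (hS : ∀ k, S (ι k) = a.2 k) (hS' : ∀ k, S' (ι k) = b.2 k)
    (hr : ∀ k', (∀ k, ι k ≠ k') → S k' = S' k') :
    (F.embed ι get set).Runs (set a.1 x, S) (set b.1 x, S') t := by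
  obtain ⟨s, hs, h⟩ := h
  refine ⟨s, hs, ?_⟩
  -- The starting stacks vary along the run while the final stacks `S'` stay fixed; off the range of
  -- `ι` both agree throughout.
  have gen : ∀ (c d : Cfg (fun k => Γ' (ι k)) F.Λ σ) (n : ℕ), StepsIn F.m c n d →
      ∀ S : ∀ k, List (Γ' k), (∀ k, S (ι k) = c.stk k) → (∀ k, S' (ι k) = d.stk k) →
      (∀ k', (∀ k, ι k ≠ k') → S k' = S' k') →
      StepsIn (F.embed ι get set).m ⟨c.l, set c.var x, S⟩ n ⟨d.l, set d.var x, S'⟩ := by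
    intro c d n h
    induction h with
    | refl c =>
      intro S h1 h2 h3
      have : S = S' := by
        funext k'
        by_cases hk : ∃ k, ι k = k'
        · obtain ⟨k, rfl⟩ := hk
          rw [h1, h2]
        · exact h3 k' (by simpa using hk)
      rw [this]
      exact .refl _
    | @head c d e n hs _ ih =>
      intro S h1 h2 h3
      rcases c with ⟨_ | l, v, T⟩
      · simp at hs
      · simp only [step, Option.some.injEq] at hs
        subst hs
        obtain rfl : (fun k => S (ι k)) = T := funext h1
        obtain ⟨g1, g2, g3, g4⟩ := stepAux_embedStmt (set := set) hι hgs hss (F.m l) v S x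
        have := ih (stepAux (embedStmt ι get set (F.m l)) (set v x) S).stk g3 h2
          fun k' hk => (g4 k' hk).trans (h3 k' hk)
        refine .head ?_ this
        simp only [step, Frag.embed, Option.some.injEq]
        rw [← g1, ← g2]
  exact gen _ _ _ h S hS hS' hr

end Embed

/-- The whole program of a machine as a fragment. -/
def ofTM (tm : FinTM2) : Frag tm.Γ tm.σ :=
  letI := tm.ΛFin
  ⟨tm.Λ, tm.main, tm.m⟩

end Frag

/-! ### Initial and halting configurations -/

/-- All stacks are empty, except that `l` is on stack `k`. -/
def single {K : Type} [DecidableEq K] {Γ : K → Type} (k : K) (l : List (Γ k)) :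
    ∀ k, List (Γ k) :=
  Function.update (fun _ => []) k l

theorem single_self {K : Type} [DecidableEq K] {Γ : K → Type} (k : K) (l : List (Γ k)) :
    single k l k = l := by simp [single]

theorem update_single {K : Type} [DecidableEq K] {Γ : K → Type} (k : K) (l l' : List (Γ k)) :
    Function.update (single k l) k l' = single k l' := by simp [single]

theorem single_nil {K : Type} [DecidableEq K] {Γ : K → Type} (k : K) :
    single k ([] : List (Γ k)) = fun _ => [] := by simp [single]

theorem initList_eq (tm : FinTM2) (s : List (tm.Γ tm.k₀)) :
    initList tm s = ⟨some tm.main, tm.initialState, single tm.k₀ s⟩ := by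
  unfold initList single
  congr 1
  funext k
  by_cases h : k = tm.k₀
  · subst h; simp
  · simp [h]

/-- Halting demands the initial state and empty stacks apart from the output. This is why the
programs below reset their registers and clear their work stacks. -/
theorem haltList_eq (tm : FinTM2) (s : List (tm.Γ tm.k₁)) :
    haltList tm s = ⟨none, tm.initialState, single tm.k₁ s⟩ := by
  unfold haltList single
  congr 1
  funext k
  by_cases h : k = tm.k₁
  · subst h; simp
  · simp [h]

/-- Translates inductive runs, which are convenient for composition, into the iterated partial step
function used in the definition of computability. A halted machine has no successor, and `none`
stays `none`. -/
theorem stepsIn_iff {K : Type} [DecidableEq K] {Γ : K → Type} {Λ σ : Type} (M : Λ → Stmt Γ Λ σ)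
    (a b : Cfg Γ Λ σ) (n : ℕ) :
    StepsIn M a n b ↔ (flip bind (step M))^[n] (some a) = some b := by
  have hn : ∀ n, (flip bind (step M))^[n] none = none := by
    intro n
    induction n with
    | zero => rfl
    | succ n ih => rw [Function.iterate_succ_apply]; exact ih
  constructor
  · intro h
    induction h with
    | refl => rfl
    | @head a b c n hs _ ih =>
      rw [Function.iterate_succ_apply, ← ih, ← hs]
      rfl
  · induction n generalizing a with
    | zero => intro h; simp at h; subst h; exact .refl _
    | succ n ih =>
      intro h
      rw [Function.iterate_succ_apply] at h
      cases hs : step M a with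
      | none =>
        have : flip bind (step M) (some a) = none := hs
        rw [this, hn] at h
        cases h
      | some c =>
        have : flip bind (step M) (some a) = some c := hs
        rw [this] at h
        exact .head hs (ih c h)

theorem natPoly_eval_mono (p : Polynomial ℕ) : Monotone fun n => p.eval n := by
  intro a b h
  simp only [Polynomial.eval_eq_sum, Polynomial.sum]
  gcongr

/-- The way back from fragments to `PolyTime`: the exit of the fragment becomes the halt of a
complete machine. -/
theorem polyTime_of_frag {α β αΓ βΓ : Type} {ea : α → List αΓ} {eb : β → List βΓ} {f : α → β}
    {K : Type} [DecidableEq K] [Fintype K] {Γ : K → Type} {σ : Type} [Fintype σ] (k₀ k₁ : K)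
    [Fintype (Γ k₀)] (ein : Γ k₀ ≃ αΓ) (eout : Γ k₁ ≃ βΓ) (v : σ) (F : Frag Γ σ)
    (p : Polynomial ℕ)
    (h : ∀ a, F.Runs (v, single k₀ ((ea a).map ein.symm)) (v, single k₁ ((eb (f a)).map eout.symm))
      (p.eval (ea a).length)) :
    PolyTime ea eb f := by
  let tm : FinTM2 := { K := K, k₀ := k₀, k₁ := k₁, Γ := Γ, Λ := F.Λ, main := F.main, σ := σ,
                       initialState := v, m := F.m }
  have key : ∀ a, ∃ s ≤ p.eval (ea a).length,
      (flip bind tm.step)^[s] (some (initList tm ((ea a).map ein.symm))) =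
        some (haltList tm ((eb (f a)).map eout.symm)) := by
    intro a
    obtain ⟨s, hs, h⟩ := h a
    refine ⟨s, hs, ?_⟩
    rw [initList_eq, haltList_eq]
    exact (stepsIn_iff _ _ _ _).1 h
  choose s hs h using key
  exact ⟨{ tm := tm, inputAlphabet := ein, outputAlphabet := eout, time := p,
           outputsFun := fun a => ⟨⟨s a, h a⟩, hs a⟩ }⟩

/-- A machine that computes a function in polynomial time, as a fragment. -/
theorem runs_ofTM {α β αΓ βΓ : Type} {ea : α → List αΓ} {eb : β → List βΓ} {f : α → β}
    (C : TM2ComputableInPolyTime ea eb f) (a : α) :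
    (Frag.ofTM C.tm).Runs
      (C.tm.initialState, single C.tm.k₀ ((ea a).map C.inputAlphabet.symm))
      (C.tm.initialState, single C.tm.k₁ ((eb (f a)).map C.outputAlphabet.symm))
      (C.time.eval (ea a).length) := by
  have h := C.outputsFun a
  refine ⟨h.steps, h.steps_le_m, ?_⟩
  have h' : ∀ (n : ℕ) (_ : (flip bind C.tm.step)^[n] (some (initList C.tm
      ((ea a).map C.inputAlphabet.symm))) = some (haltList C.tm
      ((eb (f a)).map C.outputAlphabet.symm))), (flip bind C.tm.step)^[n] (some
      ⟨some C.tm.main, C.tm.initialState, single C.tm.k₀ ((ea a).map C.inputAlphabet.symm)⟩) =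
      some ⟨none, C.tm.initialState, single C.tm.k₁ ((eb (f a)).map C.outputAlphabet.symm)⟩ := by
    intro n hn
    rw [initList_eq, haltList_eq] at hn
    exact hn
  exact (stepsIn_iff _ _ _ _).2 (h' _ h.evals_in_steps)

/-! ### Finite transducers -/

/-- The output of a finite transducer with transition function `δ` and final output `fin`. -/
def transduce {A B Q : Type} (δ : Q → A → Q × Option B) (fin : Q → Option B) : Q → List A → List B
  | q, [] => (fin q).toList
  | q, a :: l => (δ q a).2.toList ++ transduce δ fin (δ q a).1 l

section Transducer

variable {A B Q : Type} (δ : Q → A → Q × Option B) (fin : Q → Option B)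

/-- One transition of a transducer, with the outputs so far in reverse order. -/
def transStep (y : Q × List B) (a : A) : Q × List B :=
  ((δ y.1 a).1, (δ y.1 a).2.toList ++ y.2)

/-- Loop invariant of the machine: what has been emitted, held backwards on a stack, followed by
what the rest of the input will still produce, is the total output. -/
theorem transduce_eq_foldl (l : List A) (y : Q × List B) :
    y.2.reverse ++ transduce δ fin y.1 l =
      ((fin (l.foldl (transStep δ) y).1).toList ++ (l.foldl (transStep δ) y).2).reverse := by
  induction l generalizing y with
  | nil => cases h : fin y.1 <;> simp [transduce, h]
  | cons a l ih =>
    rw [List.foldl_cons, ← ih, transduce, transStep, List.reverse_append, List.append_assoc]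
    cases (δ y.1 a).2 <;> simp

theorem length_transStep_foldl (l : List A) (y : Q × List B) :
    (l.foldl (transStep δ) y).2.length ≤ y.2.length + l.length := by
  induction l generalizing y with
  | nil => simp
  | cons a l ih =>
    refine (ih _).trans ?_
    have : (δ y.1 a).2.toList.length ≤ 1 := by cases (δ y.1 a).2 <;> simp
    simp only [transStep, List.length_append, List.length_cons]
    omega

/-- The stack alphabets of a transducer that is followed by a machine: an input stack, a buffer,
and the stacks of the machine. -/
@[reducible] def TransΓ (A B : Type) {K : Type} (Γ : K → Type) : Option (Option K) → Type
  | none => A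
  | some none => B
  | some (some k) => Γ k

/-- The stacks of a transducer that is followed by a machine. -/
def transStk {A B K : Type} {Γ : K → Type} (i : List A) (b : List B) (s : ∀ k, List (Γ k)) :
    ∀ k, List (TransΓ A B Γ k)
  | none => i
  | some none => b
  | some (some k) => s k

section Stk

variable {K : Type} {Γ : K → Type} (i i' : List A) (b b' : List B)
  (s : ∀ k, List (Γ k))

@[simp] theorem transStk_inp : transStk i b s none = i := rfl
@[simp] theorem transStk_buf : transStk i b s (some none) = b := rfl
@[simp] theorem transStk_mach (k : K) : transStk i b s (some (some k)) = s k := rfl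

variable [DecidableEq K]

@[simp] theorem update_transStk_inp :
    Function.update (transStk i b s) none i' = transStk i' b s := by
  funext k; rcases k with _ | _ | k <;> simp

@[simp] theorem update_transStk_buf :
    Function.update (transStk i b s) (some none) b' = transStk i b' s := by
  funext k; rcases k with _ | _ | k <;> simp

@[simp] theorem update_transStk_mach (k : K) (l : List (Γ k)) :
    Function.update (transStk i b s) (some (some k)) l = transStk i b (Function.update s k l) := by
  funext k'
  rcases k' with _ | _ | k' <;> simp
  by_cases h : k' = k
  · subst h; simp
  · rw [Function.update_of_ne (by simpa using h), Function.update_of_ne h]; rfl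

end Stk

/-- A transition that does nothing if there is no input symbol. -/
def transOpt (o : Option A) (q : Q) : Q × Option B :=
  match o with
  | none => (q, none)
  | some a => δ q a

variable [Inhabited B] {K : Type} {Γ : K → Type} (σ : Type)

/-- The program of a transducer that writes its output to the stack `k₀` of a machine. -/
def transFrag (q₀ : Q) (k₀ : K) (e : B → Γ k₀) :
    Frag (TransΓ A B Γ) (Option A × Option B × Q × σ) :=
  (Frag.stm (.pop none (fun s o => (o, s.2)) .halt)).seq <|
  (Frag.loop (fun s => s.1.isSome) (Frag.stm (
    .branch (fun s => (transOpt δ s.1 s.2.2.1).2.isSome)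
      (.push (some none) (fun s => (transOpt δ s.1 s.2.2.1).2.getD default)
        (.load (fun s => (s.1, s.2.1, (transOpt δ s.1 s.2.2.1).1, s.2.2.2))
          (.pop none (fun s o => (o, s.2)) .halt)))
      (.load (fun s => (s.1, s.2.1, (transOpt δ s.1 s.2.2.1).1, s.2.2.2))
        (.pop none (fun s o => (o, s.2)) .halt))))).seq <|
  (Frag.stm (
    .branch (fun s => (fin s.2.2.1).isSome)
      (.push (some none) (fun s => (fin s.2.2.1).getD default)
        (.load (fun s => (s.1, s.2.1, q₀, s.2.2.2))
          (.pop (some none) (fun s o => (s.1, o, s.2.2)) .halt)))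
      (.load (fun s => (s.1, s.2.1, q₀, s.2.2.2))
        (.pop (some none) (fun s o => (s.1, o, s.2.2)) .halt)))).seq <|
  (Frag.loop (fun s => s.2.1.isSome) (Frag.stm (
    .push (some (some k₀)) (fun s => e (s.2.1.getD default))
      (.pop (some none) (fun s o => (s.1, o, s.2.2)) .halt))))

/-- The first loop collects the output backwards in the buffer; moving it to `k₀` reverses it again.
In between, the final output is added and the state is reset to `q₀`. -/
theorem runs_transFrag [DecidableEq K] (q₀ : Q) (k₀ : K) (e : B → Γ k₀) (l : List A) (x : σ) :
    (transFrag δ fin σ q₀ k₀ e).Runs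
      ((none, none, q₀, x), transStk l [] (fun _ => []))
      ((none, none, q₀, x), transStk [] [] (single k₀ ((transduce δ fin q₀ l).map e)))
      (4 * l.length + 6) := by
  obtain ⟨q, b, hqb⟩ : ∃ q b, l.foldl (transStep δ) (q₀, []) = (q, b) := ⟨_, _, rfl⟩
  have hout := transduce_eq_foldl δ fin l (q₀, [])
  have hlen := length_transStep_foldl δ l (q₀, [])
  rw [hqb] at hout hlen
  simp only [List.reverse_nil, List.nil_append, List.length_nil, zero_add] at hout hlen
  set c := (fin q).toList ++ b with hc
  have hclen : c.length ≤ l.length + 1 := by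
    have : (fin q).toList.length ≤ 1 := by cases fin q <;> simp
    simp only [hc, List.length_append]; omega
  have h1 := Frag.runs_loop_foldl (Γ := TransΓ A B Γ) (σ := Option A × Option B × Q × σ)
    (c := fun s => s.1.isSome)
    (F := Frag.stm (
      .branch (fun s => (transOpt δ s.1 s.2.2.1).2.isSome)
        (.push (some none) (fun s => (transOpt δ s.1 s.2.2.1).2.getD default)
          (.load (fun s => (s.1, s.2.1, (transOpt δ s.1 s.2.2.1).1, s.2.2.2))
            (.pop none (fun s o => (o, s.2)) .halt)))
        (.load (fun s => (s.1, s.2.1, (transOpt δ s.1 s.2.2.1).1, s.2.2.2))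
          (.pop none (fun s o => (o, s.2)) .halt))))
    (fun l y => ((l.head?, none, y.1, x), transStk l.tail y.2 (fun _ => [])))
    (transStep δ) 1 (by simp) (by simp)
    (by
      intro a l y
      refine Frag.runs_stm ?_
      cases h : (δ y.1 a).2 <;> simp [transOpt, h, transStep])
    l (q₀, [])
  rw [hqb] at h1
  have h2 := Frag.runs_loop_foldl (Γ := TransΓ A B Γ) (σ := Option A × Option B × Q × σ)
    (c := fun s => s.2.1.isSome)
    (F := Frag.stm (
      .push (some (some k₀)) (fun s => e (s.2.1.getD default))
        (.pop (some none) (fun s o => (s.1, o, s.2.2)) .halt)))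
    (fun l y => ((none, l.head?, q₀, x), transStk [] l.tail (single k₀ y)))
    (fun y b => e b :: y) 1 (by simp) (by simp)
    (by
      intro a l y
      refine Frag.runs_stm ?_
      simp [single_self, update_single])
    c []
  have hfold : ∀ (c : List B) (d : List (Γ k₀)),
      c.foldl (fun y b => e b :: y) d = c.reverse.map e ++ d := by
    intro c
    induction c with
    | nil => simp
    | cons a c ih => intro d; simp [ih]
  rw [hfold, List.append_nil, ← hout, single_nil] at h2
  refine Frag.Runs.mono (Frag.Runs.seq (Frag.runs_stm (b := ((l.head?, none, q₀, x),
    transStk l.tail [] (fun _ => []))) ?_) (Frag.Runs.seq h1 (Frag.Runs.seq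
      (Frag.runs_stm ?_) h2))) (t := 1 + ((1 + 1) * l.length + 1 + (1 + ((1 + 1) * c.length + 1))))
    (by omega)
  · simp
  · cases h : fin q <;> simp [h, hc]

end Transducer

/-- A polynomial-time function after a finite transducer. -/
theorem PolyTime.comp_transducer {α β γ A B C Q : Type} [Fintype A] [Fintype B] [Inhabited B]
    [Fintype Q] {ea : α → List A} {eb : β → List B} {ec : γ → List C} {g : β → γ}
    (hg : PolyTime eb ec g) (f : α → β) (δ : Q → A → Q × Option B) (fin : Q → Option B) (q₀ : Q)
    (h : ∀ a, eb (f a) = transduce δ fin q₀ (ea a)) :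
    PolyTime ea ec (fun a => g (f a)) := by
  obtain ⟨G⟩ := hg
  let := G.tm.σFin
  let := G.tm.kFin
  let call : Frag (TransΓ A B G.tm.Γ) (Option A × Option B × Q × G.tm.σ) :=
    Frag.embed (fun k => some (some k)) (fun s => s.2.2.2)
      (fun v s => (s.1, s.2.1, s.2.2.1, v)) (Frag.ofTM G.tm)
  refine polyTime_of_frag (Γ := TransΓ A B G.tm.Γ) none (some (some G.tm.k₁)) (Equiv.refl A)
    G.outputAlphabet (none, none, q₀, G.tm.initialState)
    ((transFrag δ fin G.tm.σ q₀ G.tm.k₀ G.inputAlphabet.symm).seq call)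
    (4 * Polynomial.X + 6 + G.time.comp (Polynomial.X + 1)) fun a => ?_
  have h1 := runs_transFrag δ fin G.tm.σ q₀ G.tm.k₀ G.inputAlphabet.symm (ea a) G.tm.initialState
  have h2 : call.Runs _ _ _ := Frag.Runs.embed (Γ' := TransΓ A B G.tm.Γ)
    (ι := fun k => some (some k)) (get := fun s : Option A × Option B × Q × G.tm.σ => s.2.2.2)
    (set := fun v s => (s.1, s.2.1, s.2.2.1, v)) (fun _ _ h => by simpa using h)
    (fun _ _ => rfl) (fun _ _ _ => rfl) (runs_ofTM G (f a)) (x := (none, none, q₀, G.tm.initialState))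
    (S := transStk [] [] (single G.tm.k₀ ((eb (f a)).map G.inputAlphabet.symm)))
    (S' := transStk [] [] (single G.tm.k₁ ((ec (g (f a))).map G.outputAlphabet.symm)))
    (fun _ => rfl) (fun _ => rfl) (fun k' hk => by
      rcases k' with _ | _ | k'
      · rfl
      · rfl
      · exact absurd rfl (hk k'))
  rw [← h] at h1
  -- One symbol per transition and possibly one from `fin`; this is the `X + 1` at which the time
  -- bound of the second machine is evaluated.
  have hlen : (eb (f a)).length ≤ (ea a).length + 1 := by
    have := transduce_eq_foldl δ fin (ea a) (q₀, [])
    have h3 := length_transStep_foldl δ (ea a) (q₀, [])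
    rw [h, ← List.nil_append (transduce _ _ _ _), ← List.reverse_nil, this]
    have : ∀ q, (fin q).toList.length ≤ 1 := fun q => by cases fin q <;> simp
    have := this (List.foldl (transStep δ) (q₀, []) (ea a)).1
    simp only [List.length_nil, zero_add] at h3
    rw [List.length_reverse, List.length_append]
    omega
  have e1 : (single none ((ea a).map (Equiv.refl A).symm) : ∀ k, List (TransΓ A B G.tm.Γ k)) =
      transStk (ea a) [] (fun _ => []) := by
    funext k; rcases k with _ | _ | k <;> simp [single]
  have e2 : (single (some (some G.tm.k₁)) ((ec (g (f a))).map G.outputAlphabet.symm) :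
      ∀ k, List (TransΓ A B G.tm.Γ k)) =
      transStk [] [] (single G.tm.k₁ ((ec (g (f a))).map G.outputAlphabet.symm)) := by
    rw [single, single, ← update_transStk_mach]
    congr 1
    funext k; rcases k with _ | _ | k <;> simp
  rw [e1, e2]
  refine (h1.seq h2).mono ?_
  have := natPoly_eval_mono G.time hlen
  simp only [Polynomial.eval_add, Polynomial.eval_mul, Polynomial.eval_ofNat, Polynomial.eval_X,
    Polynomial.eval_comp, Polynomial.eval_one] at this ⊢
  omega

/-! ### Boolean combinations -/

/-- The stack alphabets of two machines that are run on the same input: an input stack, a buffer,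
and the stacks of the machines. -/
@[reducible] def PairΓ (A : Type) {K K' : Type} (Γ : K → Type) (Γ' : K' → Type) :
    Bool ⊕ (K ⊕ K') → Type
  | .inl true => A
  | .inl false => A
  | .inr (.inl k) => Γ k
  | .inr (.inr k) => Γ' k

/-- The stacks of two machines that are run on the same input. -/
def pairStk {A K K' : Type} {Γ : K → Type} {Γ' : K' → Type} (i : List A) (b : List A)
    (s : ∀ k, List (Γ k)) (s' : ∀ k, List (Γ' k)) : ∀ k, List (PairΓ A Γ Γ' k)
  | .inl true => i
  | .inl false => b
  | .inr (.inl k) => s k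
  | .inr (.inr k) => s' k

section PairStk

variable {A K K' : Type} {Γ : K → Type} {Γ' : K' → Type}
  (i i' : List A) (b b' : List A) (s : ∀ k, List (Γ k)) (s' : ∀ k, List (Γ' k))

@[simp] theorem pairStk_inp : pairStk i b s s' (.inl true) = i := rfl
@[simp] theorem pairStk_buf : pairStk i b s s' (.inl false) = b := rfl
@[simp] theorem pairStk_left (k : K) : pairStk i b s s' (.inr (.inl k)) = s k := rfl
@[simp] theorem pairStk_right (k : K') : pairStk i b s s' (.inr (.inr k)) = s' k := rfl

variable [DecidableEq K] [DecidableEq K']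

@[simp] theorem update_pairStk_inp :
    Function.update (pairStk i b s s') (.inl true) i' = pairStk i' b s s' := by
  funext k; rcases k with (_ | _) | _ | k <;> simp

@[simp] theorem update_pairStk_buf :
    Function.update (pairStk i b s s') (.inl false) b' = pairStk i b' s s' := by
  funext k; rcases k with (_ | _) | _ | k <;> simp

@[simp] theorem update_pairStk_left (k : K) (l : List (Γ k)) :
    Function.update (pairStk i b s s') (.inr (.inl k)) l =
      pairStk i b (Function.update s k l) s' := by
  funext k'
  rcases k' with (_ | _) | k' | k' <;> simp

@[simp] theorem update_pairStk_right (k : K') (l : List (Γ' k)) :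
    Function.update (pairStk i b s s') (.inr (.inr k)) l =
      pairStk i b s (Function.update s' k l) := by
  funext k'
  rcases k' with (_ | _) | k' | k' <;> simp

end PairStk

/-- Pop the next input symbol. -/
def pairPopInp (A : Type) {K K' : Type} (Γ : K → Type) (Γ' : K' → Type) (σ : Type) :
    Stmt (PairΓ A Γ Γ') Unit (Option A × σ) :=
  .pop (.inl true) (fun s o => (o, s.2)) .halt

/-- Pop the next symbol of the buffer. -/
def pairPopBuf (A : Type) {K K' : Type} (Γ : K → Type) (Γ' : K' → Type) (σ : Type) :
    Stmt (PairΓ A Γ Γ') Unit (Option A × σ) :=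
  .pop (.inl false) (fun s o => (o, s.2)) .halt

/-- Copy the input to the stacks `k₀` and `k₀'` of two machines. -/
def copyFrag {A K K' : Type} [Inhabited A] {Γ : K → Type} {Γ' : K' → Type} (σ : Type)
    (k₀ : K) (k₀' : K') (e : A → Γ k₀) (e' : A → Γ' k₀') :
    Frag (PairΓ A Γ Γ') (Option A × σ) :=
  (Frag.stm (pairPopInp A Γ Γ' σ)).seq <|
  (Frag.loop (fun s => s.1.isSome) (Frag.stm (
    .push (.inl false) (fun s => s.1.getD default) (pairPopInp A Γ Γ' σ)))).seq <|
  (Frag.stm (pairPopBuf A Γ Γ' σ)).seq <|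
  (Frag.loop (fun s => s.1.isSome) (Frag.stm (
    .push (.inr (.inl k₀)) (fun s => e (s.1.getD default))
      (.push (.inr (.inr k₀')) (fun s => e' (s.1.getD default)) (pairPopBuf A Γ Γ' σ)))))

/-- Two reversals, into the buffer and out of it onto both stacks, restore the order of the input.
-/
theorem runs_copyFrag {A K K' : Type} [Inhabited A] [DecidableEq K] [DecidableEq K']
    {Γ : K → Type} {Γ' : K' → Type} (σ : Type)
    (k₀ : K) (k₀' : K') (e : A → Γ k₀) (e' : A → Γ' k₀') (l : List A) (x : σ) :
    (copyFrag σ k₀ k₀' e e').Runs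
      ((none, x), pairStk l [] (fun _ => []) (fun _ => []))
      ((none, x), pairStk [] [] (single k₀ (l.map e)) (single k₀' (l.map e')))
      (4 * l.length + 4) := by
  have h1 := Frag.runs_loop_foldl (Γ := PairΓ A Γ Γ') (σ := Option A × σ)
    (c := fun s => s.1.isSome)
    (F := Frag.stm (
      .push (.inl false) (fun s => s.1.getD default) (pairPopInp A Γ Γ' σ)))
    (fun l y => ((l.head?, x), pairStk l.tail y (fun _ => []) (fun _ => [])))
    (fun y a => a :: y) 1 (by simp) (by simp)
    (fun a l y => Frag.runs_stm (by simp [pairPopInp])) l []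
  have h2 := Frag.runs_loop_foldl (Γ := PairΓ A Γ Γ') (σ := Option A × σ)
    (c := fun s => s.1.isSome)
    (F := Frag.stm (
      .push (.inr (.inl k₀)) (fun s => e (s.1.getD default))
        (.push (.inr (.inr k₀')) (fun s => e' (s.1.getD default)) (pairPopBuf A Γ Γ' σ))))
    (fun l y => ((l.head?, x), pairStk [] l.tail (single k₀ (y.map e))
      (single k₀' (y.map e'))))
    (fun y a => a :: y) 1 (by simp) (by simp)
    (fun a l y => Frag.runs_stm (by
      simp [pairPopBuf, single_self, update_single])) l.reverse []
  have hfold : ∀ (c d : List A), c.foldl (fun y b => b :: y) d = c.reverse ++ d := by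
    intro c
    induction c with
    | nil => simp
    | cons a c ih => intro d; simp [ih]
  rw [hfold, List.append_nil] at h1 h2
  simp only [List.reverse_reverse, List.map_nil, single_nil] at h2
  refine Frag.Runs.mono (Frag.Runs.seq (Frag.runs_stm ?_) (Frag.Runs.seq h1 (Frag.Runs.seq
      (Frag.runs_stm ?_) h2)))
      (t := 1 + ((1 + 1) * l.length + 1 + (1 + ((1 + 1) * l.reverse.length + 1))))
    (by simp only [List.length_reverse]; omega)
  · simp [pairPopInp]
  -- The top of the buffer is the last input symbol, so the list is split at its end.
  · rcases List.eq_nil_or_concat l with rfl | ⟨l, a, rfl⟩ <;> simp [pairPopBuf]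

/-- Boolean combinations of polynomial-time predicates. -/
theorem PolyTime.boolOp {α A : Type} [Fintype A] [Inhabited A] {ea : α → List A} {f g : α → Bool}
    (hf : PolyTime ea Computability.encodeBool f) (hg : PolyTime ea Computability.encodeBool g)
    (op : Bool → Bool → Bool) :
    PolyTime ea Computability.encodeBool (fun a => op (f a) (g a)) := by
  obtain ⟨F⟩ := hf
  obtain ⟨G⟩ := hg
  let := F.tm.σFin
  let := F.tm.kFin
  let := G.tm.σFin
  let := G.tm.kFin
  let Γ' := PairΓ A F.tm.Γ G.tm.Γ
  let St := Option A × F.tm.σ × G.tm.σ × Bool × Bool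
  let callF : Frag Γ' St :=
    Frag.embed (fun k => .inr (.inl k)) (fun s => s.2.1)
      (fun v s => (s.1, v, s.2.2)) (Frag.ofTM F.tm)
  let callG : Frag Γ' St :=
    Frag.embed (fun k => .inr (.inr k)) (fun s => s.2.2.1)
      (fun v s => (s.1, s.2.1, v, s.2.2.2)) (Frag.ofTM G.tm)
  -- Both one-symbol answers are popped, which empties both output stacks. The result is written in
  -- the alphabet of the first machine, and the answer registers are cleared.
  let fin : Frag Γ' St := Frag.stm (
    .pop (.inr (.inl F.tm.k₁)) (fun s o => (s.1, s.2.1, s.2.2.1,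
      (o.map F.outputAlphabet).getD false, s.2.2.2.2)) <|
    .pop (.inr (.inr G.tm.k₁)) (fun s o => (s.1, s.2.1, s.2.2.1, s.2.2.2.1,
      (o.map G.outputAlphabet).getD false)) <|
    .push (.inr (.inl F.tm.k₁)) (fun s => F.outputAlphabet.symm (op s.2.2.2.1 s.2.2.2.2)) <|
    .load (fun s => (s.1, s.2.1, s.2.2.1, false, false)) .halt)
  let v0 : St := (none, F.tm.initialState, G.tm.initialState, false, false)
  refine polyTime_of_frag (Γ := Γ') (.inl true) (.inr (.inl F.tm.k₁)) (Equiv.refl A)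
    F.outputAlphabet v0 ((((copyFrag _ F.tm.k₀ G.tm.k₀ F.inputAlphabet.symm
      G.inputAlphabet.symm).seq callF).seq callG).seq fin)
    (4 * Polynomial.X + 6 + F.time + G.time) fun a => ?_
  have h1 := runs_copyFrag (F.tm.σ × G.tm.σ × Bool × Bool) F.tm.k₀ G.tm.k₀ F.inputAlphabet.symm
      G.inputAlphabet.symm (ea a) v0.2
  have h2 : callF.Runs _ _ _ := Frag.Runs.embed (Γ' := Γ') (ι := fun k => .inr (.inl k))
    (get := fun s : St => s.2.1) (set := fun v s => (s.1, v, s.2.2))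
    (fun _ _ h => by simpa using h) (fun _ _ => rfl) (fun _ _ _ => rfl) (runs_ofTM F a) (x := v0)
    (S := pairStk [] [] (single F.tm.k₀ ((ea a).map F.inputAlphabet.symm))
      (single G.tm.k₀ ((ea a).map G.inputAlphabet.symm)))
    (S' := pairStk [] []
      (single F.tm.k₁ ((Computability.encodeBool (f a)).map F.outputAlphabet.symm))
      (single G.tm.k₀ ((ea a).map G.inputAlphabet.symm)))
    (fun _ => rfl) (fun _ => rfl) (fun k' hk => by
      rcases k' with (_ | _) | k' | k'
      · rfl
      · rfl
      · exact absurd rfl (hk k')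
      · rfl)
  have h3 : callG.Runs _ _ _ := Frag.Runs.embed (Γ' := Γ') (ι := fun k => .inr (.inr k))
    (get := fun s : St => s.2.2.1) (set := fun v s => (s.1, s.2.1, v, s.2.2.2))
    (fun _ _ h => by simpa using h) (fun _ _ => rfl) (fun _ _ _ => rfl) (runs_ofTM G a) (x := v0)
    (S := pairStk [] []
      (single F.tm.k₁ ((Computability.encodeBool (f a)).map F.outputAlphabet.symm))
      (single G.tm.k₀ ((ea a).map G.inputAlphabet.symm)))
    (S' := pairStk [] []
      (single F.tm.k₁ ((Computability.encodeBool (f a)).map F.outputAlphabet.symm))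
      (single G.tm.k₁ ((Computability.encodeBool (g a)).map G.outputAlphabet.symm)))
    (fun _ => rfl) (fun _ => rfl) (fun k' hk => by
      rcases k' with (_ | _) | k' | k'
      · rfl
      · rfl
      · rfl
      · exact absurd rfl (hk k'))
  have h4 : fin.Runs (v0, pairStk [] []
      (single F.tm.k₁ ((Computability.encodeBool (f a)).map F.outputAlphabet.symm))
      (single G.tm.k₁ ((Computability.encodeBool (g a)).map G.outputAlphabet.symm)))
      (v0, pairStk [] []
        (single F.tm.k₁ ((Computability.encodeBool (op (f a) (g a))).map F.outputAlphabet.symm))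
        (fun _ => [])) 1 :=
    Frag.runs_stm (by
      simp [Γ', v0, Computability.encodeBool, single])
  have e1 : (single (.inl true) ((ea a).map (Equiv.refl A).symm) : ∀ k, List (Γ' k)) =
      pairStk (ea a) [] (fun _ => []) (fun _ => []) := by
    funext k; rcases k with (_ | _) | k | k <;> simp [single, Γ']
  have e2 : ∀ l, (single (.inr (.inl F.tm.k₁)) l : ∀ k, List (Γ' k)) =
      pairStk [] [] (single F.tm.k₁ l) (fun _ => []) := by
    intro l
    rw [single, single, ← update_pairStk_left]
    congr 1
    funext k; rcases k with (_ | _) | k | k <;> simp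
  rw [e1, e2]
  refine (((h1.seq h2).seq h3).seq h4).mono ?_
  simp only [Polynomial.eval_add, Polynomial.eval_mul, Polynomial.eval_ofNat, Polynomial.eval_X]
  omega

/-! ### Repeated runs of a learner on data that are written in an advice string -/

/-- The blocks (random bits, training set) that an advice string describes. The advice is read in
groups of three bits: `0?b` adds `b` to the current string `w`, `10y` adds the example `w` with the
label `y` to the current training set, and `11?` ends the current block. -/
def decodeBlocks : List Bool → List Bool → TrainingSet → List (List Bool × TrainingSet)
  | c :: d :: b :: rest, w, T =>
    match c, d with
    | false, _ => decodeBlocks rest (b :: w) T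
    | true, false => decodeBlocks rest [] ((w.reverse, b) :: T)
    | true, true => (w.reverse, T) :: decodeBlocks rest [] []
  | [], w, T => [(w.reverse, T)]
  | [_], w, T => [(w.reverse, T)]
  | [_, _], w, T => [(w.reverse, T)]

/-- Update a signed unary counter: a list of equal bits. -/
def countStep : List Bool → Bool → List Bool
  | [], b => [b]
  | c :: l, b => if c = b then b :: c :: l else l

/-- The majority of a list of bits. -/
def majority (l : List Bool) : Bool := (l.foldl countStep []).headD false

/-- The majority of the answers of a learner on the blocks of an advice string. -/
def majorityRun (M : List Bool × TrainingSet × List Bool → Bool) (p : List Bool × List Bool) :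
    Bool :=
  majority ((decodeBlocks p.2 [] []).map fun t => M (p.1, t.2, t.1))

section Drain

variable {K : Type} [DecidableEq K] {Γ : K → Type} {A σ : Type}

/-- Run `q` for each symbol that the statement `p` pops into the first register. -/
def drain (p q : Stmt Γ Unit (Option A × σ)) : Frag Γ (Option A × σ) :=
  (Frag.stm p).seq (Frag.loop (fun s => s.1.isSome) (Frag.stm q))

/-- The register is one symbol ahead of the stack: `p` loads the first symbol, and each `q` handles
the loaded symbol and fetches the next. Hence the tail in the configurations. -/
theorem runs_drain {Y : Type} {p q : Stmt Γ Unit (Option A × σ)}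
    (g : List A → Y → ∀ k, List (Γ k)) (up : Y → A → Y) (x : σ)
    (hp : ∀ l y, stepAux p (none, x) (g l y) = ⟨none, (l.head?, x), g l.tail y⟩)
    (hq : ∀ a l y, stepAux q (some a, x) (g l y) = ⟨none, (l.head?, x), g l.tail (up y a)⟩)
    (l : List A) (y : Y) :
    (drain p q).Runs ((none, x), g l y) ((none, x), g [] (l.foldl up y)) (2 * l.length + 2) := by
  have h := Frag.runs_loop_foldl (c := fun s : Option A × σ => s.1.isSome) (F := Frag.stm q)
    (fun l y => ((l.head?, x), g l.tail y)) up 1 (by simp) (by simp)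
    (fun a l y => Frag.runs_stm (hq a l y)) l y
  exact (Frag.Runs.seq (Frag.runs_stm (hp l y)) h).mono (by omega)

theorem foldl_cons_map {A B : Type} (f : A → B) (c : List A) (d : List B) :
    c.foldl (fun y b => f b :: y) d = c.reverse.map f ++ d := by
  induction c generalizing d with
  | nil => simp
  | cons a c ih => simp [ih]

theorem foldl_cons {A : Type} (c d : List A) :
    c.foldl (fun y b => b :: y) d = c.reverse ++ d := by
  simp

end Drain

/-- The auxiliary stacks: the input, the string `x`, a copy of it, the current string, and the
counter. -/
inductive MajK
  | inp | str | aux | cur | cnt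
  deriving DecidableEq

instance : Fintype MajK :=
  ⟨{.inp, .str, .aux, .cur, .cnt}, fun x => by cases x <;> simp⟩

/-- The stack alphabets of the majority machine. -/
@[reducible] def MajΓ {K : Type} (Γ : K → Type) : MajK ⊕ K → Type
  | .inl .inp => Option Bool
  | .inl .str => Bool
  | .inl .aux => Bool
  | .inl .cur => Bool
  | .inl .cnt => Bool
  | .inr k => Γ k

/-- The stacks of the majority machine. -/
def majStk {K : Type} {Γ : K → Type} (i : List (Option Bool)) (x x' w c : List Bool)
    (s : ∀ k, List (Γ k)) : ∀ k, List (MajΓ Γ k)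
  | .inl .inp => i
  | .inl .str => x
  | .inl .aux => x'
  | .inl .cur => w
  | .inl .cnt => c
  | .inr k => s k

section Stk

variable {K : Type} {Γ : K → Type} (i i' : List (Option Bool)) (x x' w c l : List Bool)
  (s : ∀ k, List (Γ k))

@[simp] theorem majStk_inp : majStk i x x' w c s (.inl .inp) = i := rfl
@[simp] theorem majStk_str : majStk i x x' w c s (.inl .str) = x := rfl
@[simp] theorem majStk_aux : majStk i x x' w c s (.inl .aux) = x' := rfl
@[simp] theorem majStk_cur : majStk i x x' w c s (.inl .cur) = w := rfl
@[simp] theorem majStk_cnt : majStk i x x' w c s (.inl .cnt) = c := rfl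
@[simp] theorem majStk_mach (k : K) : majStk i x x' w c s (.inr k) = s k := rfl

variable [DecidableEq K]

@[simp] theorem update_majStk_inp :
    Function.update (majStk i x x' w c s) (.inl .inp) i' = majStk i' x x' w c s := by
  funext k; rcases k with (_ | _) | k <;> simp

@[simp] theorem update_majStk_str :
    Function.update (majStk i x x' w c s) (.inl .str) l = majStk i l x' w c s := by
  funext k; rcases k with (_ | _) | k <;> simp

@[simp] theorem update_majStk_aux :
    Function.update (majStk i x x' w c s) (.inl .aux) l = majStk i x l w c s := by
  funext k; rcases k with (_ | _) | k <;> simp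

@[simp] theorem update_majStk_cur :
    Function.update (majStk i x x' w c s) (.inl .cur) l = majStk i x x' l c s := by
  funext k; rcases k with (_ | _) | k <;> simp

@[simp] theorem update_majStk_cnt :
    Function.update (majStk i x x' w c s) (.inl .cnt) l = majStk i x x' w l s := by
  funext k; rcases k with (_ | _) | k <;> simp

@[simp] theorem update_majStk_mach (k : K) (l : List (Γ k)) :
    Function.update (majStk i x x' w c s) (.inr k) l =
      majStk i x x' w c (Function.update s k l) := by
  funext k'; rcases k' with (_ | _) | k' <;> simp

end Stk

/-- The last three symbols that were read. -/
abbrev MajTok := Option (Option Bool) × Option (Option Bool) × Option (Option Bool)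

/-- The state of the majority machine: a register, the last three symbols that were read, a flag
that is set until the input is exhausted, and the state of the learner. -/
abbrev MajSt (σ : Type) := Option Bool × MajTok × Bool × σ

/-- The symbols describe a bit of a string. -/
def MajTok.isBit : MajTok → Bool
  | (some (some false), some (some _), some (some _)) => true
  | _ => false

/-- The symbols describe the label of an example. -/
def MajTok.isLabel : MajTok → Bool
  | (some (some true), some (some false), some (some _)) => true
  | _ => false

/-- The last of the three symbols. -/
def MajTok.bit (t : MajTok) : Bool := (t.2.2.getD none).getD false

/-- No symbol was missing. -/
def MajTok.full (t : MajTok) : Bool := (t.2.2.getD none).isSome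

section Machine

variable {K : Type} [DecidableEq K] {Γ : K → Type} {σ : Type} (k₀ k₁ : K)
  (e : Option Bool → Γ k₀) (d : Γ k₁ ≃ Bool)

/-- Move the first string of the input to the stack `str`. -/
def majInit : Frag (MajΓ Γ) (MajSt σ) :=
  let p : Stmt (MajΓ Γ) Unit (MajSt σ) :=
    .pop (.inl .inp) (fun s o => (o.getD none, s.2)) .halt
  drain p (.push (.inl .str) (fun s => s.1.getD false) p)

/-- Popping yields a nested option that `getD none` flattens, so the end marker after `x` looks like
an empty stack and stops the loop. -/
theorem runs_majInit (x : List Bool) (i : List (Option Bool)) (y : MajTok × Bool × σ) :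
    (majInit (Γ := Γ)).Runs ((none, y), majStk (x.map some ++ none :: i) [] [] [] [] fun _ => [])
      ((none, y), majStk i x.reverse [] [] [] fun _ => []) (2 * x.length + 2) := by
  have h := Frag.runs_loop_foldl (c := fun s : MajSt σ => s.1.isSome)
    (F := Frag.stm (.push (.inl .str) (fun s => s.1.getD false)
      (.pop (.inl .inp) (fun s o => (o.getD none, s.2)) .halt)))
    (fun (l z : List Bool) => ((l.head?, y),
      majStk (Γ := Γ) ((l.map some ++ none :: i).tail) z [] [] [] fun _ => []))
    (fun z a => a :: z) 1 (by simp) (by simp)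
    (fun a l z => Frag.runs_stm (by cases l <;> simp)) x []
  rw [foldl_cons, List.append_nil] at h
  refine (Frag.Runs.seq (Frag.runs_stm ?_) h).mono (by omega)
  cases x <;> simp

/-- Move the current string to the input stack of the learner. -/
def majCur : Frag (MajΓ Γ) (MajSt σ) :=
  let p : Stmt (MajΓ Γ) Unit (MajSt σ) := .pop (.inl .cur) (fun s o => (o, s.2)) .halt
  drain p (.push (.inr k₀) (fun s => e s.1) p)

/-- The current string is held with its latest bit on top; moving it to the learner's stack puts it
into reading order. -/
theorem runs_majCur (i : List (Option Bool)) (x x' w c : List Bool) (l : List (Γ k₀))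
    (y : MajTok × Bool × σ) :
    (majCur k₀ e).Runs ((none, y), majStk i x x' w c (single k₀ l))
      ((none, y), majStk i x x' [] c (single k₀ ((w.reverse.map some).map e ++ l)))
      (2 * w.length + 2) := by
  have h := runs_drain (Γ := MajΓ Γ) (p := .pop (.inl .cur) (fun s o => (o, s.2)) .halt)
    (q := .push (.inr k₀) (fun s => e s.1) (.pop (.inl .cur) (fun s o => (o, s.2)) .halt))
    (fun w l => majStk i x x' w c (single k₀ l)) (fun l a => e (some a) :: l) y
    (by simp) (by simp [single_self, update_single]) w l
  rw [foldl_cons_map (fun a => e (some a))] at h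
  rw [List.map_map]
  exact h

/-- Copy the string `x` to the input stack of the learner. -/
def majStr : Frag (MajΓ Γ) (MajSt σ) :=
  let p : Stmt (MajΓ Γ) Unit (MajSt σ) := .pop (.inl .str) (fun s o => (o, s.2)) .halt
  let p' : Stmt (MajΓ Γ) Unit (MajSt σ) := .pop (.inl .aux) (fun s o => (o, s.2)) .halt
  (drain p (.push (.inr k₀) (fun s => e s.1) (.push (.inl .aux) (fun s => s.1.getD false) p))).seq
    (drain p' (.push (.inl .str) (fun s => s.1.getD false) p'))

/-- The second stack keeps a copy of `x`, which is moved back afterwards because every later block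
needs it again. -/
theorem runs_majStr (i : List (Option Bool)) (x c : List Bool) (l : List (Γ k₀))
    (y : MajTok × Bool × σ) :
    (majStr k₀ e).Runs ((none, y), majStk i x.reverse [] [] c (single k₀ l))
      ((none, y), majStk i x.reverse [] [] c (single k₀ ((x.map some).map e ++ l)))
      (4 * x.length + 4) := by
  have h := runs_drain (Γ := MajΓ Γ) (p := .pop (.inl .str) (fun s o => (o, s.2)) .halt)
    (q := .push (.inr k₀) (fun s => e s.1) (.push (.inl .aux) (fun s => s.1.getD false)
      (.pop (.inl .str) (fun s o => (o, s.2)) .halt)))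
    (fun w (z : List Bool) => majStk i w z [] c (single k₀ ((z.map some).map e ++ l)))
    (fun z a => a :: z) y
    (by simp) (by simp [single_self, update_single]) x.reverse []
  have h' := runs_drain (Γ := MajΓ Γ) (p := .pop (.inl .aux) (fun s o => (o, s.2)) .halt)
    (q := .push (.inl .str) (fun s => s.1.getD false)
      (.pop (.inl .aux) (fun s o => (o, s.2)) .halt))
    (fun w (z : List Bool) => majStk i z w [] c (single k₀ ((x.map some).map e ++ l)))
    (fun z a => a :: z) y
    (by simp) (by simp) x []
  rw [foldl_cons, List.append_nil, List.reverse_reverse] at h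
  rw [foldl_cons, List.append_nil] at h'
  refine (h.seq h').mono ?_
  rw [List.length_reverse]
  omega

/-- Count the answer of the learner. -/
def majCount : Frag (MajΓ Γ) (MajSt σ) :=
  (Frag.stm (.pop (.inr k₁) (fun s o => (o.map d, s.2)) .halt)).seq <|
  Frag.ite (fun s => s.1.getD false) (majCountBit true) (majCountBit false)
where
  /-- Count the answer `b`. -/
  majCountBit (b : Bool) : Frag (MajΓ Γ) (MajSt σ) := Frag.stm (
    .pop (.inl .cnt) (fun s o => (o, s.2)) <|
    .branch (fun s => s.1 == some !b)
      (.load (fun s => (none, ((none, none, none), s.2.1.full, s.2.2.2))) .halt)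
      (.branch (fun s => s.1 == none)
        (.push (.inl .cnt) (fun _ => b)
          (.load (fun s => (none, ((none, none, none), s.2.1.full, s.2.2.2))) .halt))
        (.push (.inl .cnt) (fun _ => b) (.push (.inl .cnt) (fun _ => b)
          (.load (fun s => (none, ((none, none, none), s.2.1.full, s.2.2.2))) .halt)))))

/-- The loop flag becomes `t.full`: an incomplete token means that the advice has ended and that
this block was the last. -/
theorem runs_majCount (i : List (Option Bool)) (x x' w c : List Bool) (b live : Bool) (t : MajTok)
    (v : σ) :
    (majCount k₁ d).Runs ((none, t, live, v), majStk i x x' w c (single k₁ [d.symm b]))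
      ((none, (none, none, none), t.full, v), majStk i x x' w (countStep c b) fun _ => []) 3 := by
  have h : ∀ b r, (majCount.majCountBit (Γ := Γ) b).Runs
      ((r, t, live, v), majStk i x x' w c fun _ => [])
      ((none, (none, none, none), t.full, v), majStk i x x' w (countStep c b) fun _ => []) 1 := by
    intro b r
    refine Frag.runs_stm ?_
    cases c with
    | nil => simp [countStep]
    | cons a c => cases a <;> cases b <;> simp [countStep]
  refine (Frag.Runs.seq (b := ((some b, t, live, v), majStk i x x' w c fun _ => []))
    (Frag.runs_stm ?_) (t' := 2) ?_).mono le_rfl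
  · simp [single_self, update_single, single_nil]
  · cases b
    · exact Frag.Runs.ite_false rfl (h false _)
    · exact Frag.Runs.ite_true rfl (h true _)

/-- Remove the string `x` and the counter, and output the sign of the counter. -/
def majFinish : Frag (MajΓ Γ) (MajSt σ) :=
  let p : Stmt (MajΓ Γ) Unit (MajSt σ) := .pop (.inl .str) (fun s o => (o, s.2)) .halt
  let p' : Stmt (MajΓ Γ) Unit (MajSt σ) := .pop (.inl .cnt) (fun s o => (o, s.2)) .halt
  let q : Stmt (MajΓ Γ) Unit (MajSt σ) :=
    .peek (.inl .cnt) (fun s o => (o, s.2)) (.push (.inr k₁) (fun s => d.symm (s.1.getD false))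
      (.load (fun s => (none, (none, none, none), true, s.2.2.2)) .halt))
  (drain p p).seq ((Frag.stm q).seq (drain p' p'))

theorem runs_majFinish (x c : List Bool) (live : Bool) (t : MajTok) (v : σ) :
    (majFinish k₁ d).Runs ((none, t, live, v), majStk [] x [] [] c fun _ => [])
      ((none, (none, none, none), true, v),
        majStk [] [] [] [] [] (single k₁ [d.symm (c.headD false)]))
      (2 * x.length + 2 * c.length + 5) := by
  have h := runs_drain (Γ := MajΓ Γ) (p := .pop (.inl .str) (fun s o => (o, s.2)) .halt)
    (q := .pop (.inl .str) (fun s o => (o, s.2)) .halt)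
    (fun w (_ : Unit) => majStk (Γ := Γ) [] w [] [] c fun _ => [])
    (fun z _ => z) (t, live, v) (by simp) (by simp) x ()
  have h' := runs_drain (Γ := MajΓ Γ) (p := .pop (.inl .cnt) (fun s o => (o, s.2)) .halt)
    (q := .pop (.inl .cnt) (fun s o => (o, s.2)) .halt)
    (fun w (_ : Unit) => majStk [] [] [] [] w (single k₁ [d.symm (c.headD false)]))
    (fun z _ => z) (((none, none, none) : MajTok), true, v) (by simp) (by simp) c ()
  refine (Frag.Runs.seq h (Frag.Runs.seq (Frag.runs_stm ?_) h')).mono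
    (t := (2 * x.length + 2) + (1 + (2 * c.length + 2))) (by omega)
  cases c <;> simp [single]

end Machine


/-- The tape of a training set. -/
def encSamples (T : TrainingSet) : List (Option Bool) :=
  encStrings (T.flatMap fun s => [s.1, [s.2]])

/-- The learner's tape is built on a stack from its far end: first the examples, then the random
bits, then `x`. The advice lists the parts of a block in the same order. -/
theorem encLearner_eq (x r : List Bool) (T : TrainingSet) :
    encLearner (x, T, r) = x.map some ++ none :: (r.map some ++ none :: encSamples T) := by
  simp [encLearner, encStrings, encSamples]

theorem encSamples_cons (w : List Bool) (b : Bool) (T : TrainingSet) :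
    encSamples ((w, b) :: T) = w.map some ++ none :: some b :: none :: encSamples T := by
  simp [encSamples, encStrings]

theorem encSamples_nil : encSamples [] = [] := rfl

/-! ### The main loop of the majority machine -/

section Loop

variable {M : List Bool × TrainingSet × List Bool → Bool}
  (C : TM2ComputableInPolyTime encLearner Computability.encodeBool M)

/-- Complete the current block, run the learner and count its answer. -/
def majBlock : Frag (MajΓ C.tm.Γ) (MajSt C.tm.σ) :=
  let sep : Frag (MajΓ C.tm.Γ) (MajSt C.tm.σ) :=
    Frag.stm (.push (.inr C.tm.k₀) (fun _ => C.inputAlphabet.symm none) .halt)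
  let call : Frag (MajΓ C.tm.Γ) (MajSt C.tm.σ) :=
    Frag.embed Sum.inr (fun s => s.2.2.2) (fun v s => (s.1, s.2.1, s.2.2.1, v)) (Frag.ofTM C.tm)
  (((((sep.seq (majCur C.tm.k₀ C.inputAlphabet.symm)).seq sep).seq
    (majStr C.tm.k₀ C.inputAlphabet.symm)).seq call).seq (majCount C.tm.k₁ C.outputAlphabet))

/-- The examples already lie on the learner's stack; a separator, the random bits, a separator and
`x` complete its input. The bound `n` covers the length of that input, hence also the learner's
time. -/
theorem runs_majBlock (i : List (Option Bool)) (x w c : List Bool) (T : TrainingSet) (t : MajTok)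
    {n : ℕ} (hn : x.length + w.length + (encSamples T).length + 2 ≤ n) :
    (majBlock C).Runs
      ((none, t, true, C.tm.initialState), majStk i x.reverse [] w c
        (single C.tm.k₀ ((encSamples T).map C.inputAlphabet.symm)))
      ((none, (none, none, none), t.full, C.tm.initialState), majStk i x.reverse [] []
        (countStep c (M (x, T, w.reverse))) fun _ => [])
      (4 * n + C.time.eval n + 11) := by
  have h1 := runs_majCur C.tm.k₀ C.inputAlphabet.symm i x.reverse [] w c
    ((none :: encSamples T).map C.inputAlphabet.symm) (t, true, C.tm.initialState)
  have h2 := runs_majStr C.tm.k₀ C.inputAlphabet.symm i x c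
    ((none :: (w.reverse.map some ++ none :: encSamples T)).map C.inputAlphabet.symm)
    (t, true, C.tm.initialState)
  have h3 := Frag.Runs.embed (Γ' := MajΓ C.tm.Γ)
    (ι := Sum.inr) (get := fun s : MajSt C.tm.σ => s.2.2.2)
    (set := fun v s => (s.1, s.2.1, s.2.2.1, v)) Sum.inr_injective
    (fun _ _ => rfl) (fun _ _ _ => rfl) (runs_ofTM C (x, T, w.reverse))
    (x := (none, t, true, C.tm.initialState))
    (S := majStk i x.reverse [] [] c (single C.tm.k₀
      ((encLearner (x, T, w.reverse)).map C.inputAlphabet.symm)))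
    (S' := majStk i x.reverse [] [] c (single C.tm.k₁
      [C.outputAlphabet.symm (M (x, T, w.reverse))]))
    (fun _ => rfl) (fun _ => rfl) (fun k' hk => by
      rcases k' with (_ | _) | k'
      all_goals first | rfl | exact absurd rfl (hk k'))
  have h4 := runs_majCount C.tm.k₁ C.outputAlphabet i x.reverse [] [] c (M (x, T, w.reverse)) true
    t C.tm.initialState
  rw [← List.map_append] at h1 h2
  rw [← encLearner_eq] at h2
  have hlen : (encLearner (x, T, w.reverse)).length ≤ n := by
    rw [encLearner_eq]
    simp only [List.length_append, List.length_map, List.length_cons, List.length_reverse]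
    omega
  have := natPoly_eval_mono C.time hlen
  simp only at this
  refine (Frag.Runs.seq (Frag.Runs.seq (Frag.Runs.seq (Frag.Runs.seq (Frag.Runs.seq
    (Frag.runs_stm ?_) h1) (Frag.runs_stm ?_)) h2) h3) h4).mono (by omega)
  · simp [single_self, update_single]
  · simp [single_self, update_single]

/-- Read and process three symbols of the advice. -/
def majBody : Frag (MajΓ C.tm.Γ) (MajSt C.tm.σ) :=
  let read : Stmt (MajΓ C.tm.Γ) Unit (MajSt C.tm.σ) :=
    .pop (.inl .inp) (fun s o => (s.1, (o, s.2.1.2), s.2.2)) <|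
    .pop (.inl .inp) (fun s o => (s.1, (s.2.1.1, o, s.2.1.2.2), s.2.2)) <|
    .pop (.inl .inp) (fun s o => (s.1, (s.2.1.1, s.2.1.2.1, o), s.2.2)) .halt
  let clear : Stmt (MajΓ C.tm.Γ) Unit (MajSt C.tm.σ) :=
    .load (fun s => (s.1, (none, none, none), s.2.2)) .halt
  let label : Stmt (MajΓ C.tm.Γ) Unit (MajSt C.tm.σ) :=
    .push (.inr C.tm.k₀) (fun _ => C.inputAlphabet.symm none) <|
    .push (.inr C.tm.k₀) (fun s => C.inputAlphabet.symm (some s.2.1.bit)) <|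
    .push (.inr C.tm.k₀) (fun _ => C.inputAlphabet.symm none) clear
  (Frag.stm read).seq <|
  Frag.ite (fun s => s.2.1.isBit) (Frag.stm (.push (.inl .cur) (fun s => s.2.1.bit) clear)) <|
  Frag.ite (fun s => s.2.1.isLabel)
    ((Frag.stm label).seq (majCur C.tm.k₀ C.inputAlphabet.symm)) (majBlock C)

/-- Induction along the recursion of `decodeBlocks`. The invariant is that the learner's input stack
carries the encoded training set read so far and `cur` the unfinished string. -/
theorem runs_majLoop (x a w c : List Bool) (T : TrainingSet) {n : ℕ}
    (hn : x.length + w.length + (encSamples T).length + a.length + 2 ≤ n) :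
    (Frag.loop (fun s => s.2.2.1) (majBody C)).Runs
      ((none, (none, none, none), true, C.tm.initialState),
        majStk (a.map some ++ [none]) x.reverse [] w c
          (single C.tm.k₀ ((encSamples T).map C.inputAlphabet.symm)))
      ((none, (none, none, none), false, C.tm.initialState), majStk [] x.reverse [] []
        (((decodeBlocks a w T).map fun t => M (x, t.2, t.1)).foldl countStep c) fun _ => [])
      ((a.length + 1) * (4 * n + C.time.eval n + 15) + 1) := by
  fun_induction decodeBlocks a w T generalizing c with
  | case1 d b rest w T ih =>
    simp only [List.length_cons] at hn ih
    refine (Frag.Runs.loop rfl (Frag.Runs.seq (Frag.runs_stm (b := ((none,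
      (some (some false), some (some d), some (some b)), true, C.tm.initialState),
        majStk (rest.map some ++ [none]) x.reverse [] w c
          (single C.tm.k₀ ((encSamples T).map C.inputAlphabet.symm)))) ?_)
      (Frag.Runs.ite_true rfl (Frag.runs_stm ?_))) (ih c (by omega))).mono ?_
    · simp
    · simp [MajTok.bit]
    · simp only [List.length_cons]; ring_nf; omega
  | case2 b rest w T ih =>
    rw [encSamples_cons] at ih
    simp only [List.length_cons, List.length_append, List.length_map, List.length_reverse,
      List.length_nil] at hn ih
    have h1 := runs_majCur C.tm.k₀ C.inputAlphabet.symm (rest.map some ++ [none]) x.reverse [] w c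
      ((none :: some b :: none :: encSamples T).map C.inputAlphabet.symm)
      ((none, none, none), true, C.tm.initialState)
    rw [← List.map_append] at h1
    refine (Frag.Runs.loop rfl (Frag.Runs.seq (Frag.runs_stm (b := ((none,
      (some (some true), some (some false), some (some b)), true, C.tm.initialState),
        majStk (rest.map some ++ [none]) x.reverse [] w c
          (single C.tm.k₀ ((encSamples T).map C.inputAlphabet.symm)))) ?_)
      (Frag.Runs.ite_false rfl (Frag.Runs.ite_true rfl (Frag.Runs.seq (Frag.runs_stm ?_) h1))))
      (ih c (by omega))).mono ?_
    · simp
    · simp [MajTok.bit, single_self, update_single]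
    · simp only [List.length_cons]; ring_nf; omega
  | case3 b rest w T ih =>
    simp only [List.length_cons, encSamples_nil, List.length_nil] at hn ih
    have h1 := runs_majBlock C (rest.map some ++ [none]) x w c T
      (some (some true), some (some true), some (some b)) (n := n) (by omega)
    rw [List.map_nil, single_nil] at ih
    refine (Frag.Runs.loop rfl (Frag.Runs.seq (Frag.runs_stm (b := ((none,
      (some (some true), some (some true), some (some b)), true, C.tm.initialState),
        majStk (rest.map some ++ [none]) x.reverse [] w c
          (single C.tm.k₀ ((encSamples T).map C.inputAlphabet.symm)))) ?_)
      (Frag.Runs.ite_false rfl (Frag.Runs.ite_false rfl h1)))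
      (ih _ (by omega))).mono ?_
    · simp
    · simp only [List.length_cons]; ring_nf; omega
  -- From here on the end marker falls within the three symbols read. The token is then neither a
  -- bit nor a label and not full, so the pending block is run and the loop exits.
  | case4 w T =>
    have h1 := runs_majBlock C [] x w c T (some none, none, none) (n := n) (by omega)
    refine (Frag.Runs.loop rfl (Frag.Runs.seq (Frag.runs_stm (b := ((none,
      (some none, none, none), true, C.tm.initialState), majStk [] x.reverse [] w c
          (single C.tm.k₀ ((encSamples T).map C.inputAlphabet.symm)))) ?_)
      (Frag.Runs.ite_false rfl (Frag.Runs.ite_false rfl h1)))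
      (Frag.runs_loop_exit rfl)).mono ?_
    · simp
    · simp only [List.length_nil]; ring_nf; omega
  | case5 a w T =>
    have h1 := runs_majBlock C [] x w c T (some (some a), some none, none) (n := n) (by omega)
    refine (Frag.Runs.loop rfl (Frag.Runs.seq (Frag.runs_stm (b := ((none,
      (some (some a), some none, none), true, C.tm.initialState), majStk [] x.reverse [] w c
          (single C.tm.k₀ ((encSamples T).map C.inputAlphabet.symm)))) ?_)
      (Frag.Runs.ite_false (by cases a <;> rfl) (Frag.Runs.ite_false (by cases a <;> rfl) h1)))
      (Frag.runs_loop_exit rfl)).mono ?_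
    · simp
    · simp only [List.length_cons, List.length_nil]; ring_nf; omega
  | case6 a b w T =>
    have h1 := runs_majBlock C [] x w c T (some (some a), some (some b), some none) (n := n)
      (by omega)
    refine (Frag.Runs.loop rfl (Frag.Runs.seq (Frag.runs_stm (b := ((none,
      (some (some a), some (some b), some none), true, C.tm.initialState),
        majStk [] x.reverse [] w c
          (single C.tm.k₀ ((encSamples T).map C.inputAlphabet.symm)))) ?_)
      (Frag.Runs.ite_false (by cases a <;> rfl)
        (Frag.Runs.ite_false (by cases a <;> cases b <;> rfl) h1)))
      (Frag.runs_loop_exit rfl)).mono ?_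
    · simp
    · simp only [List.length_cons, List.length_nil]; ring_nf; omega

end Loop

theorem length_countStep (c : List Bool) (b : Bool) : (countStep c b).length ≤ c.length + 1 := by
  cases c with
  | nil => simp [countStep]
  | cons a c => simp only [countStep]; split <;> simp only [List.length_cons] <;> omega

theorem length_foldl_countStep (l c : List Bool) :
    (l.foldl countStep c).length ≤ c.length + l.length := by
  induction l generalizing c with
  | nil => simp
  | cons a l ih =>
    have := ih (countStep c a)
    have := length_countStep c a
    simp only [List.foldl_cons, List.length_cons]
    omega

theorem length_decodeBlocks (a w : List Bool) (T : TrainingSet) :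
    (decodeBlocks a w T).length ≤ a.length + 1 := by
  fun_induction decodeBlocks a w T <;> simp only [List.length_cons, List.length_nil] at * <;> omega

/-- Repeated runs of a learner on data from an advice string take polynomial time. -/
theorem PolyTime.majorityRun {M : List Bool × TrainingSet × List Bool → Bool}
    (hM : PolyTime encLearner Computability.encodeBool M) :
    PolyTime encPair Computability.encodeBool (majorityRun M) := by
  obtain ⟨C⟩ := hM
  let := C.tm.σFin
  let := C.tm.kFin
  let v0 : MajSt C.tm.σ := (none, (none, none, none), true, C.tm.initialState)
  refine polyTime_of_frag (Γ := MajΓ C.tm.Γ) (.inl .inp) (.inr C.tm.k₁)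
    (Equiv.refl (Option Bool)) C.outputAlphabet v0
    (((majInit (Γ := C.tm.Γ)).seq (Frag.loop (fun s => s.2.2.1) (majBody C))).seq
      (majFinish C.tm.k₁ C.outputAlphabet))
    ((Polynomial.X + 1) * (4 * Polynomial.X + C.time + 15) + 1 + 4 * Polynomial.X + 9) ?_
  rintro ⟨x, a⟩
  have hlen : (encPair (x, a)).length = x.length + a.length + 2 := by
    simp [encPair, encStrings]; omega
  have h1 := runs_majInit (Γ := C.tm.Γ) x (a.map some ++ [none]) v0.2
  have h2 := runs_majLoop C x a [] [] [] (n := (encPair (x, a)).length)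
    (by rw [hlen, encSamples_nil]; simp)
  rw [encSamples_nil, List.map_nil, single_nil] at h2
  have h3 := runs_majFinish C.tm.k₁ C.outputAlphabet x.reverse
    (((decodeBlocks a [] []).map fun t => M (x, t.2, t.1)).foldl countStep []) false
    (none, none, none) C.tm.initialState
  have e1 : (single (.inl .inp) ((encPair (x, a)).map (Equiv.refl (Option Bool)).symm) :
      ∀ k, List (MajΓ C.tm.Γ k)) =
      majStk (x.map some ++ none :: (a.map some ++ [none])) [] [] [] [] (fun _ => []) := by
    funext k; rcases k with (_ | _) | k <;> simp [single, encPair, encStrings]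
  have e2 : (single (.inr C.tm.k₁) ((Computability.encodeBool
      (DataLearning.majorityRun M (x, a))).map C.outputAlphabet.symm) :
      ∀ k, List (MajΓ C.tm.Γ k)) = majStk [] [] [] [] [] (single C.tm.k₁ [C.outputAlphabet.symm
      ((((decodeBlocks a [] []).map fun t => M (x, t.2, t.1)).foldl countStep []).headD
        false)]) := by
    have e3 : (fun _ => [] : ∀ k, List (MajΓ C.tm.Γ k)) =
        majStk [] [] [] [] [] (fun _ => []) := by
      funext k; rcases k with (_ | _) | k <;> simp
    rw [single, single, ← update_majStk_mach, ← e3]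
    rfl
  rw [e1, e2]
  refine ((h1.seq h2).seq h3).mono ?_
  -- The counter is at most as long as the number of blocks, which exceeds the advice length by at
  -- most one; this bounds the cost of clearing it.
  have h4 := length_foldl_countStep ((decodeBlocks a [] []).map fun t => M (x, t.2, t.1)) []
  have h5 := length_decodeBlocks a [] []
  rw [List.length_map, List.length_nil] at h4
  have h6 : (a.length + 1) * (4 * (encPair (x, a)).length + C.time.eval (encPair (x, a)).length + 15)
      ≤ ((encPair (x, a)).length + 1) *
        (4 * (encPair (x, a)).length + C.time.eval (encPair (x, a)).length + 15) :=
    Nat.mul_le_mul_right _ (by omega)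
  simp only [Polynomial.eval_add, Polynomial.eval_mul, Polynomial.eval_ofNat, Polynomial.eval_X,
    Polynomial.eval_one, List.length_reverse]
  omega

/-! ### Polynomial-time functions are primitive recursive -/

theorem primrec_natPoly_eval (p : Polynomial ℕ) : Primrec fun n => p.eval n := by
  induction p using Polynomial.induction_on' with
  | add p q hp hq => simpa using Primrec.nat_add.comp hp hq
  | monomial n a =>
    have : Primrec fun x : ℕ => x ^ n := by
      induction n with
      | zero => simpa using Primrec.const 1
      | succ n ih => simpa [pow_succ] using Primrec.nat_mul.comp ih Primrec.id
    simpa using Primrec.nat_mul.comp (Primrec.const a) this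

/-- Finitely many primitive recursive functions can be selected by their index. It glues the
simulators of the individual labels into one step function. -/
theorem primrec₂_of_finite_left {Λ β γ : Type} [Primcodable Λ] [Finite Λ] [Primcodable β]
    [Primcodable γ] {f : Λ → β → γ} (h : ∀ l, Primrec (f l)) : Primrec₂ f := by
  obtain ⟨n, ⟨e⟩⟩ := Finite.exists_equiv_fin Λ
  have h1 : Primrec₂ fun (i : Fin n) b => f (e.symm i) b :=
    Primrec.fin_curry₁.2 fun i => h _
  have h2 : Primrec e := Primrec.dom_finite _
  exact (h1.comp (h2.comp Primrec.fst) Primrec.snd).of_eq fun p => by simp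

theorem primrec_update {n : ℕ} {β γ : Type} [Primcodable β] [Primcodable γ] {f : β → Fin n → γ}
    {g : β → γ} (hf : Primrec f) (i : Fin n) (hg : Primrec g) :
    Primrec fun b => Function.update (f b) i (g b) := by
  refine Primrec.fin_curry.2 ?_
  have h1 : PrimrecPred fun p : β × Fin n => p.2 = i := Primrec.eq.comp Primrec.snd (.const i)
  have h2 : Primrec fun p : β × Fin n => f p.1 p.2 :=
    Primrec.fin_app.comp (hf.comp Primrec.fst) Primrec.snd
  exact (Primrec.ite h1 (hg.comp Primrec.fst) h2).of_eq fun p => by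
    simp [Function.update_apply]

/-! ### Primitive recursive simulation of stack machines -/

section Simulation

variable {K : Type} {Γ : K → Type} {Λ σ : Type}

/-- The symbols that a statement pushes. -/
def pushes : Stmt Γ Λ σ → Set (Σ k, Γ k)
  | .push k f q => (Set.range fun v => ⟨k, f v⟩) ∪ pushes q
  | .peek _ _ q => pushes q
  | .pop _ _ q => pushes q
  | .load _ q => pushes q
  | .branch _ q q' => pushes q ∪ pushes q'
  | .goto _ => ∅
  | .halt => ∅

/-- A push is a function of the finite state, so it writes finitely many symbols, even onto a stack
whose alphabet is infinite. -/
theorem finite_pushes [Finite σ] (q : Stmt Γ Λ σ) : (pushes q).Finite := by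
  induction q with
  | push k f q ih => exact (Set.finite_range _).union ih
  | branch f q q' ih ih' => exact ih.union ih'
  | goto f => exact Set.finite_empty
  | halt => exact Set.finite_empty
  | _ => assumption

variable [DecidableEq K] {G : Set (Σ k, Γ k)} {n : ℕ} (e : K ≃ Fin n)

/-- The lists `T` over the finite alphabet `G` represent the stacks `S`. -/
def Represents (S : ∀ k, List (Γ k)) (T : Fin n → List G) : Prop :=
  ∀ k, (T (e k)).map Subtype.val = (S k).map (Sigma.mk k)

/-- The symbol of stack `k` that a symbol of the common alphabet stands for. -/
def symbolAt (k : K) (g : Σ k, Γ k) : Option (Γ k) :=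
  if h : g.1 = k then some (h ▸ g.2) else none

theorem symbolAt_mk (k : K) (a : Γ k) : symbolAt k ⟨k, a⟩ = some a := by simp [symbolAt]

variable {e} {S : ∀ k, List (Γ k)} {T : Fin n → List G}

theorem Represents.head? (h : Represents e S T) (k : K) :
    (T (e k)).head?.bind (fun g => symbolAt k g.1) = (S k).head? := by
  have := h k
  cases h1 : T (e k) with
  | nil =>
    rw [h1, List.map_nil, eq_comm, List.map_eq_nil_iff] at this
    simp [this]
  | cons g l =>
    cases h2 : S k with
    | nil => simp [h1, h2] at this
    | cons a l' =>
      simp only [h1, h2, List.map_cons, List.cons.injEq] at this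
      simp [this.1, symbolAt_mk]

theorem Represents.update (h : Represents e S T) (k : K) {l : List G} {l' : List (Γ k)}
    (hl : l.map Subtype.val = l'.map (Sigma.mk k)) :
    Represents e (Function.update S k l') (Function.update T (e k) l) := by
  intro k'
  by_cases hk : k' = k
  · subst hk; simpa using hl
  · rw [Function.update_of_ne hk, Function.update_of_ne (by simpa using hk)]
    exact h k'

/-- Over a finite state set and a finite alphabet, every function that occurs in a statement has
finite domain and is thus primitive recursive; what remains are list operations on finitely many
stacks. -/
theorem exists_primrec_stepAux [Primcodable Λ] [Finite Λ] [Primcodable σ] [Finite σ]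
    [Primcodable G] [Finite G] (e : K ≃ Fin n) (q : Stmt Γ Λ σ) (hq : pushes q ⊆ G) :
    ∃ F : σ × (Fin n → List G) → Option Λ × σ × (Fin n → List G), Primrec F ∧
      ∀ v S T, Represents e S T → (F (v, T)).1 = (stepAux q v S).l ∧
        (F (v, T)).2.1 = (stepAux q v S).var ∧ Represents e (stepAux q v S).stk (F (v, T)).2.2 := by
  induction q with
  | push k f q ih =>
    obtain ⟨F, hF, h⟩ := ih (Set.subset_union_right.trans hq)
    have hm : ∀ v, (⟨k, f v⟩ : Σ k, Γ k) ∈ G := fun v => hq (Or.inl ⟨v, rfl⟩)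
    have hp : Primrec fun p : σ × (Fin n → List G) =>
        (p.1, Function.update p.2 (e k) (⟨⟨k, f p.1⟩, hm p.1⟩ :: p.2 (e k))) :=
      Primrec.fst.pair (primrec_update Primrec.snd _ (Primrec.list_cons.comp
        ((Primrec.dom_finite fun v => (⟨⟨k, f v⟩, hm v⟩ : G)).comp Primrec.fst)
        (Primrec.fin_app.comp Primrec.snd (.const _))))
    refine ⟨_, hF.comp hp, fun v S T hST => ?_⟩
    exact h v _ _ (hST.update k (by simp [hST k]))
  | peek k f q ih =>
    obtain ⟨F, hF, h⟩ := ih hq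
    have hp : Primrec fun p : σ × (Fin n → List G) =>
        (f p.1 ((p.2 (e k)).head?.bind fun g => symbolAt k g.1), p.2) :=
      Primrec.pair ((Primrec.dom_finite fun y : σ × Option G =>
        f y.1 (y.2.bind fun g => symbolAt k g.1)).comp (Primrec.fst.pair (Primrec.list_head?.comp
        (Primrec.fin_app.comp Primrec.snd (.const _))))) Primrec.snd
    refine ⟨_, hF.comp hp, fun v S T hST => ?_⟩
    simp only [hST.head?]
    exact h _ _ _ hST
  | pop k f q ih =>
    obtain ⟨F, hF, h⟩ := ih hq
    have hp : Primrec fun p : σ × (Fin n → List G) =>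
        (f p.1 ((p.2 (e k)).head?.bind fun g => symbolAt k g.1),
          Function.update p.2 (e k) (p.2 (e k)).tail) :=
      Primrec.pair ((Primrec.dom_finite fun y : σ × Option G =>
        f y.1 (y.2.bind fun g => symbolAt k g.1)).comp (Primrec.fst.pair (Primrec.list_head?.comp
        (Primrec.fin_app.comp Primrec.snd (.const _))))) (primrec_update Primrec.snd _
        (Primrec.list_tail.comp (Primrec.fin_app.comp Primrec.snd (.const _))))
    refine ⟨_, hF.comp hp, fun v S T hST => ?_⟩
    simp only [hST.head?]
    exact h _ _ _ (hST.update k (by rw [List.map_tail, List.map_tail, hST k]))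
  | load f q ih =>
    obtain ⟨F, hF, h⟩ := ih hq
    have hp : Primrec fun p : σ × (Fin n → List G) => (f p.1, p.2) :=
      Primrec.pair ((Primrec.dom_finite f).comp Primrec.fst) Primrec.snd
    exact ⟨_, hF.comp hp, fun v S T hST => h _ _ _ hST⟩
  | branch f q q' ih ih' =>
    obtain ⟨F, hF, h⟩ := ih (Set.subset_union_left.trans hq)
    obtain ⟨F', hF', h'⟩ := ih' (Set.subset_union_right.trans hq)
    refine ⟨fun p => cond (f p.1) (F p) (F' p),
      Primrec.cond ((Primrec.dom_finite f).comp Primrec.fst) hF hF', fun v S T hST => ?_⟩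
    simp only [stepAux]
    cases f v
    · exact h' _ _ _ hST
    · exact h _ _ _ hST
  | goto f =>
    exact ⟨fun p => (some (f p.1), p),
      Primrec.pair ((Primrec.dom_finite fun v => some (f v)).comp Primrec.fst) Primrec.id,
      fun v S T hST => ⟨rfl, rfl, hST⟩⟩
  | halt => exact ⟨fun p => (none, p), Primrec.pair (.const _) Primrec.id,
      fun v S T hST => ⟨rfl, rfl, hST⟩⟩

/-- Halted configurations are fixed points of the simulator, so iterating it up to any upper bound
for the running time gives the final stacks. -/
theorem exists_primrec_steps [Primcodable Λ] [Finite Λ] [Primcodable σ] [Finite σ]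
    [Primcodable G] [Finite G] (e : K ≃ Fin n) (M : Λ → Stmt Γ Λ σ) (hM : ∀ l, pushes (M l) ⊆ G) :
    ∃ F : Option Λ × σ × (Fin n → List G) → Option Λ × σ × (Fin n → List G), Primrec F ∧
      ∀ (l : Option Λ) v S T (t : ℕ) v' S', Represents e S T →
        (∃ s ≤ t, StepsIn M ⟨l, v, S⟩ s ⟨none, v', S'⟩) →
        Represents e S' (F^[t] (l, v, T)).2.2 := by
  choose F hF h using fun l => exists_primrec_stepAux e (M l) (hM l)
  have hF' : Primrec₂ F := primrec₂_of_finite_left hF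
  let H : Option Λ × σ × (Fin n → List G) → Option Λ × σ × (Fin n → List G) :=
    fun p => p.1.casesOn p fun l => F l p.2
  have hH : Primrec H := Primrec.option_casesOn (f := fun p => p) (g := fun p l => F l p.2)
    Primrec.fst Primrec.id (hF'.comp Primrec.snd (Primrec.snd.comp Primrec.fst)).to₂
  refine ⟨H, hH, ?_⟩
  have hfix : ∀ t p, (H^[t] (none, p)) = (none, p) := fun t p =>
    Function.iterate_fixed rfl t
  intro l v S T t v' S' hST ⟨s, hst, hs⟩
  obtain ⟨r, rfl⟩ := Nat.exists_eq_add_of_le hst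
  clear hst
  induction s generalizing l v S T with
  | zero => cases hs; rw [hfix]; exact hST
  | succ s ih =>
    rcases hs with _ | ⟨h1, h2⟩
    rcases l with _ | l
    · simp at h1
    · simp only [step, Option.some.injEq] at h1
      subst h1
      obtain ⟨g1, g2, g3⟩ := h l v S T hST
      have h3 := ih (stepAux (M l) v S).l (stepAux (M l) v S).var _ _ g3 h2
      rw [← g1, ← g2] at h3
      rw [Nat.add_right_comm, Function.iterate_succ_apply]
      exact h3

end Simulation

/-- A function that is computed in polynomial time is primitive recursive. -/
theorem PolyTime.primrec {α β A B : Type} [Primcodable α] [Primcodable A] [Primcodable B]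
    {ea : α → List A} {eb : β → List B} {f : α → β} (h : PolyTime ea eb f) (hea : Primrec ea) :
    Primrec fun a => eb (f a) := by
  obtain ⟨C⟩ := h
  let := C.tm.σFin
  let := C.tm.kFin
  let := C.tm.ΛFin
  let := C.tm.Γk₀Fin
  let : Primcodable C.tm.σ := Primcodable.ofEquiv _ (Fintype.equivFin C.tm.σ)
  let : Primcodable C.tm.Λ := Primcodable.ofEquiv _ (Fintype.equivFin C.tm.Λ)
  -- Every symbol that ever occurs is an input symbol or was pushed by one of the finitely many
  -- statements.
  let G : Set (Σ k, C.tm.Γ k) := Set.range (Sigma.mk C.tm.k₀) ∪ ⋃ l, pushes (C.tm.m l)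
  have hG : G.Finite := (Set.finite_range _).union (Set.finite_iUnion fun l => finite_pushes _)
  have : Finite G := hG
  let : Fintype G := Fintype.ofFinite G
  let : Primcodable G := Primcodable.ofEquiv _ (Fintype.equivFin G)
  have : Finite A := Finite.of_equiv _ C.inputAlphabet
  have e := Fintype.equivFin C.tm.K
  obtain ⟨F, hF, hsim⟩ := exists_primrec_steps (G := G) e C.tm.m
    fun l => (Set.subset_iUnion (fun l => pushes (C.tm.m l)) l).trans Set.subset_union_right
  let inp : A → G := fun x => ⟨⟨C.tm.k₀, C.inputAlphabet.symm x⟩, Or.inl ⟨_, rfl⟩⟩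
  let T₀ : α → Fin (Fintype.card C.tm.K) → List G := fun a =>
    Function.update (fun _ => []) (e C.tm.k₀) ((ea a).map inp)
  have hT₀ : Primrec T₀ := primrec_update (.const _) _
    (Primrec.list_map hea ((Primrec.dom_finite inp).comp₂ Primrec₂.right))
  let out : G → Option B := fun g => (symbolAt C.tm.k₁ g.1).map C.outputAlphabet
  have hrun : Primrec fun a => F^[C.time.eval (ea a).length]
      (some C.tm.main, C.tm.initialState, T₀ a) :=
    Primrec.nat_iterate ((primrec_natPoly_eval C.time).comp (Primrec.list_length.comp hea))
      ((Primrec.const _).pair ((Primrec.const _).pair hT₀)) (hF.comp₂ Primrec₂.right)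
  refine (Primrec.listFilterMap (Primrec.fin_app.comp (Primrec.snd.comp (Primrec.snd.comp hrun))
    (.const (e C.tm.k₁))) ((Primrec.dom_finite out).comp₂ Primrec₂.right)).of_eq fun a => ?_
  have h0 : Represents e (single C.tm.k₀ ((ea a).map C.inputAlphabet.symm)) (T₀ a) := by
    refine Represents.update (fun _ => by simp) _ ?_
    simp [inp, Function.comp_def]
  have h1 := hsim _ _ _ _ _ _ _ h0 (runs_ofTM C a) C.tm.k₁
  simp only [single_self] at h1
  have h2 : ∀ l : List G, l.filterMap out =
      (l.map Subtype.val).filterMap fun g => (symbolAt C.tm.k₁ g).map C.outputAlphabet := by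
    intro l
    rw [List.filterMap_map]
    rfl
  simp only [id]
  rw [h2]
  refine (congrArg _ h1).trans ?_
  simp [List.filterMap_map, Function.comp_def, symbolAt_mk]

/-! ### Expectations -/

/-- The expectation of a nonnegative function. -/
def expect {α : Type} (μ : PMF α) (f : α → ℝ≥0∞) : ℝ≥0∞ := ∑' a, μ a * f a

/-- The indicator of the value `true`. -/
def ind (b : Bool) : ℝ≥0∞ := if b then 1 else 0

@[simp] theorem ind_true : ind true = 1 := rfl
@[simp] theorem ind_false : ind false = 0 := rfl

theorem ind_le_one (b : Bool) : ind b ≤ 1 := by cases b <;> simp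

section Expect

variable {α β : Type} (μ : PMF α)

theorem expect_mono {f g : α → ℝ≥0∞} (h : ∀ a, f a ≤ g a) : expect μ f ≤ expect μ g :=
  ENNReal.tsum_le_tsum fun a => mul_le_mul_right (h a) _

theorem expect_const (c : ℝ≥0∞) : expect μ (fun _ => c) = c := by
  simp [expect, ENNReal.tsum_mul_right, PMF.tsum_coe]

theorem expect_add (f g : α → ℝ≥0∞) :
    expect μ (fun a => f a + g a) = expect μ f + expect μ g := by
  simp [expect, mul_add, ENNReal.tsum_add]

theorem expect_const_mul (c : ℝ≥0∞) (f : α → ℝ≥0∞) :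
    expect μ (fun a => c * f a) = c * expect μ f := by
  simp only [expect, ← ENNReal.tsum_mul_left]
  exact tsum_congr fun a => by ring

theorem expect_mul_const (c : ℝ≥0∞) (f : α → ℝ≥0∞) :
    expect μ (fun a => f a * c) = expect μ f * c := by
  simp only [mul_comm _ c, expect_const_mul]

theorem expect_comm (ν : PMF β) (f : α → β → ℝ≥0∞) :
    expect μ (fun a => expect ν fun b => f a b) = expect ν fun b => expect μ fun a => f a b := by
  simp only [expect, ← ENNReal.tsum_mul_left]
  rw [ENNReal.tsum_comm]
  exact tsum_congr fun b => tsum_congr fun a => by ring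

theorem expect_pure (a : α) (f : α → ℝ≥0∞) : expect (PMF.pure a) f = f a := by
  rw [expect, tsum_eq_single a]
  · simp
  · intro b hb
    simp [PMF.pure_apply, hb]

theorem expect_bind (κ : α → PMF β) (f : β → ℝ≥0∞) :
    expect (μ.bind κ) f = expect μ fun a => expect (κ a) f := by
  simp only [expect, PMF.bind_apply, ← ENNReal.tsum_mul_left, ← ENNReal.tsum_mul_right]
  rw [ENNReal.tsum_comm]
  exact tsum_congr fun b => tsum_congr fun a => by ring

theorem expect_map (g : α → β) (f : β → ℝ≥0∞) :
    expect (μ.map g) f = expect μ fun a => f (g a) := by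
  rw [PMF.map, expect_bind]
  simp [expect_pure]

theorem apply_true_eq_expect (μ : PMF Bool) : μ true = expect μ ind := by
  simp [expect]

theorem expect_ind_le_one (f : α → Bool) : expect μ (fun a => ind (f a)) ≤ 1 :=
  (expect_mono μ fun _ => ind_le_one _).trans (expect_const μ 1).le

theorem expect_ind_not (f : α → Bool) :
    expect μ (fun a => ind (f a)) + expect μ (fun a => ind (!f a)) = 1 := by
  rw [← expect_add, ← expect_const μ 1]
  congr 1
  funext a
  cases f a <;> simp

theorem expect_iid_zero (f : List α → ℝ≥0∞) : expect (iid μ 0) f = f [] := expect_pure _ _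

theorem expect_iid_succ (N : ℕ) (f : List α → ℝ≥0∞) :
    expect (iid μ (N + 1)) f = expect μ fun a => expect (iid μ N) fun l => f (a :: l) := by
  rw [iid, expect_bind]
  simp only [expect_map]

/-- Independence turns the expectation of a product into a power; applied below to an exponential
moment of the number of errors. -/
theorem expect_iid_prod (N : ℕ) (w : α → ℝ≥0∞) :
    expect (iid μ N) (fun l => (l.map w).prod) = expect μ w ^ N := by
  induction N with
  | zero => simp [expect_iid_zero]
  | succ N ih =>
    rw [expect_iid_succ]
    simp only [List.map_cons, List.prod_cons, expect_const_mul, ih, expect_mul_const]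
    rw [pow_succ, mul_comm]

end Expect

theorem expect_uniform_bool (f : Bool → ℝ≥0∞) :
    expect (PMF.uniformOfFintype Bool) f = 2⁻¹ * (f true + f false) := by
  rw [expect, tsum_fintype]
  simp [PMF.uniformOfFintype_apply, mul_add]

theorem acceptProb_eq (L : Language Bool) (M : List Bool × TrainingSet × List Bool → Bool)
    (μ : PMF (List Bool)) (N m : ℕ) (x : List Bool) :
    acceptProb L M μ N m x =
      expect (iid μ N) fun zs => expect (randomBits m) fun r => ind (M (x, labelled L zs, r)) := by
  rw [acceptProb, apply_true_eq_expect, expect_bind]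
  simp only [expect_map]

/-! ### Counting bit strings -/

/-- The list of all bit strings of length `m`. -/
def allBits : ℕ → List (List Bool)
  | 0 => [[]]
  | m + 1 => (allBits m).map (true :: ·) ++ (allBits m).map (false :: ·)

/-- Scaling by `2 ^ m` turns an acceptance probability into a number of accepting strings, which is
what a primitive recursive function can count. -/
theorem expect_randomBits (m : ℕ) (f : List Bool → ℝ≥0∞) :
    2 ^ m * expect (randomBits m) f = ((allBits m).map f).sum := by
  induction m generalizing f with
  | zero => simp [randomBits, expect_iid_zero, allBits]
  | succ m ih =>
    have h := fun b => ih fun l => f (b :: l)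
    rw [randomBits] at h ⊢
    rw [expect_iid_succ, expect_uniform_bool]
    simp only [allBits, List.map_append, List.map_map, List.sum_append, Function.comp_def]
    rw [← h true, ← h false, pow_succ, mul_assoc, ← mul_assoc 2,
      ENNReal.mul_inv_cancel (by simp) (by simp), one_mul, mul_add]

theorem sum_map_ind {α : Type} (l : List α) (f : α → Bool) :
    (l.map fun r => ind (f r)).sum = ((l.filter fun r => f r).length : ℝ≥0∞) := by
  induction l with
  | nil => simp
  | cons a l ih => cases h : f a <;> simp [h, ih, add_comm]

/-- A majority decides a predicate that is computed with bounded error. -/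
theorem majority_of_bounds {m : ℕ} {f : List Bool → Bool} {P : Prop}
    (h1 : P → 2 / 3 ≤ expect (randomBits m) fun r => ind (f r))
    (h2 : ¬P → expect (randomBits m) (fun r => ind (f r)) ≤ 1 / 3) :
    P ↔ 2 ^ m < 2 * ((allBits m).filter fun r => f r).length := by
  have h := expect_randomBits m fun r => ind (f r)
  rw [sum_map_ind] at h
  set c := ((allBits m).filter fun r => f r).length
  have hle := expect_ind_le_one (randomBits m) f
  set p := expect (randomBits m) fun r => ind (f r)
  have hp : p ≠ ⊤ := ne_top_of_le_ne_top ENNReal.one_ne_top hle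
  have hr : (2 : ℝ) ^ m * p.toReal = c := by
    have := congrArg ENNReal.toReal h
    simpa using this
  have hpos : (0 : ℝ) < 2 ^ m := by positivity
  constructor
  · intro hP
    have := ENNReal.toReal_mono hp (h1 hP)
    have h3 : (2 : ℝ) / 3 ≤ p.toReal := by simpa using this
    have : (2 : ℝ) ^ m < 2 * c := by rw [← hr]; nlinarith
    exact_mod_cast this
  · intro hlt
    by_contra hP
    have := ENNReal.toReal_mono (by simp) (h2 hP)
    have h3 : p.toReal ≤ 1 / 3 := by simpa using this
    have h4 : (2 : ℝ) ^ m < 2 * c := by exact_mod_cast hlt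
    rw [← hr] at h4
    nlinarith

/-! ### Languages in BPP are decidable -/

theorem primrec_ones : Primrec ones :=
  (Primrec.list_map Primrec.list_range (.const true)).of_eq fun n => by
    simp [ones, List.map_const']

theorem primrec_allBits : Primrec allBits :=
  (Primrec.nat_rec₁ [[]] (f := fun _ l => l.map (true :: ·) ++ l.map (false :: ·))
    (Primrec.list_append.comp
      (Primrec.list_map Primrec.snd (Primrec.list_cons.comp (.const true) Primrec.snd).to₂)
      (Primrec.list_map Primrec.snd (Primrec.list_cons.comp (.const false) Primrec.snd).to₂))).of_eq
    fun n => by induction n with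
      | zero => rfl
      | succ n ih => simp only [allBits, ih]

theorem primrec_encPair : Primrec encPair := by
  have h : Primrec fun w : List Bool => w.map some ++ [none] :=
    Primrec.list_append.comp (Primrec.list_map Primrec.id
      (Primrec.option_some.comp₂ Primrec₂.right)) (.const [none])
  exact (Primrec.list_append.comp (h.comp Primrec.fst) (h.comp Primrec.snd)).of_eq fun p => by
    simp [encPair, encStrings]

theorem primrec_of_encodeBool {α : Type} [Primcodable α] {f : α → Bool}
    (h : Primrec fun a => Computability.encodeBool (f a)) : Primrec f :=
  ((Primrec.list_headI (α := Bool)).comp h).of_eq fun _ => rfl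

/-- Exhaustive derandomisation: count the accepting random strings and test for a strict majority,
which is right because of the gap between `1/3` and `2/3`. -/
theorem exists_primrec_of_mem_BPP {L : Language Bool} (hL : L ∈ BPP) :
    ∃ d : ℕ → Bool, Primrec d ∧ ∀ n, d n = true ↔ ones n ∈ L := by
  obtain ⟨M, p, hM, h⟩ := hL
  have hM' : Primrec M := primrec_of_encodeBool (hM.primrec primrec_encPair)
  have hbits : Primrec fun n => allBits (p.eval n) :=
    primrec_allBits.comp (primrec_natPoly_eval p)
  have hcount : Primrec fun n => (((allBits (p.eval n)).filterMap fun r =>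
      if M (ones n, r) then some () else none)).length := by
    refine Primrec.list_length.comp (Primrec.listFilterMap hbits ?_)
    have h1 : Primrec fun q : ℕ × List Bool => M (ones q.1, q.2) :=
      hM'.comp ((primrec_ones.comp Primrec.fst).pair Primrec.snd)
    exact (Primrec.cond h1 (.const (some ())) (.const none)).of_eq fun q => by
      cases h : M (ones q.1, q.2) <;> simp [h]
  have hpow : Primrec fun n : ℕ => 2 ^ n :=
    (Primrec.nat_rec₁ 1 (f := fun _ l => 2 * l)
      (Primrec.nat_mul.comp (.const 2) Primrec.snd)).of_eq fun n => by
        induction n with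
        | zero => rfl
        | succ n ih => simp only [ih, pow_succ]; ring
  have hd : PrimrecPred fun n => 2 ^ p.eval n < 2 * (((allBits (p.eval n)).filterMap fun r =>
      if M (ones n, r) then some () else none)).length :=
    Primrec.nat_lt.comp (hpow.comp (primrec_natPoly_eval p))
      (Primrec.nat_mul.comp (.const 2) hcount)
  refine ⟨_, hd.decide, fun n => ?_⟩
  have hlen : (ones n).length = n := by simp [ones]
  have h' := h (ones n)
  simp only [apply_true_eq_expect, expect_map, hlen] at h'
  rw [decide_eq_true_iff, majority_of_bounds h'.1 h'.2]
  -- The count was written with `filterMap`, whose function may depend on `n`; it equals the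
  -- filtered count.
  have : ∀ l : List (List Bool), (l.filterMap fun r =>
      if M (ones n, r) then some () else none).length = (l.filter fun r => M (ones n, r)).length := by
    intro l
    induction l with
    | nil => rfl
    | cons r l ih => cases h : M (ones n, r) <;> simp [h, ih]
  rw [this]

end

/-! ### Simulation of quantum circuits by sums over paths

A state is represented, up to a power of `√2`, by a list of paths: pairs of a phase, which is an
exponent of `exp(iπ/4)`, and a basis state. -/

/-- The two paths into which a Hadamard gate on qubit `i` splits a path. -/
def hadamardPaths (i : ℕ) (p : ℕ × List Bool) : List (ℕ × List Bool) :=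
  [(p.1, p.2.set i false), (p.1 + cond (p.2.getD i false) 4 0, p.2.set i true)]

/-- The action of a `T` gate on a path. -/
def phasePath (i : ℕ) (p : ℕ × List Bool) : ℕ × List Bool :=
  (p.1 + cond (p.2.getD i false) 1 0, p.2)

/-- The action of a controlled-not gate on a path. -/
def cnotPath (c t : ℕ) (p : ℕ × List Bool) : ℕ × List Bool :=
  (p.1, p.2.set t (xor (p.2.getD t false) (p.2.getD c false)))

/-- The paths after a gate. -/
def gatePaths {w : ℕ} : QGate w → List (ℕ × List Bool) → List (ℕ × List Bool)
  | .hadamard i, P => P.flatMap (hadamardPaths i)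
  | .phaseT i, P => P.map (phasePath i)
  | .cnot c t _, P => P.map (cnotPath c t)

/-- The number of Hadamard gates. -/
def gateWeight {w : ℕ} : QGate w → ℕ
  | .hadamard _ => 1
  | _ => 0

/-- The primitive eighth root of unity. -/
def rootEight : ℂ := Complex.exp (Complex.I * (Real.pi / 4))

theorem rootEight_eq : rootEight = (Real.sqrt 2 / 2 : ℝ) + (Real.sqrt 2 / 2 : ℝ) * Complex.I := by
  rw [rootEight, mul_comm, Complex.exp_mul_I]
  have : (Real.pi / 4 : ℂ) = ((Real.pi / 4 : ℝ) : ℂ) := by push_cast; rfl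
  rw [this, ← Complex.ofReal_cos, ← Complex.ofReal_sin, Real.cos_pi_div_four,
    Real.sin_pi_div_four]

theorem rootEight_sq : rootEight ^ 2 = Complex.I := by
  have h : ((Real.sqrt 2 : ℝ) : ℂ) ^ 2 = 2 := by
    rw [← Complex.ofReal_pow, Real.sq_sqrt (by norm_num)]; norm_num
  rw [rootEight_eq]
  push_cast
  linear_combination (1 / 4 * (1 + 2 * Complex.I + Complex.I ^ 2)) * h + 1 / 2 * Complex.I_sq

theorem rootEight_pow_four : rootEight ^ 4 = -1 := by
  rw [show 4 = 2 * 2 from rfl, pow_mul, rootEight_sq, Complex.I_sq]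

theorem rootEight_pow_eight : rootEight ^ 8 = 1 := by
  rw [show 8 = 4 * 2 from rfl, pow_mul, rootEight_pow_four]; norm_num

theorem rootEight_pow_mod (k : ℕ) : rootEight ^ (k % 8) = rootEight ^ k := by
  conv_rhs => rw [← Nat.mod_add_div k 8, pow_add, pow_mul, rootEight_pow_eight, one_pow, mul_one]

/-- Conjugate and inverse agree on the unit circle. Writing the inverse as a seventh power keeps all
exponents natural. -/
theorem conj_rootEight : (starRingEnd ℂ) rootEight = rootEight ^ 7 := by
  have h : rootEight ≠ 0 := Complex.exp_ne_zero _
  have h1 : (starRingEnd ℂ) rootEight * rootEight = 1 := by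
    rw [rootEight, ← Complex.exp_conj, ← Complex.exp_add]
    simp [map_ofNat]
  have h2 : rootEight ^ 7 * rootEight = 1 := by rw [← pow_succ, rootEight_pow_eight]
  exact mul_right_cancel₀ h (h1.trans h2.symm)

/-- The sum of the paths that end in a basis state. -/
def pathSum (w : ℕ) (P : List (ℕ × List Bool)) : QState w :=
  fun b => (P.map fun p => if p.2 = List.ofFn b then rootEight ^ p.1 else 0).sum

section Gates

variable {w : ℕ}

theorem ofFn_set (b : Fin w → Bool) (i : Fin w) (v : Bool) :
    (List.ofFn b).set i v = List.ofFn (Function.update b i v) := by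
  refine List.ext_getElem (by simp) fun j h1 h2 => ?_
  rw [List.getElem_set]
  simp only [List.getElem_ofFn, Function.update_apply, Fin.ext_iff, eq_comm]

theorem ofFn_getD (b : Fin w → Bool) (i : Fin w) : (List.ofFn b).getD i false = b i := by
  simp [List.getD_eq_getElem?_getD]

theorem exists_eq_ofFn {l : List Bool} (h : l.length = w) :
    ∃ b : Fin w → Bool, l = List.ofFn b := by
  subst h
  exact ⟨l.get, (List.ofFn_get l).symm⟩

theorem pathSum_cons (p : ℕ × List Bool) (P : List (ℕ × List Bool)) (b : Fin w → Bool) :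
    pathSum w (p :: P) b = (if p.2 = List.ofFn b then rootEight ^ p.1 else 0) + pathSum w P b := by
  simp [pathSum]

theorem eq_update_iff (b b' : Fin w → Bool) (i : Fin w) (v : Bool) :
    b' = Function.update b i v ↔ b' i = v ∧ ∀ j, j ≠ i → b' j = b j := by
  rw [Function.eq_update_iff]

/-- By linearity one path at a time suffices. A Hadamard gate splits a path in two, with sign `-1 =
rootEight ^ 4` exactly when the old and the new bit are both `1`; its factor `1/√2` is set aside in
the weight. -/
theorem gate_apply_pathSum (g : QGate w) (P : List (ℕ × List Bool))
    (hP : ∀ p ∈ P, p.2.length = w) :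
    g.apply (pathSum w P) = fun b => pathSum w (gatePaths g P) b / (Real.sqrt 2 : ℂ) ^ gateWeight g := by
  funext b
  induction P with
  | nil => cases g <;> simp [QGate.apply, gatePaths, pathSum]
  | cons p P ih =>
    have ih := ih fun p hp => hP p (List.mem_cons_of_mem _ hp)
    obtain ⟨k, l⟩ := p
    obtain ⟨b', rfl⟩ : ∃ b' : Fin w → Bool, l = List.ofFn b' :=
      exists_eq_ofFn (hP _ List.mem_cons_self)
    cases g with
    | hadamard i =>
      simp only [QGate.apply, gatePaths, List.flatMap_cons, hadamardPaths, List.cons_append,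
        List.nil_append, pathSum_cons, ofFn_set, ofFn_getD, List.ofFn_inj, gateWeight,
        pow_one] at ih ⊢
      -- If `b` and `b'` differ away from qubit `i`, all terms vanish; otherwise only the four
      -- values of the two bits at `i` matter.
      have key : ((if b' = Function.update b i false then rootEight ^ k else 0) +
          (if b i then -1 else 1) * (if b' = Function.update b i true then rootEight ^ k else 0)) =
          (if Function.update b' i false = b then rootEight ^ k else 0) +
          (if Function.update b' i true = b then
            rootEight ^ (k + cond (b' i) 4 0) else 0) := by
        simp only [eq_update_iff, eq_comm (b := b)]
        by_cases h : ∀ j, j ≠ i → b' j = b j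
        · have h' : ∀ j, j ≠ i → b j = b' j := fun j hj => (h j hj).symm
          simp only [eq_true h, eq_true h', and_true]
          cases b i <;> cases b' i <;> simp [pow_add, rootEight_pow_four]
        · have h' : ¬∀ j, j ≠ i → b j = b' j := fun h' => h fun j hj => (h' j hj).symm
          simp only [h, h', and_false, if_false, mul_zero, add_zero]
      rw [← add_assoc, ← key]
      rw [div_eq_iff (by simp)] at ih
      rw [div_left_inj' (by simp)]
      rw [div_mul_cancel₀ _ (by simp)] at ih
      rw [← ih]
      ring
    | phaseT i =>
      simp only [QGate.apply, gatePaths, List.map_cons, phasePath, pathSum_cons, ofFn_getD,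
        List.ofFn_inj, gateWeight, pow_zero, div_one] at ih ⊢
      rw [mul_add, ih]
      congr 1
      by_cases h : b' = b
      · subst h
        cases b' i <;> simp [pow_succ, rootEight, mul_comm]
      · simp [h]
    | cnot c t hct =>
      simp only [QGate.apply, gatePaths, List.map_cons, cnotPath, pathSum_cons, ofFn_getD,
        ofFn_set, List.ofFn_inj, gateWeight, pow_zero, div_one] at ih ⊢
      rw [ih]
      congr 1
      -- A controlled-not is its own inverse: since `c ≠ t`, the control bit survives the update of
      -- the target.
      refine if_congr ?_ rfl rfl
      rw [eq_update_iff, eq_comm (b := b), eq_update_iff]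
      constructor
      · rintro ⟨h1, h2⟩
        refine ⟨?_, fun j hj => (h2 j hj).symm⟩
        rw [h1, h2 c hct]
        cases b t <;> cases b c <;> rfl
      · rintro ⟨h1, h2⟩
        refine ⟨?_, fun j hj => (h2 j hj).symm⟩
        rw [h1, h2 c hct]
        cases b' t <;> cases b' c <;> rfl

theorem gatePaths_length (g : QGate w) {P : List (ℕ × List Bool)}
    (hP : ∀ p ∈ P, p.2.length = w) : ∀ p ∈ gatePaths g P, p.2.length = w := by
  intro p hp
  cases g with
  | hadamard i =>
    simp only [gatePaths, List.mem_flatMap, hadamardPaths, List.mem_cons, List.not_mem_nil,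
      or_false] at hp
    obtain ⟨q, hq, rfl | rfl⟩ := hp <;> simpa using hP q hq
  | phaseT i =>
    simp only [gatePaths, List.mem_map] at hp
    obtain ⟨q, hq, rfl⟩ := hp
    simpa [phasePath] using hP q hq
  | cnot c t h =>
    simp only [gatePaths, List.mem_map] at hp
    obtain ⟨q, hq, rfl⟩ := hp
    simpa [cnotPath] using hP q hq

theorem gate_apply_div (g : QGate w) (ψ : QState w) (c : ℂ) :
    g.apply (fun b => ψ b / c) = fun b => g.apply ψ b / c := by
  funext b
  cases g <;> simp only [QGate.apply] <;> ring

end Gates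

/-- The paths and the number of Hadamard gates after a list of gates. -/
def circuitPaths {w : ℕ} (gs : List (QGate w)) (s : ℕ × List (ℕ × List Bool)) :
    ℕ × List (ℕ × List Bool) :=
  gs.foldl (fun s g => (s.1 + gateWeight g, gatePaths g s.2)) s

theorem foldl_apply_eq {w : ℕ} (gs : List (QGate w)) (h : ℕ) (P : List (ℕ × List Bool))
    (hP : ∀ p ∈ P, p.2.length = w) :
    gs.foldl (fun ψ g => g.apply ψ) (fun b => pathSum w P b / (Real.sqrt 2 : ℂ) ^ h) =
      (fun b => pathSum w (circuitPaths gs (h, P)).2 b /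
        (Real.sqrt 2 : ℂ) ^ (circuitPaths gs (h, P)).1) ∧
      ∀ p ∈ (circuitPaths gs (h, P)).2, p.2.length = w := by
  induction gs generalizing h P with
  | nil => exact ⟨rfl, hP⟩
  | cons g gs ih =>
    have := ih (h + gateWeight g) (gatePaths g P) (gatePaths_length g hP)
    rw [List.foldl_cons, gate_apply_div, gate_apply_pathSum g P hP]
    simp only [div_div, ← pow_add, add_comm (gateWeight g)]
    exact this

/-- The phases of the pairs of paths that contribute to the acceptance probability. -/
def pairPhases (P : List (ℕ × List Bool)) : List ℕ :=
  P.flatMap fun p => P.flatMap fun p' =>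
    if p.2 = p'.2 ∧ p.2.headI = true then [(p.1 + 7 * p'.1) % 8] else []

theorem sum_map_flatMap {α β R : Type} [AddCommMonoid R] (l : List α) (f : α → List β) (g : β → R) :
    ((l.flatMap f).map g).sum = (l.map fun a => ((f a).map g).sum).sum := by
  induction l with
  | nil => simp
  | cons a l ih => simp [ih]

theorem finset_sum_list_sum {ι α R : Type} [AddCommMonoid R] (s : Finset ι) (l : List α)
    (f : ι → α → R) : ∑ i ∈ s, (l.map (f i)).sum = (l.map fun a => ∑ i ∈ s, f i a).sum := by
  induction l with
  | nil => simp
  | cons a l ih => simp [Finset.sum_add_distrib, ih]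

theorem re_list_sum (l : List ℂ) : l.sum.re = (l.map Complex.re).sum := by
  induction l with
  | nil => simp
  | cons a l ih => simp [ih]

/-- Expanding an amplitude times its conjugate gives a sum over pairs of paths with phase `k + 7k'`.
Two paths interfere only if they end in the same basis state, and then at just that one state. -/
theorem sum_sq_pathSum {w : ℕ} (P : List (ℕ × List Bool)) (hP : ∀ p ∈ P, p.2.length = w + 1) :
    (∑ b : Fin (w + 1) → Bool, if b 0 then ‖pathSum (w + 1) P b‖ ^ 2 else 0) =
      ((pairPhases P).map fun k => (rootEight ^ k).re).sum := by
  have h1 : ∀ b : Fin (w + 1) → Bool, (if b 0 then ‖pathSum (w + 1) P b‖ ^ 2 else 0) =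
      (P.map fun p => (P.map fun p' => if p.2 = List.ofFn b then
        (if p.2 = p'.2 ∧ p.2.headI = true then (rootEight ^ ((p.1 + 7 * p'.1) % 8)).re else 0)
          else 0).sum).sum := by
    intro b
    have hb : (List.ofFn b).headI = b 0 := by simp [List.ofFn_succ]
    have h2 : ∀ z : ℂ, ‖z‖ ^ 2 = (z * (starRingEnd ℂ) z).re := by
      intro z
      rw [Complex.mul_conj, Complex.ofReal_re, Complex.normSq_eq_norm_sq]
    have h3 : (starRingEnd ℂ) (pathSum (w + 1) P b) =
        (P.map fun p => if p.2 = List.ofFn b then rootEight ^ (7 * p.1) else 0).sum := by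
      rw [pathSum, map_list_sum, List.map_map]
      congr 1
      refine List.map_congr_left fun p _ => ?_
      simp only [Function.comp]
      split
      · rw [map_pow, conj_rootEight, ← pow_mul]
      · simp
    rw [h2, h3, pathSum, ← List.sum_map_mul_right]
    simp only [← List.sum_map_mul_left]
    rw [re_list_sum, List.map_map]
    split_ifs with hb0
    · congr 1
      refine List.map_congr_left fun p _ => ?_
      simp only [Function.comp]
      rw [re_list_sum, List.map_map]
      congr 1
      refine List.map_congr_left fun p' _ => ?_
      simp only [Function.comp]
      by_cases h4 : p.2 = List.ofFn b
      · rw [if_pos h4, if_pos h4]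
        by_cases h5 : p'.2 = List.ofFn b
        · rw [if_pos h5, if_pos ⟨h4.trans h5.symm, by rw [h4, hb, hb0]⟩, rootEight_pow_mod, pow_add]
        · rw [if_neg h5, if_neg fun h => h5 (h.1.symm.trans h4)]; simp
      · simp only [if_neg h4, zero_mul, Complex.zero_re]
    · symm
      refine List.sum_eq_zero fun x hx => ?_
      obtain ⟨p, _, rfl⟩ := List.mem_map.1 hx
      refine List.sum_eq_zero fun y hy => ?_
      obtain ⟨p', _, rfl⟩ := List.mem_map.1 hy
      by_cases h4 : p.2 = List.ofFn b
      · rw [if_pos h4, if_neg]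
        rintro ⟨_, h⟩
        rw [h4, hb] at h
        exact hb0 h
      · rw [if_neg h4]
  rw [Finset.sum_congr rfl fun b _ => h1 b, finset_sum_list_sum, pairPhases, sum_map_flatMap]
  congr 1
  refine List.map_congr_left fun p hp => ?_
  rw [finset_sum_list_sum, sum_map_flatMap]
  congr 1
  refine List.map_congr_left fun p' _ => ?_
  obtain ⟨b, hb⟩ := exists_eq_ofFn (hP p hp)
  rw [Finset.sum_eq_single b]
  · rw [if_pos hb]; split_ifs <;> simp
  · intro b' _ hb'
    rw [if_neg]
    rw [hb, List.ofFn_inj]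
    exact hb'.symm
  · simp

/-- The initial list of paths, for the input `1ⁿ`. -/
def initPaths (n anc : ℕ) : List (ℕ × List Bool) :=
  [(0, List.replicate n true ++ List.replicate (anc + 1) false)]

theorem initState_ones (n anc : ℕ) :
    initState (n + anc + 1) (ones n) = pathSum (n + anc + 1) (initPaths n anc) := by
  funext b
  simp only [initState, pathSum, initPaths, List.map_cons, List.map_nil, List.sum_cons,
    List.sum_nil, pow_zero, add_zero]
  refine if_congr ?_ rfl rfl
  constructor
  · intro h
    refine List.ext_getElem (by simp; omega) fun j h1 h2 => ?_
    rw [List.length_ofFn] at h2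
    rw [List.getElem_ofFn, h ⟨j, h2⟩]
    by_cases hj : j < n <;> simp [ones, List.getElem_append, List.getD_eq_getElem?_getD, hj]
  · intro h i
    rw [← ofFn_getD b i, ← h]
    by_cases hj : (i : ℕ) < n
    · simp [ones, List.getD_eq_getElem?_getD, hj, List.getElem?_append]
    · have : (i : ℕ) - n < anc + 1 := by omega
      simp [ones, List.getD_eq_getElem?_getD, hj, List.getElem?_append, this]

/-- Squaring the norm turns the deferred factor `√2 ^ h` into the integer `2 ^ h`. -/
theorem acceptProb_ones {n : ℕ} (C : QCircuit n) :
    2 ^ (circuitPaths C.gates (0, initPaths n C.anc)).1 * C.acceptProb (ones n) =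
      ((pairPhases (circuitPaths C.gates (0, initPaths n C.anc)).2).map
        fun k => (rootEight ^ k).re).sum := by
  obtain ⟨h1, h2⟩ := foldl_apply_eq C.gates 0 (initPaths n C.anc)
    (fun p hp => by simp [initPaths] at hp; subst hp; simp; omega)
  rw [← sum_sq_pathSum _ h2, QCircuit.acceptProb, Finset.mul_sum]
  refine Finset.sum_congr rfl fun b _ => ?_
  simp only [pow_zero, div_one] at h1
  rw [QCircuit.run, initState_ones, h1]
  split_ifs
  · rw [norm_div, div_pow, norm_pow, ← pow_mul, mul_comm _ 2, pow_mul,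
      Complex.norm_of_nonneg (Real.sqrt_nonneg 2), Real.sq_sqrt (by norm_num)]
    field_simp
  · simp

/-! ### Languages in BQP are decidable -/

/-- Read a list of numbers from a bit string in which the number `k` is written as `1ᵏ0`. -/
def decodeNats (l : List Bool) : List ℕ :=
  (l.foldl (fun s b => cond b (s.1 + 1, s.2) (0, s.2 ++ [s.1])) (0, [])).2

theorem decodeNats_flatMap (l : List ℕ) :
    decodeNats (l.flatMap fun k => ones k ++ [false]) = l := by
  have h1 : ∀ (k j : ℕ) (acc : List ℕ), (ones k).foldl
      (fun s b => cond b (s.1 + 1, s.2) (0, s.2 ++ [s.1])) (j, acc) = (j + k, acc) := by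
    intro k
    induction k with
    | zero => intro j acc; rfl
    | succ k ih =>
      intro j acc
      have := ih (j + 1) acc
      rw [ones] at this ⊢
      rw [List.replicate_succ, List.foldl_cons]
      simpa [Nat.add_assoc, Nat.add_comm 1] using this
  have h2 : ∀ (l acc : List ℕ), (l.flatMap fun k => ones k ++ [false]).foldl
      (fun s b => cond b (s.1 + 1, s.2) (0, s.2 ++ [s.1])) (0, acc) = (0, acc ++ l) := by
    intro l
    induction l with
    | nil => simp
    | cons k l ih =>
      intro acc
      rw [List.flatMap_cons, List.foldl_append, List.foldl_append, h1]
      simp [ih]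
  simp [decodeNats, h2]

theorem primrec_decodeNats : Primrec decodeNats := by
  refine Primrec.snd.comp (Primrec.list_foldl (f := fun l : List Bool => l)
    (h := fun _ p => cond p.2 (p.1.1 + 1, p.1.2) (0, p.1.2 ++ [p.1.1]))
    Primrec.id (.const ((0, []) : ℕ × List ℕ)) ?_)
  have hs : Primrec fun p : List Bool × (ℕ × List ℕ) × Bool => p.2.1 :=
    Primrec.fst.comp Primrec.snd
  exact Primrec.cond (Primrec.snd.comp Primrec.snd)
    ((Primrec.succ.comp (Primrec.fst.comp hs)).pair (Primrec.snd.comp hs))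
    ((Primrec.const 0).pair (Primrec.list_concat.comp (Primrec.snd.comp hs) (Primrec.fst.comp hs)))

/-- Process one number of the description of a list of gates. The first component holds the numbers
of a gate that is not yet complete. -/
def codeStep (s : List ℕ × ℕ × List (ℕ × List Bool)) (k : ℕ) :
    List ℕ × ℕ × List (ℕ × List Bool) :=
  if s.1 = [0] then ([], s.2.1 + 1, s.2.2.flatMap (hadamardPaths k))
  else if s.1 = [1] then ([], s.2.1, s.2.2.map (phasePath k))
  else if s.1.length = 2 then ([], s.2.1, s.2.2.map (cnotPath (s.1.getD 1 0) k))
  else (s.1 ++ [k], s.2.1, s.2.2)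

/-- Gate codes delimit themselves: the leading number fixes how many follow, so a buffer of at most
two numbers suffices to parse the list from left to right. -/
theorem foldl_codeStep {w : ℕ} (gs : List (QGate w)) (s : ℕ × List (ℕ × List Bool)) :
    (gs.flatMap QGate.code).foldl codeStep ([], s) = ([], circuitPaths gs s) := by
  induction gs generalizing s with
  | nil => rfl
  | cons g gs ih =>
    rw [List.flatMap_cons, List.foldl_append]
    have : g.code.foldl codeStep ([], s) = ([], s.1 + gateWeight g, gatePaths g s.2) := by
      cases g <;> simp [QGate.code, codeStep, gateWeight, gatePaths]
    rw [this, ih]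
    rfl

theorem primrec_bit : Primrec fun q : ℕ × List Bool => q.2.getD q.1 false :=
  (Primrec.list_getD false).comp Primrec.snd Primrec.fst

theorem primrec_hadamardPaths : Primrec₂ hadamardPaths := by
  have hi : Primrec fun q : ℕ × ℕ × List Bool => q.1 := Primrec.fst
  have hk : Primrec fun q : ℕ × ℕ × List Bool => q.2.1 := Primrec.fst.comp Primrec.snd
  have hl : Primrec fun q : ℕ × ℕ × List Bool => q.2.2 := Primrec.snd.comp Primrec.snd
  have hset : ∀ v : Bool, Primrec fun q : ℕ × ℕ × List Bool => q.2.2.set q.1 v := fun v =>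
    Primrec.list_set.comp hl (hi.pair (.const v))
  have hbit : Primrec fun q : ℕ × ℕ × List Bool => q.2.2.getD q.1 false :=
    primrec_bit.comp (hi.pair hl)
  exact Primrec.list_cons.comp (hk.pair (hset false)) (Primrec.list_cons.comp
    ((Primrec.nat_add.comp hk (Primrec.cond hbit (.const 4) (.const 0))).pair (hset true))
    (.const []))

theorem primrec_phasePath : Primrec₂ phasePath := by
  have hi : Primrec fun q : ℕ × ℕ × List Bool => q.1 := Primrec.fst
  have hk : Primrec fun q : ℕ × ℕ × List Bool => q.2.1 := Primrec.fst.comp Primrec.snd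
  have hl : Primrec fun q : ℕ × ℕ × List Bool => q.2.2 := Primrec.snd.comp Primrec.snd
  have hbit : Primrec fun q : ℕ × ℕ × List Bool => q.2.2.getD q.1 false :=
    primrec_bit.comp (hi.pair hl)
  exact (Primrec.nat_add.comp hk (Primrec.cond hbit (.const 1) (.const 0))).pair hl

theorem primrec_cnotPath :
    Primrec fun q : (ℕ × ℕ) × ℕ × List Bool => cnotPath q.1.1 q.1.2 q.2 := by
  have hc : Primrec fun q : (ℕ × ℕ) × ℕ × List Bool => q.1.1 := Primrec.fst.comp Primrec.fst
  have ht : Primrec fun q : (ℕ × ℕ) × ℕ × List Bool => q.1.2 := Primrec.snd.comp Primrec.fst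
  have hl : Primrec fun q : (ℕ × ℕ) × ℕ × List Bool => q.2.2 := Primrec.snd.comp Primrec.snd
  exact (Primrec.fst.comp Primrec.snd).pair (Primrec.list_set.comp hl (ht.pair
    ((Primrec.dom_bool₂ xor).comp (primrec_bit.comp (ht.pair hl)) (primrec_bit.comp (hc.pair hl)))))

theorem primrec_codeStep : Primrec₂ codeStep := by
  have hs : Primrec fun p : (List ℕ × ℕ × List (ℕ × List Bool)) × ℕ => p.1.1 :=
    Primrec.fst.comp Primrec.fst
  have hh : Primrec fun p : (List ℕ × ℕ × List (ℕ × List Bool)) × ℕ => p.1.2.1 :=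
    Primrec.fst.comp (Primrec.snd.comp Primrec.fst)
  have hP : Primrec fun p : (List ℕ × ℕ × List (ℕ × List Bool)) × ℕ => p.1.2.2 :=
    Primrec.snd.comp (Primrec.snd.comp Primrec.fst)
  refine Primrec.ite (Primrec.eq.comp hs (.const [0])) ((Primrec.const []).pair
    ((Primrec.succ.comp hh).pair (Primrec.list_flatMap hP
      (primrec_hadamardPaths.comp (Primrec.snd.comp Primrec.fst) Primrec.snd).to₂))) ?_
  refine Primrec.ite (Primrec.eq.comp hs (.const [1])) ((Primrec.const []).pair
    (hh.pair (Primrec.list_map hP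
      (primrec_phasePath.comp (Primrec.snd.comp Primrec.fst) Primrec.snd).to₂))) ?_
  refine Primrec.ite (Primrec.eq.comp (Primrec.list_length.comp hs) (.const 2))
    ((Primrec.const []).pair (hh.pair (Primrec.list_map hP (primrec_cnotPath.comp
      (((Primrec.list_getD 0).comp (hs.comp Primrec.fst) (.const 1)).pair
        (Primrec.snd.comp Primrec.fst) |>.pair Primrec.snd)).to₂))) ?_
  exact (Primrec.list_concat.comp hs Primrec.snd).pair (hh.pair hP)

theorem primrec_pairPhases : Primrec pairPhases := by
  refine Primrec.list_flatMap Primrec.id (Primrec.list_flatMap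
    (f := fun q : List (ℕ × List Bool) × ℕ × List Bool => q.1)
    (g := fun q (p' : ℕ × List Bool) => if q.2.2 = p'.2 ∧ q.2.2.headI = true then
      [(q.2.1 + 7 * p'.1) % 8] else []) Primrec.fst ?_).to₂
  have h1 : Primrec fun q : (List (ℕ × List Bool) × ℕ × List Bool) × ℕ × List Bool => q.1.2 :=
    Primrec.snd.comp Primrec.fst
  have h2 : Primrec fun q : (List (ℕ × List Bool) × ℕ × List Bool) × ℕ × List Bool => q.2 :=
    Primrec.snd
  refine (Primrec.ite (PrimrecPred.and (Primrec.eq.comp (Primrec.snd.comp h1) (Primrec.snd.comp h2))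
    (Primrec.eq.comp (Primrec.list_headI.comp (Primrec.snd.comp h1)) (.const true)))
    (Primrec.list_cons.comp (Primrec.nat_mod.comp (Primrec.nat_add.comp (Primrec.fst.comp h1)
      (Primrec.nat_mul.comp (.const 7) (Primrec.fst.comp h2))) (.const 8)) (.const []))
    (.const [])).to₂

/-- The number of occurrences of the phases `j` and `j'`. -/
def countPhases (j j' : ℕ) (Z : List ℕ) : ℕ := (Z.filter fun z => z = j ∨ z = j').length

theorem primrec_countPhases (j j' : ℕ) : Primrec (countPhases j j') :=
  Primrec.list_length.comp (Primrec.listFilter (PrimrecPred.or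
    (Primrec.eq.comp Primrec.id (.const j)) (Primrec.eq.comp Primrec.id (.const j'))))

theorem re_rootEight_pow : ∀ k < 8, 2 * (rootEight ^ k).re =
    (if k = 0 then 2 else 0) + (if k = 1 ∨ k = 7 then Real.sqrt 2 else 0) -
      (if k = 4 then 2 else 0) - (if k = 3 ∨ k = 5 then Real.sqrt 2 else 0) := by
  have h1 : rootEight.re = Real.sqrt 2 / 2 := by rw [rootEight_eq]; simp
  have him : rootEight.im = Real.sqrt 2 / 2 := by rw [rootEight_eq]; simp
  have h3 : (rootEight ^ 3).re = -(Real.sqrt 2 / 2) := by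
    rw [pow_succ, rootEight_sq]; simp [him]
  have h5 : ∀ k, (rootEight ^ (4 + k)).re = -(rootEight ^ k).re := by
    intro k; rw [pow_add, rootEight_pow_four]; simp
  have e4 := h5 0
  have e5 := h5 1
  have e6 := h5 2
  have e7 := h5 3
  intro k hk
  interval_cases k
  · simp
  · simp [h1]; ring
  · rw [rootEight_sq]; simp
  · rw [h3]; norm_num; ring
  · norm_num at e4 ⊢; rw [e4]; norm_num
  · norm_num at e5 ⊢; rw [e5, h1]; ring
  · norm_num at e6 ⊢; rw [e6, rootEight_sq]; simp
  · norm_num at e7 ⊢; rw [e7, h3]; ring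

/-- Twice the real part of an eighth root of unity is `0`, `±2` or `±√2`. Keeping positive and
negative phases apart makes all coefficients natural numbers. -/
theorem sum_re_rootEight (Z : List ℕ) (hZ : ∀ z ∈ Z, z < 8) :
    2 * (Z.map fun k => (rootEight ^ k).re).sum =
      (2 * countPhases 0 0 Z + Real.sqrt 2 * countPhases 1 7 Z) -
      (2 * countPhases 4 4 Z + Real.sqrt 2 * countPhases 3 5 Z) := by
  induction Z with
  | nil => simp [countPhases]
  | cons z Z ih =>
    have ih := ih fun y hy => hZ y (List.mem_cons_of_mem _ hy)
    have hz := re_rootEight_pow z (hZ z List.mem_cons_self)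
    have hc : ∀ j j', (countPhases j j' (z :: Z) : ℝ) =
        (if z = j ∨ z = j' then 1 else 0) + countPhases j j' Z := by
      intro j j'
      by_cases h : z = j ∨ z = j' <;> simp [countPhases, h, add_comm]
    rw [List.map_cons, List.sum_cons, mul_add, ih, hz]
    simp only [hc, or_self]
    split_ifs <;> ring

/-- Comparison of numbers of the form `a + b√2`. -/
theorem add_sqrt_two_lt_iff (A B C D : ℕ) :
    (C + Real.sqrt 2 * D < A + Real.sqrt 2 * B) ↔
      (C - A) * (C - A) + 2 * ((D - B) * (D - B)) < (A - C) * (A - C) + 2 * ((B - D) * (B - D)) := by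
  have key : ∀ x y : ℝ, 0 ≤ x → 0 ≤ y → (x < Real.sqrt 2 * y ↔ x * x < 2 * (y * y)) := by
    intro x y hx hy
    have h2 := Real.mul_self_sqrt (show (0 : ℝ) ≤ 2 by norm_num)
    have h3 := Real.sqrt_nonneg 2
    rw [mul_self_lt_mul_self_iff hx (by positivity)]
    rw [show Real.sqrt 2 * y * (Real.sqrt 2 * y) = (Real.sqrt 2 * Real.sqrt 2) * (y * y) by ring, h2]
  have key' : ∀ x y : ℝ, 0 ≤ x → 0 ≤ y → (Real.sqrt 2 * y < x ↔ 2 * (y * y) < x * x) := by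
    intro x y hx hy
    have h2 := Real.mul_self_sqrt (show (0 : ℝ) ≤ 2 by norm_num)
    rw [mul_self_lt_mul_self_iff (by positivity) hx]
    rw [show Real.sqrt 2 * y * (Real.sqrt 2 * y) = (Real.sqrt 2 * Real.sqrt 2) * (y * y) by ring, h2]
  have hs : 0 < Real.sqrt 2 := by positivity
  -- The subtractions are truncated, so one of each opposite pair is zero. When both differences
  -- favour the same side the sign is clear; when they oppose each other, squaring decides.
  rcases le_total A C with h | h <;> obtain ⟨a, rfl⟩ := Nat.exists_eq_add_of_le h <;>
    rcases le_total B D with h' | h' <;> obtain ⟨b, rfl⟩ := Nat.exists_eq_add_of_le h' <;>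
    push_cast <;> simp only [Nat.add_sub_cancel_left, Nat.sub_eq_zero_of_le, Nat.le_add_right,
      mul_zero, zero_add, add_zero]
  · constructor
    · intro h
      have : 0 ≤ Real.sqrt 2 * b := by positivity
      have : (0 : ℝ) ≤ a := by positivity
      nlinarith
    · intro h
      exact absurd h (Nat.not_lt_zero _)
  · rw [← @Nat.cast_lt ℝ]
    push_cast
    rw [← key _ _ (by positivity) (by positivity)]
    constructor <;> intro h <;> linarith
  · rw [← @Nat.cast_lt ℝ]
    push_cast
    rw [← key' _ _ (by positivity) (by positivity)]
    constructor <;> intro h <;> linarith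
  · constructor
    · intro h
      by_contra hn
      have ha : a = 0 := by nlinarith
      have hb : b = 0 := by nlinarith
      subst ha hb
      simp at h
    · intro h
      have : 0 < a ∨ 0 < b := by
        by_contra hn
        have ha : a = 0 := by omega
        have hb : b = 0 := by omega
        subst ha hb
        simp at h
      rcases this with h | h
      · have : (0 : ℝ) < a := by exact_mod_cast h
        have : 0 ≤ Real.sqrt 2 * b := by positivity
        nlinarith
      · have : (0 : ℝ) < b := by exact_mod_cast h
        have : 0 < Real.sqrt 2 * b := by positivity
        have : (0 : ℝ) ≤ a := by positivity
        nlinarith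

/-- The circuit is decoded from its description and its path sum evaluated exactly; no approximation
of `√2` is needed to compare the probability with `1/2`. -/
theorem exists_primrec_of_mem_BQP {L : Language Bool} (hL : L ∈ BQP) :
    ∃ d : ℕ → Bool, Primrec d ∧ ∀ n, d n = true ↔ ones n ∈ L := by
  obtain ⟨C, hC, h⟩ := hL
  have hcode : Primrec fun n => decodeNats ((C n).encode) :=
    primrec_decodeNats.comp (hC.primrec primrec_ones)
  have hdec : ∀ n, decodeNats ((C n).encode) = (C n).anc :: (C n).gates.flatMap QGate.code :=
    fun n => decodeNats_flatMap _
  have hrep : ∀ b : Bool, Primrec fun n : ℕ => List.replicate n b := fun b =>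
    (Primrec.list_map Primrec.list_range (.const b)).of_eq fun n => by simp [List.map_const']
  have hinit : Primrec fun n => initPaths n (decodeNats ((C n).encode)).headI :=
    Primrec.list_cons.comp ((Primrec.const 0).pair (Primrec.list_append.comp (hrep true)
      ((hrep false).comp (Primrec.succ.comp (Primrec.list_headI.comp hcode))))) (.const [])
  have hsim : Primrec fun n => ((decodeNats ((C n).encode)).tail.foldl codeStep
      ([], 0, initPaths n (decodeNats ((C n).encode)).headI)).2 :=
    Primrec.snd.comp (Primrec.list_foldl (Primrec.list_tail.comp hcode)
      ((Primrec.const []).pair ((Primrec.const 0).pair hinit))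
      (primrec_codeStep.comp (Primrec.fst.comp Primrec.snd) (Primrec.snd.comp Primrec.snd)).to₂)
  have hsim' : Primrec fun n => circuitPaths (C n).gates (0, initPaths n (C n).anc) :=
    hsim.of_eq fun n => by rw [hdec, List.tail_cons, List.headI_cons, foldl_codeStep]
  have hZ : Primrec fun n => pairPhases (circuitPaths (C n).gates (0, initPaths n (C n).anc)).2 :=
    primrec_pairPhases.comp (Primrec.snd.comp hsim')
  have hpow : Primrec fun n : ℕ => 2 ^ n :=
    (Primrec.nat_rec₁ 1 (f := fun _ l => 2 * l)
      (Primrec.nat_mul.comp (.const 2) Primrec.snd)).of_eq fun n => by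
        induction n with
        | zero => rfl
        | succ n ih => simp only [ih, pow_succ]; ring
  let A := fun n => 2 * countPhases 0 0
    (pairPhases (circuitPaths (C n).gates (0, initPaths n (C n).anc)).2)
  let B := fun n => countPhases 1 7
    (pairPhases (circuitPaths (C n).gates (0, initPaths n (C n).anc)).2)
  -- The summand `2 ^ h` is the threshold: acceptance with probability above `1/2` means `2 · 2 ^ h
  -- · prob > 2 ^ h`.
  let A' := fun n => 2 * countPhases 4 4
    (pairPhases (circuitPaths (C n).gates (0, initPaths n (C n).anc)).2) +
      2 ^ (circuitPaths (C n).gates (0, initPaths n (C n).anc)).1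
  let B' := fun n => countPhases 3 5
    (pairPhases (circuitPaths (C n).gates (0, initPaths n (C n).anc)).2)
  have hA : Primrec A := Primrec.nat_mul.comp (.const 2) ((primrec_countPhases 0 0).comp hZ)
  have hB : Primrec B := (primrec_countPhases 1 7).comp hZ
  have hA' : Primrec A' := Primrec.nat_add.comp
    (Primrec.nat_mul.comp (.const 2) ((primrec_countPhases 4 4).comp hZ))
    (hpow.comp (Primrec.fst.comp hsim'))
  have hB' : Primrec B' := (primrec_countPhases 3 5).comp hZ
  have hq : ∀ {X Y X' Y' : ℕ → ℕ}, Primrec X → Primrec Y → Primrec X' → Primrec Y' → Primrec fun n =>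
      (X n - X' n) * (X n - X' n) + 2 * ((Y n - Y' n) * (Y n - Y' n)) := by
    intro X Y X' Y' hX hY hX' hY'
    have h1 := Primrec.nat_sub.comp hX hX'
    have h2 := Primrec.nat_sub.comp hY hY'
    exact Primrec.nat_add.comp (Primrec.nat_mul.comp h1 h1)
      (Primrec.nat_mul.comp (.const 2) (Primrec.nat_mul.comp h2 h2))
  have hd := Primrec.nat_lt.comp (hq hA' hB' hA hB) (hq hA hB hA' hB')
  refine ⟨_, hd.decide, fun n => ?_⟩
  rw [decide_eq_true_iff, ← add_sqrt_two_lt_iff]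
  have hlen : (ones n).length = n := by simp [ones]
  have hn := h (ones n)
  rw [hlen] at hn
  have hacc := acceptProb_ones (C n)
  have hsum := sum_re_rootEight
    (pairPhases (circuitPaths (C n).gates (0, initPaths n (C n).anc)).2) (by
      intro z hz
      simp only [pairPhases, List.mem_flatMap] at hz
      obtain ⟨p, _, p', _, hz⟩ := hz
      split_ifs at hz
      · simp at hz; omega
      · simp at hz)
  rw [← hacc] at hsum
  have hpos : (0 : ℝ) < 2 ^ (circuitPaths (C n).gates (0, initPaths n (C n).anc)).1 := by positivity
  simp only [A, B, A', B']
  push_cast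
  constructor
  · intro hlt
    by_contra hnot
    have := hn.2 hnot
    nlinarith
  · intro hin
    have := hn.1 hin
    nlinarith

/-! ### Majorities -/

theorem countStep_replicate (j : ℕ) (c a : Bool) : countStep (List.replicate j c) a =
    if j = 0 then [a] else if c = a then List.replicate (j + 1) c else List.replicate (j - 1) c := by
  cases j with
  | zero => simp [countStep]
  | succ j =>
    by_cases h : c = a
    · subst h; simp [countStep, List.replicate_succ]
    · simp [countStep, List.replicate_succ, h]

/-- A counter of `j` equal bits stands for `j` net votes for that bit. The hypothesis says that `b`
wins once the votes in `l` are added, and each step preserves this. -/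
theorem headD_foldl_countStep (b : Bool) (l : List Bool) (j : ℕ) (c : Bool)
    (h : if c = b then l.count (!b) < j + l.count b else j + l.count (!b) < l.count b) :
    (l.foldl countStep (List.replicate j c)).headD false = b := by
  induction l generalizing j c with
  | nil =>
    by_cases hc : c = b
    · rw [if_pos hc] at h
      cases j with
      | zero => simp at h
      | succ j => simp [List.replicate_succ, hc]
    · simp [hc] at h
  | cons a l ih =>
    rw [List.foldl_cons, countStep_replicate]
    by_cases hj : j = 0
    · rw [if_pos hj]
      refine ih 1 a ?_
      subst hj
      cases a <;> cases b <;> cases c <;> simp at h ⊢ <;> omega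
    · rw [if_neg hj]
      by_cases hca : c = a
      · rw [if_pos hca]
        refine ih _ _ ?_
        subst hca
        cases b <;> cases c <;> simp at h ⊢ <;> omega
      · rw [if_neg hca]
        refine ih _ _ ?_
        cases a <;> cases b <;> cases c <;> simp at h hca ⊢ <;> omega

theorem majority_eq {l : List Bool} {b : Bool} (h : l.count (!b) < l.count b) : majority l = b :=
  headD_foldl_countStep b l 0 b (by simpa using h)

/-! ### Advice strings -/

/-- The bits of a string in an advice string. -/
def bitTokens (s : List Bool) : List Bool := s.flatMap fun b => [false, false, b]

/-- An example in an advice string. -/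
def sampleTokens (s : List Bool × Bool) : List Bool := bitTokens s.1 ++ [true, false, s.2]

/-- A block in an advice string. -/
def blockTokens (t : List Bool × TrainingSet) : List Bool :=
  t.2.reverse.flatMap sampleTokens ++ bitTokens t.1

/-- An advice string that describes a nonempty list of blocks. -/
def encodeBlocks : List (List Bool × TrainingSet) → List Bool
  | [] => []
  | [t] => blockTokens t
  | t :: ts => blockTokens t ++ [true, true, true] ++ encodeBlocks ts

theorem decodeBlocks_bitTokens (s rest w : List Bool) (T : TrainingSet) :
    decodeBlocks (bitTokens s ++ rest) w T = decodeBlocks rest (s.reverse ++ w) T := by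
  induction s generalizing w with
  | nil => rfl
  | cons b s ih =>
    have : bitTokens (b :: s) ++ rest = false :: false :: b :: (bitTokens s ++ rest) := rfl
    rw [this, decodeBlocks, ih]
    simp

/-- The decoder puts each new example in front, so the examples are written in reverse order. -/
theorem decodeBlocks_samples (T : TrainingSet) (rest : List Bool) (T' : TrainingSet) :
    decodeBlocks (T.reverse.flatMap sampleTokens ++ rest) [] T' =
      decodeBlocks rest [] (T ++ T') := by
  induction T generalizing rest T' with
  | nil => rfl
  | cons s T ih =>
    rw [List.reverse_cons, List.flatMap_append, List.append_assoc, ih, List.flatMap_singleton,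
      sampleTokens, List.append_assoc, decodeBlocks_bitTokens]
    simp [decodeBlocks]

theorem decodeBlocks_blockTokens (t : List Bool × TrainingSet) (rest : List Bool) :
    decodeBlocks (blockTokens t ++ rest) [] [] = decodeBlocks rest t.1.reverse t.2 := by
  rw [blockTokens, List.append_assoc, decodeBlocks_samples, decodeBlocks_bitTokens]
  simp

/-- The decoder always returns at least one block, which is why the empty list is excluded. -/
theorem decodeBlocks_encodeBlocks (ts : List (List Bool × TrainingSet)) (h : ts ≠ []) :
    decodeBlocks (encodeBlocks ts) [] [] = ts := by
  fun_induction encodeBlocks ts with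
  | case1 => exact absurd rfl h
  | case2 t =>
    have := decodeBlocks_blockTokens t []
    rw [List.append_nil] at this
    rw [this]
    simp [decodeBlocks]
  | case3 t ts hts ih =>
    rw [List.append_assoc, decodeBlocks_blockTokens]
    have : ts ≠ [] := fun h => hts h
    simp [decodeBlocks, ih this]

theorem length_bitTokens (s : List Bool) : (bitTokens s).length = 3 * s.length := by
  simp [bitTokens, List.length_flatMap, mul_comm]

theorem length_encodeBlocks (ts : List (List Bool × TrainingSet)) {n N m : ℕ}
    (h : ∀ t ∈ ts, t.1.length = m ∧ t.2.length = N ∧ ∀ s ∈ t.2, s.1.length = n) :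
    (encodeBlocks ts).length ≤ ts.length * (N * (3 * n + 3) + 3 * m + 3) := by
  have hblock : ∀ t ∈ ts, (blockTokens t).length = N * (3 * n + 3) + 3 * m := by
    intro t ht
    obtain ⟨h1, h2, h3⟩ := h t ht
    have : ∀ T : TrainingSet, (∀ s ∈ T, s.1.length = n) →
        (T.flatMap sampleTokens).length = T.length * (3 * n + 3) := by
      intro T hT
      induction T with
      | nil => simp
      | cons s T ih =>
        rw [List.flatMap_cons, List.length_append, ih fun s hs => hT s (List.mem_cons_of_mem _ hs),
          sampleTokens, List.length_append, length_bitTokens, hT s List.mem_cons_self]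
        simp only [List.length_cons, List.length_nil]
        ring
    rw [blockTokens, List.length_append, length_bitTokens, h1,
      this _ fun s hs => h3 s (List.mem_reverse.1 hs), List.length_reverse, h2]
  clear h
  fun_induction encodeBlocks ts with
  | case1 => simp
  | case2 t => rw [hblock t List.mem_cons_self]; simp
  | case3 t ts hts ih =>
    have := ih fun t ht => hblock t (List.mem_cons_of_mem _ ht)
    rw [List.length_append, List.length_append, hblock t List.mem_cons_self]
    simp only [List.length_cons, List.length_nil]
    rw [Nat.add_mul]
    omega

/-! ### Good training sets and random bits for all inputs of one length -/

theorem support_iid {α : Type} (μ : PMF α) (N : ℕ) :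
    ∀ l ∈ (iid μ N).support, l.length = N ∧ ∀ a ∈ l, a ∈ μ.support := by
  induction N with
  | zero => intro l hl; simp [iid] at hl; subst hl; simp
  | succ N ih =>
    intro l hl
    rw [iid, PMF.mem_support_bind_iff] at hl
    obtain ⟨a, ha, hl⟩ := hl
    rw [PMF.mem_support_map_iff] at hl
    obtain ⟨l', hl', rfl⟩ := hl
    obtain ⟨h1, h2⟩ := ih l' hl'
    refine ⟨by simp [h1], fun b hb => ?_⟩
    rcases List.mem_cons.1 hb with rfl | hb
    · exact ha
    · exact h2 b hb

/-- Averaging. The outcome must lie in the support: only there are the example strings known to have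
length `n`, which bounds the advice. -/
theorem exists_mem_support_lt {α : Type} (μ : PMF α) (f : α → ℝ≥0∞) {c : ℝ≥0∞}
    (h : expect μ f < c) : ∃ a ∈ μ.support, f a < c := by
  by_contra hn
  push Not at hn
  refine absurd h (not_lt.2 ?_)
  rw [← expect_const μ c]
  refine ENNReal.tsum_le_tsum fun a => ?_
  by_cases ha : a ∈ μ.support
  · exact mul_le_mul_right (hn a ha) _
  · rw [PMF.mem_support_iff, not_not] at ha
    simp [ha]

theorem expect_list_sum {α β : Type} (μ : PMF α) (l : List β) (f : β → α → ℝ≥0∞) :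
    expect μ (fun a => (l.map fun x => f x a).sum) = (l.map fun x => expect μ (f x)).sum := by
  induction l with
  | nil => simp [expect_const]
  | cons x l ih => simp only [List.map_cons, List.sum_cons, expect_add, ih]

theorem length_allBits (n : ℕ) : (allBits n).length = 2 ^ n := by
  induction n with
  | zero => rfl
  | succ n ih => simp [allBits, ih, pow_succ, mul_two]

theorem mem_allBits (x : List Bool) : x ∈ allBits x.length := by
  induction x with
  | nil => simp [allBits]
  | cons b x ih => cases b <;> simp [allBits, ih]

/-- Each wrong answer contributes a factor `2`, each right one a factor `1`. -/
theorem prod_weights {α : Type} (l : List α) (f : α → Bool) (b : Bool) :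
    (l.map fun t => 1 + ind (xor (f t) b)).prod = (2 : ℝ≥0∞) ^ (l.map f).count (!b) := by
  induction l with
  | nil => simp
  | cons a l ih =>
    rw [List.map_cons, List.prod_cons, ih, List.map_cons, List.count_cons]
    cases f a <;> cases b <;> simp [pow_succ, one_add_one_eq_two, mul_comm]

/-- The source of the constant `12`: since `(4/3)^12 < 2^5`, each group of twelve outcomes gains a
factor `2` over the threshold `2^6`, enough to pay for the union over `2^n` inputs. -/
theorem pow_bound (n : ℕ) : (2 : ℝ≥0∞) ^ n * (4 / 3) ^ (12 * (n + 1)) < 2 ^ (6 * (n + 1)) := by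
  have h : (4 / 3 : ℝ≥0∞) ^ 12 ≤ 2 ^ 5 := by
    have h1 : (4 / 3 : ℝ≥0∞) = ENNReal.ofReal (4 / 3) := by
      rw [ENNReal.ofReal_div_of_pos (by norm_num)]
      simp
    have h2 : (2 : ℝ≥0∞) = ENNReal.ofReal 2 := by simp
    rw [h1, h2, ← ENNReal.ofReal_pow (by norm_num), ← ENNReal.ofReal_pow (by norm_num)]
    exact ENNReal.ofReal_le_ofReal (by norm_num)
  calc (2 : ℝ≥0∞) ^ n * (4 / 3) ^ (12 * (n + 1)) ≤ 2 ^ n * (2 ^ 5) ^ (n + 1) := by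
        rw [pow_mul]; gcongr
    _ = 2 ^ (6 * n + 5) := by rw [← pow_mul, ← pow_add]; congr 1; ring
    _ < 2 ^ (6 * (n + 1)) := by
        exact_mod_cast Nat.pow_lt_pow_right (by norm_num) (show 6 * n + 5 < 6 * (n + 1) by omega)

/-- If each input of length `n` is answered with error at most `1/3`, then some list of `12(n+1)`
outcomes has the correct majority for all inputs of length `n`. -/
theorem exists_good_outcomes {Ω : Type} (μ : PMF Ω) (n : ℕ) (f : List Bool → Ω → Bool)
    (g : List Bool → Bool)
    (h : ∀ x, x.length = n → expect μ (fun t => ind (xor (f x t) (g x))) ≤ 1 / 3) :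
    ∃ l ∈ (iid μ (12 * (n + 1))).support, ∀ x, x.length = n → majority (l.map (f x)) = g x := by
  have hlen : ∀ n, ∀ x ∈ allBits n, x.length = n := by
    intro n
    induction n with
    | zero => simp [allBits]
    | succ n ih =>
      intro x hx
      simp only [allBits, List.mem_append, List.mem_map] at hx
      rcases hx with ⟨y, hy, rfl⟩ | ⟨y, hy, rfl⟩ <;> simp [ih y hy]
  -- By independence the expectation for one `x` is at most `(1 + 1/3)^(12(n+1))`; the sum over all
  -- inputs serves as the union bound.
  have hE : expect (iid μ (12 * (n + 1))) (fun l => ((allBits n).map fun x =>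
      (l.map fun t => 1 + ind (xor (f x t) (g x))).prod).sum) < 2 ^ (6 * (n + 1)) := by
    rw [expect_list_sum]
    refine lt_of_le_of_lt (List.sum_le_card_nsmul _ ((4 / 3) ^ (12 * (n + 1))) ?_) ?_
    · intro y hy
      obtain ⟨x, hx, rfl⟩ := List.mem_map.1 hy
      rw [expect_iid_prod, expect_add, expect_const]
      gcongr
      refine (add_le_add_right (h x (hlen n x hx)) 1).trans (le_of_eq ?_)
      calc (1 : ℝ≥0∞) + 1 / 3 = 3 / 3 + 1 / 3 := by rw [ENNReal.div_self (by simp) (by simp)]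
        _ = 4 / 3 := by rw [ENNReal.div_add_div_same]; norm_num
    · rw [List.length_map, length_allBits, nsmul_eq_mul]
      push_cast
      exact pow_bound n
  obtain ⟨l, hl, hlt⟩ := exists_mem_support_lt _ _ hE
  refine ⟨l, hl, fun x hx => majority_eq ?_⟩
  -- Each summand is below the total, so every `x` sees fewer than `6(n+1)` wrong answers, less than
  -- half of them.
  have h1 : (l.map fun t => 1 + ind (xor (f x t) (g x))).prod < 2 ^ (6 * (n + 1)) := by
    refine lt_of_le_of_lt (List.single_le_sum (fun _ _ => zero_le) _ ?_) hlt
    exact List.mem_map.2 ⟨x, hx ▸ mem_allBits x, rfl⟩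
  rw [prod_weights] at h1
  have h2 : (l.map (f x)).count (!g x) < 6 * (n + 1) := by
    by_contra hn
    exact absurd h1 (not_lt.2 (pow_le_pow_right₀ (by norm_num) (not_lt.1 hn)))
  have h4 := List.count_not_add_count (l.map (f x)) (g x)
  rw [List.length_map, (support_iid μ _ l hl).1] at h4
  omega

open Classical in
/-- The error probability of a machine whose acceptance probability is bounded. -/
theorem expect_error_le {α : Type} (μ : PMF α) (f : α → Bool) (P : Prop)
    (h1 : P → 2 / 3 ≤ expect μ fun a => ind (f a)) (h2 : ¬P → expect μ (fun a => ind (f a)) ≤ 1 / 3) :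
    expect μ (fun a => ind (xor (f a) (decide P))) ≤ 1 / 3 := by
  by_cases hP : P
  · have h3 := expect_ind_not μ f
    simp only [hP, decide_true, Bool.xor_true]
    have h4 : (1 : ℝ≥0∞) = 2 / 3 + 1 / 3 := by
      rw [ENNReal.div_add_div_same, show (2 + 1 : ℝ≥0∞) = 3 by norm_num,
        ENNReal.div_self (by simp) (by simp)]
    have h5 := h1 hP
    by_contra hn
    rw [not_le] at hn
    refine absurd h3 (ne_of_gt ?_)
    rw [h4]
    exact ENNReal.add_lt_add_of_le_of_lt (ENNReal.div_ne_top (by simp) (by simp)) h5 hn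
  · simpa [hP] using h2 hP

/-- Training set and random bits form one outcome whose law depends only on the input size, so good
outcomes can be fixed for all inputs of that size at once. -/
theorem BPPData_subset_PPoly : BPPData ⊆ PPoly := by
  classical
  rintro L ⟨M, D, N, p, hM, ⟨hD, -⟩, h⟩
  let μ : ℕ → PMF (List Bool × TrainingSet) := fun n =>
    (iid (D n) (N.eval n)).bind fun zs => (randomBits (p.eval n)).map fun r => (r, labelled L zs)
  have hμ : ∀ n, ∀ t ∈ (μ n).support, t.1.length = p.eval n ∧ t.2.length = N.eval n ∧
      ∀ s ∈ t.2, s.1.length = n := by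
    intro n t ht
    simp only [μ] at ht
    rw [PMF.mem_support_bind_iff] at ht
    obtain ⟨zs, hzs, ht⟩ := ht
    rw [PMF.mem_support_map_iff] at ht
    obtain ⟨r, hr, rfl⟩ := ht
    obtain ⟨h1, h2⟩ := support_iid _ _ zs hzs
    refine ⟨(support_iid _ _ r hr).1, by simpa [labelled] using h1, fun s hs => ?_⟩
    simp only [labelled, List.mem_map] at hs
    obtain ⟨z, hz, rfl⟩ := hs
    exact hD n z (h2 z hz)
  have hgood : ∀ n, ∃ l ∈ (iid (μ n) (12 * (n + 1))).support, ∀ x : List Bool, x.length = n →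
      majority (l.map fun t => M (x, t.2, t.1)) = decide (x ∈ L) := by
    intro n
    refine exists_good_outcomes (μ n) n (fun x t => M (x, t.2, t.1)) (fun x => decide (x ∈ L)) ?_
    rintro x rfl
    refine expect_error_le _ _ _ (fun hx => ?_) (fun hx => ?_)
    · have := (h x).1 hx
      rw [acceptProb_eq] at this
      simpa only [μ, expect_bind, expect_map] using this
    · have := (h x).2 hx
      rw [acceptProb_eq] at this
      simpa only [μ, expect_bind, expect_map] using this
  choose l hl hmaj using hgood
  refine ⟨majorityRun M, fun n => encodeBlocks (l n),
    12 * (Polynomial.X + 1) * (N * (3 * Polynomial.X + 3) + 3 * p + 3), hM.majorityRun,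
    fun n => ?_, fun x => ?_⟩
  · have h1 := support_iid _ _ _ (hl n)
    have h2 := length_encodeBlocks (l n) fun t ht => hμ n t (h1.2 t ht)
    rw [h1.1] at h2
    simpa using h2
  · have h1 := (support_iid _ _ _ (hl x.length)).1
    have h2 : l x.length ≠ [] := by
      intro h
      rw [h] at h1
      simp at h1
    rw [majorityRun, decodeBlocks_encodeBlocks _ h2, hmaj _ x rfl, decide_eq_true_iff]

/-! ### Splitting a random string -/

/-- Every second bit of a string, from the first bit on if the flag is set. -/
def alternate : Bool → List Bool → List Bool
  | _, [] => []
  | true, a :: l => a :: alternate false l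
  | false, _ :: l => alternate true l

/-- Bits at even and at odd positions are independent uniform strings. Interleaving, unlike cutting
in the middle, can be undone by a finite transducer. -/
theorem expect_alternate (m : ℕ) (f : List Bool → List Bool → ℝ≥0∞) :
    expect (randomBits (2 * m)) (fun r => f (alternate true r) (alternate false r)) =
      expect (randomBits m) fun r => expect (randomBits m) fun r' => f r r' := by
  induction m generalizing f with
  | zero => simp [randomBits, expect_iid_zero, alternate]
  | succ m ih =>
    simp only [randomBits] at ih ⊢
    rw [show 2 * (m + 1) = 2 * m + 1 + 1 by ring]
    have ih' := fun a b => ih fun r r' => f (a :: r) (b :: r')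
    simp only [expect_iid_succ, alternate, ih']
    congr 1
    funext a
    -- The first bit of the second string is drawn before the rest of the first string.
    rw [expect_comm]

theorem expect_alternate_left (b : Bool) (m : ℕ) (f : List Bool → ℝ≥0∞) :
    expect (randomBits (2 * m)) (fun r => f (alternate b r)) = expect (randomBits m) f := by
  cases b
  · rw [expect_alternate m fun _ r' => f r', expect_const]
  · rw [expect_alternate m fun r _ => f r]
    simp [expect_const]

/-- The transitions of a transducer that maps the first string of its input bit by bit, takes
every second bit of the second string, and drops the rest. -/
def altStep (g : Bool → Bool) (b₀ : Bool) :
    Option (Option Bool) → Option Bool → Option (Option Bool) × Option (Option Bool)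
  | none, some a => (none, some (some (g a)))
  | none, none => (some (some b₀), some none)
  | some (some b), some a => (some (some !b), cond b (some (some a)) none)
  | some (some _), none => (some none, some none)
  | some none, _ => (some none, none)

/-- The arbitrary remainder `s` lets one transducer serve pair tapes and learner tapes alike,
dropping the examples of the latter. -/
theorem transduce_altStep (g : Bool → Bool) (b₀ : Bool) (x r : List Bool) (s : List (Option Bool)) :
    transduce (altStep g b₀) (fun _ => none) none (x.map some ++ none :: (r.map some ++ none :: s)) =
      encPair (x.map g, alternate b₀ r) := by
  have h1 : ∀ s, transduce (altStep g b₀) (fun _ => none) (some none) s = [] := by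
    intro s
    induction s with
    | nil => rfl
    | cons a s ih => simp [transduce, altStep, ih]
  have h2 : ∀ b, transduce (altStep g b₀) (fun _ => none) (some (some b))
      (r.map some ++ none :: s) = (alternate b r).map some ++ [none] := by
    induction r with
    | nil => intro b; simp [transduce, altStep, h1, alternate]
    | cons a r ih => intro b; cases b <;> simp [transduce, altStep, alternate, ih]
  induction x with
  | nil => simp [transduce, altStep, h2, encPair, encStrings]
  | cons a x ih =>
    simp only [List.map_cons, List.cons_append, transduce, altStep, ih]
    simp [encPair, encStrings]

theorem PolyTime.alternate_pair {M : List Bool × List Bool → Bool}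
    (hM : PolyTime encPair Computability.encodeBool M) (b : Bool) :
    PolyTime encPair Computability.encodeBool fun q => M (q.1, alternate b q.2) :=
  hM.comp_transducer (fun q : List Bool × List Bool => (q.1, alternate b q.2)) (altStep id b) (fun _ => none) none
    fun q => by
      have := transduce_altStep id b q.1 q.2 []
      rw [List.map_id] at this
      rw [← this]
      simp [encPair, encStrings]

theorem PolyTime.alternate_learner {M : List Bool × List Bool → Bool}
    (hM : PolyTime encPair Computability.encodeBool M) (g : Bool → Bool) (b : Bool) :
    PolyTime encLearner Computability.encodeBool
      fun q : List Bool × TrainingSet × List Bool => M (q.1.map g, alternate b q.2.2) :=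
  hM.comp_transducer (fun q : List Bool × TrainingSet × List Bool =>
    (q.1.map g, alternate b q.2.2)) (altStep g b) (fun _ => none) none
    fun q => by
      rw [← transduce_altStep g b q.1 q.2.2 (encSamples q.2.1), ← encLearner_eq]

/-! ### The first class contains BPP -/

theorem polyTime_ones :
    PolyTime encUnaryPair (id : List Bool → List Bool) fun q : ℕ × List Bool => ones q.1 := by
  have hid : PolyTime (id : List Bool → List Bool) id id :=
    ⟨Turing.idComputableInPolyTime _⟩
  let δ : Bool → Option Bool → Bool × Option Bool := fun q a =>
    match q, a with
    | true, some a => (true, some a)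
    | _, _ => (false, none)
  refine hid.comp_transducer (fun q : ℕ × List Bool => ones q.1) δ (fun _ => none) true fun q => ?_
  have h1 : ∀ s, transduce δ (fun _ => none) false s = [] := by
    intro s
    induction s with
    | nil => rfl
    | cons a s ih => simp [transduce, δ, ih]
  have h2 : ∀ (w : List Bool) (s : List (Option Bool)),
      transduce δ (fun _ => none) true (w.map some ++ none :: s) = w := by
    intro w s
    induction w with
    | nil => simp [transduce, δ, h1]
    | cons a w ih => exact congrArg (List.cons a) ih
  have := h2 (ones q.1) (q.2.map some ++ [none])
  simp only [id]
  rw [← this, encUnaryPair]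
  congr 1
  simp [encStrings]

theorem polyTimeSamplable_ones : PolyTimeSamplable fun n => PMF.pure (ones n) := by
  refine ⟨fun n z hz => ?_, fun q => ones q.1, 0, polyTime_ones, fun n => ?_⟩
  · simp at hz
    simp [hz, ones]
  · exact (PMF.map_const _ _).symm

/-- A learner may ignore data, so no example is drawn. The number of random bits is doubled because
the transducer passes on only every second one. -/
theorem BPP_subset_BPPData : BPP ⊆ BPPData := by
  rintro L ⟨M, p, hM, h⟩
  refine ⟨_, fun n => PMF.pure (ones n), 0, 2 * p, hM.alternate_learner id true,
    polyTimeSamplable_ones, fun x => ?_⟩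
  have h' := h x
  simp only [apply_true_eq_expect, expect_map] at h'
  simp only [acceptProb_eq, Polynomial.eval_zero, expect_iid_zero, List.map_id,
    Polynomial.eval_mul, Polynomial.eval_ofNat,
    expect_alternate_left true _ fun r => ind (M (x, r))]
  exact h'

/-! ### Error reduction -/

/-- `M` decides `L` with `p` random bits and error at most `e`. -/
def DecidesWithError (L : Language Bool) (M : List Bool × List Bool → Bool) (p : Polynomial ℕ)
    (e : ℝ) : Prop :=
  open Classical in
  PolyTime encPair Computability.encodeBool M ∧ ∀ x : List Bool,
    (expect (randomBits (p.eval x.length)) fun r => ind (xor (M (x, r)) (decide (x ∈ L)))).toReal ≤ e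

theorem exists_decidesWithError {L : Language Bool} (hL : L ∈ BPP) :
    ∃ M p, DecidesWithError L M p (1 / 3) := by
  classical
  obtain ⟨M, p, hM, h⟩ := hL
  refine ⟨M, p, hM, fun x => ?_⟩
  have h' := h x
  simp only [apply_true_eq_expect, expect_map] at h'
  have := expect_error_le (randomBits (p.eval x.length)) (fun r => M (x, r)) (x ∈ L) h'.1 h'.2
  have := ENNReal.toReal_mono (by simp) this
  convert this using 1
  simp

/-- The majority of three bits. -/
def maj3 (a b c : Bool) : Bool := (a && b) || (c && (a || b))

theorem maj3_xor (a b c d : Bool) : xor (maj3 a b c) d = maj3 (xor a d) (xor b d) (xor c d) := by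
  cases a <;> cases b <;> cases c <;> cases d <;> rfl

/-- A majority errs if the first two runs err, or if exactly one of them and the third do: `q² +
2q²(1 - q)`. -/
theorem expect_maj3 {α : Type} (μ : PMF α) (w : α → Bool) :
    (expect μ fun u => expect μ fun s => expect μ fun t => ind (maj3 (w u) (w s) (w t))) =
      expect μ (fun u => ind (w u)) ^ 2 + 2 * (expect μ (fun u => ind (w u)) ^ 2 *
        expect μ (fun u => ind (!w u))) := by
  have h : ∀ a b c, ind (maj3 a b c) =
      ind a * ind b + (ind a * ind (!b) + ind (!a) * ind b) * ind c := by
    intro a b c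
    cases a <;> cases b <;> cases c <;> simp [maj3]
  simp only [h, expect_add, expect_const_mul, expect_const, expect_mul_const]
  ring

theorem toReal_expect_not {α : Type} (μ : PMF α) (w : α → Bool) :
    (expect μ fun u => ind (!w u)).toReal = 1 - (expect μ fun u => ind (w u)).toReal := by
  have h := congrArg ENNReal.toReal (expect_ind_not μ w)
  rw [ENNReal.toReal_add (ne_top_of_le_ne_top ENNReal.one_ne_top (expect_ind_le_one μ w))
    (ne_top_of_le_ne_top ENNReal.one_ne_top (expect_ind_le_one μ fun u => !w u))] at h
  rw [ENNReal.toReal_one] at h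
  linarith

/-- Splitting the random string twice gives four independent quarters, three of which are used. -/
theorem DecidesWithError.maj3 {L : Language Bool} {M : List Bool × List Bool → Bool}
    {p : Polynomial ℕ} {e : ℝ} (h : DecidesWithError L M p e) (he : e ≤ 1) :
    ∃ M' p', DecidesWithError L M' p' (3 * e ^ 2 - 2 * e ^ 3) := by
  classical
  obtain ⟨hM, h⟩ := h
  have h1 : ∀ b b', PolyTime encPair Computability.encodeBool
      fun q => M (q.1, alternate b (alternate b' q.2)) := fun b b' =>
    (hM.alternate_pair b).alternate_pair b'
  refine ⟨fun q => DataLearning.maj3 (M (q.1, alternate true (alternate true q.2)))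
    (M (q.1, alternate true (alternate false q.2))) (M (q.1, alternate false (alternate false q.2))),
    2 * (2 * p), ?_, fun x => ?_⟩
  · exact ((h1 true true).boolOp (h1 true false) and).boolOp
      ((h1 false false).boolOp ((h1 true true).boolOp (h1 true false) or) and) or
  · have hx := h x
    simp only [maj3_xor, Polynomial.eval_mul, Polynomial.eval_ofNat]
    set μ := randomBits (p.eval x.length) with hμ
    let w : List Bool → Bool := fun r => xor (M (x, r)) (decide (x ∈ L))
    have h2 : (expect (randomBits (2 * (2 * p.eval x.length))) fun r =>
        ind (DataLearning.maj3 (w (alternate true (alternate true r)))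
          (w (alternate true (alternate false r))) (w (alternate false (alternate false r))))) =
        expect μ fun u => expect μ fun s => expect μ fun t =>
          ind (DataLearning.maj3 (w u) (w s) (w t)) := by
      rw [expect_alternate _ fun r r' => ind (DataLearning.maj3 (w (alternate true r))
        (w (alternate true r')) (w (alternate false r')))]
      have h3 := fun a => expect_alternate (p.eval x.length) fun s t =>
        ind (DataLearning.maj3 a (w s) (w t))
      simp only [h3]
      exact expect_alternate_left true _ fun u => expect μ fun s => expect μ fun t =>
          ind (DataLearning.maj3 (w u) (w s) (w t))
    have h3 := (h2.trans (expect_maj3 μ w))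
    have h4 : ∀ v : List Bool → Bool, expect μ (fun u => ind (v u)) ≠ ⊤ := fun v =>
      ne_top_of_le_ne_top ENNReal.one_ne_top (expect_ind_le_one μ v)
    have h4' := h4 fun u => !w u
    change (expect (randomBits (2 * (2 * p.eval x.length))) fun r =>
        ind (DataLearning.maj3 (w (alternate true (alternate true r)))
          (w (alternate true (alternate false r)))
            (w (alternate false (alternate false r))))).toReal ≤ _
    rw [h3, ENNReal.toReal_add (ENNReal.pow_ne_top (h4 w)) (ENNReal.mul_ne_top (by simp)
      (ENNReal.mul_ne_top (ENNReal.pow_ne_top (h4 w)) h4')), ENNReal.toReal_mul,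
      ENNReal.toReal_mul, ENNReal.toReal_pow, toReal_expect_not]
    have h5 : 0 ≤ (expect μ fun u => ind (w u)).toReal := ENNReal.toReal_nonneg
    have h6 : (expect μ fun u => ind (w u)).toReal ≤ e := hx
    set q := (expect μ fun u => ind (w u)).toReal
    rw [ENNReal.toReal_ofNat]
    -- The polynomial `3q² - 2q³` is increasing on `[0, 1]`, so `q ≤ e ≤ 1` suffices.
    nlinarith [mul_nonneg h5 (sub_nonneg.2 h6), mul_nonneg h5 (sub_nonneg.2 he),
      mul_nonneg (mul_nonneg h5 (sub_nonneg.2 h6)) (sub_nonneg.2 he),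
      mul_nonneg (mul_nonneg h5 (sub_nonneg.2 h6)) h5,
      mul_nonneg (sub_nonneg.2 h6) (sub_nonneg.2 he), sq_nonneg (e - q),
      mul_nonneg (mul_nonneg (sub_nonneg.2 h6) (h5.trans h6)) (sub_nonneg.2 he)]

/-- Two rounds take `1/3` to `7/27` and then to about `0.167`. One round would not do: an exclusive
or of two answers with error `7/27` may err with probability above `1/3`. -/
theorem exists_small_error {L : Language Bool} (hL : L ∈ BPP) :
    ∃ M p, DecidesWithError L M p (1 / 5) := by
  obtain ⟨M, p, h⟩ := exists_decidesWithError hL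
  obtain ⟨M₁, p₁, h₁⟩ := h.maj3 (by norm_num)
  obtain ⟨M₂, p₂, h₂⟩ := h₁.maj3 (by norm_num)
  exact ⟨M₂, p₂, h₂.1, fun x => (h₂.2 x).trans (by norm_num)⟩

/-! ### The separating language -/

/-- The label of the first example. -/
def firstLabel (T : TrainingSet) : Bool := (T.head?.map Prod.snd).getD false

/-- States `0`, `1`, `2` skip the input, the random bits and the first example string; state `3`
emits the label, state `4` discards the rest. Without any example, `fin` supplies `false`. -/
theorem polyTime_firstLabel : PolyTime encLearner Computability.encodeBool
    fun q : List Bool × TrainingSet × List Bool => firstLabel q.2.1 := by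
  have hid : PolyTime Computability.encodeBool Computability.encodeBool id :=
    ⟨Turing.idComputableInPolyTime _⟩
  let δ : Fin 5 → Option Bool → Fin 5 × Option Bool := fun q a =>
    if q = 4 then (4, none) else if q = 3 then (4, some (a.getD false)) else
      match a with
      | some _ => (q, none)
      | none => (q + 1, none)
  let fin : Fin 5 → Option Bool := fun q => if q = 4 then none else some false
  refine hid.comp_transducer (fun q : List Bool × TrainingSet × List Bool => firstLabel q.2.1) δ fin 0 fun q => ?_
  have h4 : ∀ s, transduce δ fin 4 s = [] := by
    intro s
    induction s with
    | nil => simp [transduce, fin]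
    | cons a s ih => simp [transduce, δ, ih]
  have hskip : ∀ (i : Fin 5), i ≠ 4 → i ≠ 3 → ∀ (w : List Bool) s,
      transduce δ fin i (w.map some ++ none :: s) = transduce δ fin (i + 1) s := by
    intro i hi hi' w s
    induction w with
    | nil => simp [transduce, δ, hi, hi']
    | cons a w ih =>
      simp only [List.map_cons, List.cons_append, transduce]
      simp only [δ, if_neg hi, if_neg hi', Option.toList_none, List.nil_append]
      exact ih
  obtain ⟨x, T, r⟩ := q
  rw [encLearner_eq, hskip 0 (by decide) (by decide), hskip _ (by decide) (by decide)]
  cases T with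
  | nil => simp [encSamples_nil, transduce, fin, firstLabel, Computability.encodeBool]
  | cons s T =>
    rw [encSamples_cons, hskip _ (by decide) (by decide)]
    have h3 : (0 + 1 + 1 + 1 : Fin 5) = 3 := rfl
    rw [h3, transduce]
    simp [δ, h4, firstLabel, Computability.encodeBool]

theorem combined_mem_BPPData (Lhard : Language Bool) {Leasy : Language Bool} (hL : Leasy ∈ BPP) :
    combined Lhard Leasy ∈ BPPData := by
  classical
  obtain ⟨M, p, hM, h⟩ := exists_small_error hL
  refine ⟨fun q => xor (xor (M (q.1.map id, alternate true q.2.2))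
    (M (q.1.map (fun _ => true), alternate false q.2.2))) (firstLabel q.2.1),
    fun n => PMF.pure (ones n), 1, 2 * p,
    ((hM.alternate_learner id true).boolOp (hM.alternate_learner (fun _ => true) false) xor).boolOp
      polyTime_firstLabel xor, polyTimeSamplable_ones, fun x => ?_⟩
  set L := combined Lhard Leasy
  have hmap : x.map (fun _ => true) = ones x.length := by simp [ones]
  have hlen : (ones x.length).length = x.length := by simp [ones]
  have hlabel : firstLabel (labelled L [ones x.length]) = decide (ones x.length ∈ L) := by
    simp [firstLabel, labelled]
  -- In size `n ≥ 1`, `L` is `Leasy` or its complement, the same choice for `x` and `1ⁿ`, so the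
  -- choice cancels. In size `0`, `x` is `1⁰` itself.
  have hmem : decide (x ∈ L) =
      xor (xor (decide (x ∈ Leasy)) (decide (ones x.length ∈ Leasy)))
        (decide (ones x.length ∈ L)) := by
    rcases Nat.eq_zero_or_pos x.length with h0 | h0
    · have hx : x = ones x.length := by rw [List.length_eq_zero_iff.1 h0]; rfl
      rw [← hx]
      simp
    · have hiff : ∀ z : List Bool, z.length = x.length → (z ∈ L ↔ ((z ∈ Leasy ∧
          ones x.length ∈ Lhard) ∨ (z ∉ Leasy ∧ ones x.length ∉ Lhard))) := by
        intro z hz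
        constructor
        · rintro ⟨n, -, hn, hz'⟩
          rwa [← hz, hn]
        · intro hz'
          exact ⟨x.length, h0, hz, hz'⟩
      have h1 := hiff x rfl
      have h2 := hiff _ hlen
      by_cases a : x ∈ Leasy <;> by_cases b : ones x.length ∈ Leasy <;>
        by_cases c : ones x.length ∈ Lhard <;> simp [a, b, c] at h1 h2 ⊢ <;> simp [h1, h2]
  set μ := randomBits (p.eval x.length) with hμ
  let w : List Bool → Bool := fun r => xor (M (x, r)) (decide (x ∈ Leasy))
  let w' : List Bool → Bool := fun r =>
    xor (M (ones x.length, r)) (decide (ones x.length ∈ Leasy))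
  have hw : (expect μ fun r => ind (w r)).toReal ≤ 1 / 5 := h x
  have hw' : (expect μ fun r => ind (w' r)).toReal ≤ 1 / 5 := by
    have := h (ones x.length)
    rwa [hlen] at this
  have hpos : 0 ≤ (expect μ fun r => ind (w r)).toReal := ENNReal.toReal_nonneg
  have hpos' : 0 ≤ (expect μ fun r => ind (w' r)).toReal := ENNReal.toReal_nonneg
  have htop : ∀ v : List Bool → Bool, expect μ (fun u => ind (v u)) ≠ ⊤ := fun v =>
    ne_top_of_le_ne_top ENNReal.one_ne_top (expect_ind_le_one μ v)
  -- The answer differs from the truth exactly when one of the two runs errs and the other does not;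
  -- `d` selects the probability of error or of success.
  have hacc : ∀ d : Bool, expect (randomBits (2 * p.eval x.length)) (fun r =>
      ind (xor (xor (xor (M (x, alternate true r)) (M (ones x.length, alternate false r)))
        (decide (ones x.length ∈ L))) (xor d (decide (x ∈ L))))) =
      expect μ fun r => expect μ fun r' => ind (xor (xor (w r) (w' r')) d) := by
    intro d
    rw [← expect_alternate]
    congr 1
    funext r
    congr 1
    rw [hmem]
    simp only [w, w']
    generalize decide (x ∈ Leasy) = a
    generalize decide (ones x.length ∈ Leasy) = b
    generalize decide (ones x.length ∈ L) = c
    generalize M (x, alternate true r) = e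
    generalize M (ones x.length, alternate false r) = f
    cases a <;> cases b <;> cases c <;> cases d <;> cases e <;> cases f <;> rfl
  have hxor : ∀ a b, ind (xor a b) = ind a * ind (!b) + ind (!a) * ind b := by
    intro a b; cases a <;> cases b <;> simp
  have hxnor : ∀ a b, ind (!xor a b) = ind a * ind b + ind (!a) * ind (!b) := by
    intro a b; cases a <;> cases b <;> simp
  have hval : acceptProb L (fun q : List Bool × TrainingSet × List Bool =>
      xor (xor (M (q.1.map id, alternate true q.2.2))
      (M (q.1.map (fun _ => true), alternate false q.2.2))) (firstLabel q.2.1))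
      (PMF.pure (ones x.length)) (Polynomial.eval x.length 1) (Polynomial.eval x.length (2 * p)) x =
      expect (randomBits (2 * p.eval x.length)) (fun r =>
        ind (xor (xor (M (x, alternate true r)) (M (ones x.length, alternate false r)))
          (decide (ones x.length ∈ L)))) := by
    rw [acceptProb_eq, Polynomial.eval_one, Polynomial.eval_mul, Polynomial.eval_ofNat]
    refine (expect_iid_succ _ 0 _).trans ?_
    simp only [expect_iid_zero, expect_pure, hmap, List.map_id, hlabel]
  rw [hval]
  constructor
  · intro hx
    have h1 := hacc true
    simp only [hx, decide_true, Bool.xor_self, Bool.xor_false, Bool.xor_true] at h1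
    rw [h1]
    simp only [hxnor, expect_add, expect_const_mul, expect_mul_const]
    rw [← ENNReal.toReal_le_toReal (ENNReal.div_ne_top (by simp) (by simp)) (ENNReal.add_ne_top.2
      ⟨ENNReal.mul_ne_top (htop w) (htop w'), ENNReal.mul_ne_top (htop fun u => !w u)
        (htop fun u => !w' u)⟩), ENNReal.toReal_add (ENNReal.mul_ne_top (htop w) (htop w'))
      (ENNReal.mul_ne_top (htop fun u => !w u) (htop fun u => !w' u)), ENNReal.toReal_mul,
      ENNReal.toReal_mul, toReal_expect_not, toReal_expect_not]
    simp only [ENNReal.toReal_div, ENNReal.toReal_ofNat]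
    -- Both errors are at most `1/5`, so the success probability is at least `17/25 > 2/3`.
    nlinarith
  · intro hx
    have h1 := hacc false
    simp only [hx, decide_false, Bool.xor_self, Bool.xor_false] at h1
    rw [h1]
    simp only [hxor, expect_add, expect_const_mul, expect_mul_const]
    rw [← ENNReal.toReal_le_toReal (ENNReal.add_ne_top.2
      ⟨ENNReal.mul_ne_top (htop w) (htop fun u => !w' u), ENNReal.mul_ne_top (htop fun u => !w u)
        (htop w')⟩) (ENNReal.div_ne_top (by simp) (by simp)),
      ENNReal.toReal_add (ENNReal.mul_ne_top (htop w) (htop fun u => !w' u))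
      (ENNReal.mul_ne_top (htop fun u => !w u) (htop w')), ENNReal.toReal_mul,
      ENNReal.toReal_mul, toReal_expect_not, toReal_expect_not]
    simp only [ENNReal.toReal_div, ENNReal.toReal_ofNat, ENNReal.toReal_one]
    nlinarith

/-- The separating language is not decidable on the words `1ⁿ`. -/
theorem not_primrec_combined {A : Set ℕ} {Leasy : Language Bool}
    (hA : Undecidable (unaryLanguage A)) (hL : Leasy ∈ BPP) :
    ¬∃ d : ℕ → Bool, Primrec d ∧ ∀ n, d n = true ↔ ones n ∈ combined (unaryLanguage A) Leasy := by
  classical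
  rintro ⟨d, hd, hdL⟩
  obtain ⟨e, he, heL⟩ := exists_primrec_of_mem_BPP hL
  have hlen : ∀ n, (ones n).length = n := fun n => by simp [ones]
  have hpos : ∀ n, 1 ≤ n → (ones n ∈ unaryLanguage A ↔ d n = e n) := by
    intro n hn
    have h1 : ones n ∈ combined (unaryLanguage A) Leasy ↔
        ((ones n ∈ Leasy ∧ ones n ∈ unaryLanguage A) ∨
          (ones n ∉ Leasy ∧ ones n ∉ unaryLanguage A)) := by
      constructor
      · rintro ⟨m, -, hm, h⟩
        rw [hlen] at hm
        rwa [← hm] at h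
      · intro h
        exact ⟨n, hn, hlen n, h⟩
    rw [← hdL, ← heL] at h1
    by_cases a : ones n ∈ unaryLanguage A <;> cases h : d n <;> cases h' : e n <;>
      simp [a, h, h'] at h1 ⊢
  -- `combined` says nothing about the empty word; its membership in the hard language is one bit,
  -- built into the decision procedure.
  let c : Bool := decide (ones 0 ∈ unaryLanguage A)
  have hdec : PrimrecPred fun w : List Bool => w = ones w.length ∧
      (w.length = 0 ∧ c = true ∨ ¬w.length = 0 ∧ d w.length = e w.length) := by
    have hl := Primrec.list_length (α := Bool)
    exact PrimrecPred.and (Primrec.eq.comp Primrec.id (primrec_ones.comp hl))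
      (PrimrecPred.or (PrimrecPred.and (Primrec.eq.comp hl (.const 0))
          (Primrec.eq.comp (.const c) (.const true)))
        (PrimrecPred.and (PrimrecPred.not (Primrec.eq.comp hl (.const 0)))
          (Primrec.eq.comp (hd.comp hl) (he.comp hl))))
  refine hA (ComputablePred.of_eq (p := fun w : List Bool => w = ones w.length ∧
    (w.length = 0 ∧ c = true ∨ ¬w.length = 0 ∧ d w.length = e w.length))
    ⟨inferInstance, hdec.decide.to_comp⟩ fun w => ?_)
  constructor
  · rintro ⟨hw, ⟨h0, hc⟩ | ⟨h0, hde⟩⟩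
    · rw [h0] at hw
      rw [hw]
      exact of_decide_eq_true hc
    · rw [hw]
      exact (hpos _ (Nat.one_le_iff_ne_zero.2 h0)).2 hde
  · intro hw
    have hw' : w = ones w.length := by
      obtain ⟨n, -, rfl⟩ := hw
      rw [hlen]
    refine ⟨hw', ?_⟩
    by_cases h0 : w.length = 0
    · rw [hw', h0] at hw
      exact Or.inl ⟨h0, decide_eq_true hw⟩
    · rw [hw'] at hw
      exact Or.inr ⟨h0, (hpos _ (Nat.one_le_iff_ne_zero.2 h0)).1 hw⟩

/-! ### Existence of a separating language -/

/-- The strings whose first bit is `1`. -/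
def firstBitLanguage : Language Bool := {x | x.headD false = true}

theorem firstBitLanguage_mem_BPP : firstBitLanguage ∈ BPP := by
  have hid : PolyTime Computability.encodeBool Computability.encodeBool id :=
    ⟨Turing.idComputableInPolyTime _⟩
  -- Only the first tape symbol is emitted; for the empty word this is the end marker, which reads
  -- as `false`.
  let δ : Bool → Option Bool → Bool × Option Bool := fun q a =>
    cond q (true, none) (true, some (a.getD false))
  refine ⟨fun q => q.1.headD false, 0, hid.comp_transducer
    (fun q : List Bool × List Bool => q.1.headD false) δ
    (fun _ => none) false fun q => ?_, fun x => ?_⟩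
  · have h1 : ∀ s, transduce δ (fun _ => none) true s = [] := by
      intro s
      induction s with
      | nil => rfl
      | cons a s ih => simp [transduce, δ, ih]
    obtain ⟨x, r⟩ := q
    cases x <;> simp [encPair, encStrings, transduce, δ, h1, Computability.encodeBool]
  · simp only [apply_true_eq_expect, expect_map, expect_const]
    constructor
    · intro hx
      have : x.headD false = true := hx
      rw [this, ind_true]
      refine ENNReal.div_le_of_le_mul ?_
      norm_num
    · intro hx
      have : x.headD false = false := Bool.eq_false_iff.2 hx
      rw [this, ind_false]
      exact zero_le

/-- The halting problem on input `0`, with programs numbered and numbers written in unary; the map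
from a program to its unary word is computable. -/
theorem exists_undecidable_unaryLanguage : ∃ A : Set ℕ, Undecidable (unaryLanguage A) := by
  refine ⟨{n | (Nat.Partrec.Code.eval (Denumerable.ofNat Nat.Partrec.Code n) 0).Dom}, fun h => ?_⟩
  refine ComputablePred.halting_problem 0 ?_
  obtain ⟨hdec, hc⟩ := h
  have h1 : Computable fun c : Nat.Partrec.Code => ones (Encodable.encode c) :=
    (primrec_ones.comp Primrec.encode).to_comp
  refine ComputablePred.of_eq (p := fun c : Nat.Partrec.Code => ones (Encodable.encode c) ∈
    unaryLanguage {n | (Nat.Partrec.Code.eval (Denumerable.ofNat Nat.Partrec.Code n) 0).Dom})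
    ⟨fun c => hdec _, hc.comp h1⟩ fun c => ?_
  constructor
  · rintro ⟨n, hn, h⟩
    have : Encodable.encode c = n := by simpa [ones] using congrArg List.length h
    rw [← this] at hn
    simpa using hn
  · intro h
    exact ⟨_, by simpa using h, rfl⟩

end DataLearning

end

theorem mainTheorem7 :
    DataLearning.BPP ⊆ DataLearning.BPPData ∧
    DataLearning.BPPData ⊆ DataLearning.PPoly ∧
    (∀ (A : Set ℕ) (Leasy : Language Bool),
      DataLearning.Undecidable (DataLearning.unaryLanguage A) →
      Leasy ∈ DataLearning.BPP →
      (∀ n : ℕ, 1 ≤ n →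
        (∃ a : List Bool, a.length = n ∧ a ∈ Leasy) ∧
        (∃ b : List Bool, b.length = n ∧ b ∉ Leasy)) →
      DataLearning.combined (DataLearning.unaryLanguage A) Leasy ∈ DataLearning.BPPData ∧
      DataLearning.combined (DataLearning.unaryLanguage A) Leasy ∉ DataLearning.BPP ∧
      DataLearning.combined (DataLearning.unaryLanguage A) Leasy ∉ DataLearning.BQP) ∧
    (∃ L ∈ DataLearning.BPPData, L ∉ DataLearning.BPP ∧ L ∉ DataLearning.BQP) := by
  have key : ∀ (A : Set ℕ) (Leasy : Language Bool),
      DataLearning.Undecidable (DataLearning.unaryLanguage A) → Leasy ∈ DataLearning.BPP →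
      DataLearning.combined (DataLearning.unaryLanguage A) Leasy ∈ DataLearning.BPPData ∧
      DataLearning.combined (DataLearning.unaryLanguage A) Leasy ∉ DataLearning.BPP ∧
      DataLearning.combined (DataLearning.unaryLanguage A) Leasy ∉ DataLearning.BQP :=
    fun A Leasy hA hL => ⟨DataLearning.combined_mem_BPPData _ hL,
      fun h => DataLearning.not_primrec_combined hA hL (DataLearning.exists_primrec_of_mem_BPP h),
      fun h => DataLearning.not_primrec_combined hA hL (DataLearning.exists_primrec_of_mem_BQP h)⟩
  refine ⟨DataLearning.BPP_subset_BPPData, DataLearning.BPPData_subset_PPoly,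
    fun A Leasy hA hL _ => key A Leasy hA hL, ?_⟩
  obtain ⟨A, hA⟩ := DataLearning.exists_undecidable_unaryLanguage
  exact ⟨_, key A _ hA DataLearning.firstBitLanguage_mem_BPP⟩
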